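/- Let $M=\mathbb S^3\times\mathbb S^1$ with its smooth structure and a fixed orientation (either one). Let $\mathcal I(M)$ be the set of smooth endomorphisms $J$ of $TM$ with $J^2=-\mathrm{Id}$ that are integrable ($[T^{0,1},T^{0,1}]\subset T^{0,1}$, where $T^{0,1}=\{v+iJv\}$) and induce the given orientation, with the $C^\infty$-topology. Let $\mathrm{Diff}^0(M)$ be the group of diffeomorphisms of $M$ that are $C^\infty$-isotopic to the identity, acting by $J\cdot f=(df)^{-1}\circ J\circ df$, and let the Teichmüller space $\mathcal T(M)=\mathcal I(M)/\mathrm{Diff}^0(M)$ carry the quotient topology. For an invertible contracting matrix $A\in GL_2(\mathbb C)$, let $X_A$ be the Hopf surface $(\mathbb C^2\setminus\{0\})/\langle A\rangle$. Then the topological space $\mathcal T(M)$ is not locally Hausdorff (some point has no Hausdorff neighbourhood), and it cannot be endowed with the structure of a complex analytic space, even a non-Hausdorff one (that is, a sheaf of $\mathbb C$-algebras on it making it a ringed space locally isomorphic to the zero set of finitely many holomorphic functions $f_1,\dots,f_k$ on an open set $U\subset\mathbb C^n$, with structure sheaf $\mathcal O_U/(f_1,\dots,f_k)$). More precisely, let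 $\lambda\in\mathbb C$ with $0<|\lambda|<1$. There is $J\in\mathcal I(M)$ such that $(M,J)$ is biholomorphic to $X_{\lambda I}$. For every $J_0\in\mathcal I(M)$ with $(M,J_0)$ biholomorphic to $X_{\lambda I}$, let $C$ be the connected component of $J_0$ in $\mathcal I(M)$ and let $\mathcal T_C$ be the quotient of $C$ by the relation of being in the same $\mathrm{Diff}^0(M)$-orbit, with the quotient topology. Then $\mathcal T_C$ also is not locally Hausdorff and has no structure of an analytic space, even a non-Hausdorff one; and there is $J_1\in C$ with $(M,J_1)$ biholomorphic to $X_{\left(\begin{smallmatrix}\lambda&1\\0&\lambda\end{smallmatrix}\right)}$ such that the classes of $J_0$ and $J_1$ in $\mathcal T(M)$ are distinct and have no disjoint neighbourhoods, and such that every neighbourhood of the class of $J_0$ in $\mathcal T_C$ contains the class of $J_1$. -/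

import Mathlib

open Topology Manifold ContDiff CategoryTheory TopologicalSpace Opposite

noncomputable section

/-! ### Complex analytic spaces, not necessarily Hausdorff -/

namespace AnalyticSpace

/-- The algebra of holomorphic functions on an open subset `V` of `ℂⁿ`. -/
def Holo {n : ℕ} (V : Opens (Fin n → ℂ)) : Subalgebra ℂ (V → ℂ) where
  carrier := {g | ∃ G : (Fin n → ℂ) → ℂ, DifferentiableOn ℂ G V ∧ ∀ z : V, g z = G z}
  mul_mem' := by
    rintro _ _ ⟨G, hG, h⟩ ⟨G', hG', h'⟩
    exact ⟨fun z => G z * G' z, hG.mul hG', fun z => by simp [h, h']⟩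
  add_mem' := by
    rintro _ _ ⟨G, hG, h⟩ ⟨G', hG', h'⟩
    exact ⟨fun z => G z + G' z, hG.add hG', fun z => by simp [h, h']⟩
  algebraMap_mem' c := ⟨fun _ => c, differentiableOn_const c, fun _ => rfl⟩

/-- Restriction of holomorphic functions to a smaller open set. -/
def Holo.res {n : ℕ} {V V' : Opens (Fin n → ℂ)} (h : V' ≤ V) : Holo V →ₐ[ℂ] Holo V' where
  toFun g := ⟨fun z => g.1 ⟨z.1, h z.2⟩, by
    obtain ⟨G, hG, hg⟩ := g.2
    exact ⟨G, hG.mono h, fun z => hg ⟨z.1, h z.2⟩⟩⟩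
  map_one' := rfl
  map_mul' _ _ := rfl
  map_zero' := rfl
  map_add' _ _ := rfl
  commutes' _ := rfl

/-- For a continuous map `h` defined on an open subset `W` of `X`, the preimage of `V`, as an
open subset of `X`. -/
def preimage {X Y : Type*} [TopologicalSpace X] [TopologicalSpace Y] {W : Opens X} {h : W → Y}
    (hh : Continuous h) (V : Opens Y) : Opens X :=
  ⟨Subtype.val '' (h ⁻¹' (V : Set Y)), W.2.isOpenMap_subtype_val _ (V.2.preimage hh)⟩

theorem preimage_mono {X Y : Type*} [TopologicalSpace X] [TopologicalSpace Y] {W : Opens X}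
    {h : W → Y} (hh : Continuous h) {V V' : Opens Y} (hV : V' ≤ V) :
    preimage hh V' ≤ preimage hh V :=
  Set.image_mono (Set.preimage_mono hV)

/-- Restriction of the sections of a sheaf of `ℂ`-algebras. -/
def sres {X : Type} [TopologicalSpace X] (O : TopCat.Sheaf (CommAlgCat.{0} ℂ) (TopCat.of X))
    {W W' : Opens X} (h : W' ≤ W) :
    O.presheaf.obj (op W) →ₐ[ℂ] O.presheaf.obj (op W') :=
  (O.presheaf.map (homOfLE h : W' ⟶ W).op).hom

/-- An isomorphism between the restriction of the `ℂ`-ringed space `(X, O)` to an open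
neighbourhood `W` of `x` and a local model: the zero set `Z` of finitely many holomorphic
functions `f i` on an open subset `U` of some `ℂⁿ`, with the structure sheaf `O_U / (f i)`
restricted to `Z`. The isomorphism is given by a homeomorphism `chart` from `W` onto `Z` and by a
morphism from `O_U` to the direct image of `O` along `W → U` that is, on the stalks at every
point `p` of `W`, surjective with kernel the ideal generated by the germs of the `f i`. -/
structure LocalModel {X : Type} [TopologicalSpace X]
    (O : TopCat.Sheaf (CommAlgCat.{0} ℂ) (TopCat.of X)) (x : X) where
  n : ℕ
  U : Opens (Fin n → ℂ)
  k : ℕ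
  f : Fin k → Holo U
  W : Opens X
  mem : x ∈ W
  chart : W → (Fin n → ℂ)
  isEmbedding : IsEmbedding chart
  range_chart : Set.range chart = {z | ∃ hz : z ∈ U, ∀ i, (f i).1 ⟨z, hz⟩ = 0}
  comap : ∀ V : Opens (Fin n → ℂ), V ≤ U →
    (Holo V →ₐ[ℂ] O.presheaf.obj (op (preimage isEmbedding.continuous V)))
  comap_res : ∀ (V V' : Opens (Fin n → ℂ)) (hV : V ≤ U) (h : V' ≤ V) (g : Holo V),
    comap V' (h.trans hV) (Holo.res h g) =
      sres O (preimage_mono isEmbedding.continuous h) (comap V hV g)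
  surj_stalk : ∀ (p : W) (W' : Opens X), p.1 ∈ W' → ∀ s : O.presheaf.obj (op W'),
    ∃ (V : Opens (Fin n → ℂ)) (hV : V ≤ U) (g : Holo V) (W'' : Opens X) (h : W'' ≤ W')
      (h' : W'' ≤ preimage isEmbedding.continuous V),
      p.1 ∈ W'' ∧ sres O h' (comap V hV g) = sres O h s
  ker_stalk : ∀ (p : W) (V : Opens (Fin n → ℂ)) (hV : V ≤ U), chart p ∈ V → ∀ g : Holo V,
    (∃ (W' : Opens X) (h : W' ≤ preimage isEmbedding.continuous V),
      p.1 ∈ W' ∧ sres O h (comap V hV g) = 0) ↔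
    ∃ (V' : Opens (Fin n → ℂ)) (h : V' ≤ V), chart p ∈ V' ∧
      Holo.res h g ∈ Ideal.span (Set.range fun i => Holo.res (h.trans hV) (f i))

end AnalyticSpace

/-- The structure of a (possibly non-reduced, possibly non-Hausdorff) complex analytic space on a
topological space `X`: a sheaf of `ℂ`-algebras that is locally isomorphic to a local model. An
analytic space in the strict sense is a Hausdorff space with such a structure. -/
structure AnalyticSpaceStructure (X : Type) [TopologicalSpace X] where
  sheaf : TopCat.Sheaf (CommAlgCat.{0} ℂ) (TopCat.of X)
  locally_model : ∀ x : X, Nonempty (AnalyticSpace.LocalModel sheaf x)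

/-- Every point has a Hausdorff neighbourhood. -/
def IsLocallyHausdorff (X : Type*) [TopologicalSpace X] : Prop :=
  ∀ x : X, ∃ U ∈ 𝓝 x, T2Space U

/-! ### Complex structures on a smooth manifold and the Teichmüller space -/

section Teichmuller

variable {E : Type*} [NormedAddCommGroup E] [NormedSpace ℝ E] {H : Type*} [TopologicalSpace H]

/-- An orientation of a manifold: an orientation of each tangent space, locally constant when read
in the local trivializations of the tangent bundle. -/
structure ManifoldOrientation (ι : Type*) [Fintype ι] [DecidableEq ι]
    (I : ModelWithCorners ℝ E H) (M : Type*) [TopologicalSpace M] [ChartedSpace H M]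
    [IsManifold I ∞ M] where
  at_point : ∀ x : M, Orientation ℝ (TangentSpace I x) ι
  locally_constant : ∀ x₀ : M, ∀ᶠ y in 𝓝 x₀,
    ∀ hy : y ∈ (trivializationAt E (TangentSpace I : M → Type _) x₀).baseSet,
      Orientation.map ι ((trivializationAt E (TangentSpace I : M → Type _) x₀).continuousLinearEquivAt
          ℝ y hy).toLinearEquiv (at_point y) =
        Orientation.map ι ((trivializationAt E (TangentSpace I : M → Type _) x₀).continuousLinearEquivAt
          ℝ x₀ (FiberBundle.mem_baseSet_trivializationAt' x₀)).toLinearEquiv (at_point x₀)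

variable {I : ModelWithCorners ℝ E H} {M : Type*} [TopologicalSpace M] [ChartedSpace H M]
  [IsManifold I ∞ M]

/-- The space of integrable complex operators `J` on the `2n`-dimensional manifold `M` that induce
the given orientation. -/
structure ComplexStructure {n : ℕ} (o : ManifoldOrientation (Fin n × Fin 2) I M) where
  /-- the operator on the tangent bundle -/
  op : ∀ x : M, TangentSpace I x →L[ℝ] TangentSpace I x
  smooth : ContMDiff I (I.prod 𝓘(ℝ, E →L[ℝ] E)) ∞
    (fun x => Bundle.TotalSpace.mk' (E →L[ℝ] E)
      (E := fun x : M => TangentSpace I x →L[ℝ] TangentSpace I x) x (op x))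
  sq : ∀ (x : M) (v : TangentSpace I x), op x (op x v) = -v
  /-- Involutivity of `T^{0,1} = {v + i J v}`. For real vector fields `X`, `Y` smooth near `x`,
  `[X + iJX, Y + iJY] = ([X, Y] - [JX, JY]) + i ([X, JY] + [JX, Y])`, and a complex vector `a + ib`
  (with `a`, `b` real) is in `T^{0,1}` if and only if `b = J a`. -/
  integrable : ∀ (x : M) (X Y : ∀ y : M, TangentSpace I y),
    ContMDiffAt I I.tangent ∞ (fun y => (⟨y, X y⟩ : TangentBundle I M)) x →
    ContMDiffAt I I.tangent ∞ (fun y => (⟨y, Y y⟩ : TangentBundle I M)) x →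
    VectorField.mlieBracket I X (fun y => op y (Y y)) x +
        VectorField.mlieBracket I (fun y => op y (X y)) Y x =
      op x (VectorField.mlieBracket I X Y x -
        VectorField.mlieBracket I (fun y => op y (X y)) (fun y => op y (Y y)) x)
  /-- The real bases `(e₁, J e₁, …, eₙ, J eₙ)` are positively oriented. -/
  oriented : ∀ (x : M) (b : Module.Basis (Fin n × Fin 2) ℝ (TangentSpace I x)),
    (∀ i, b (i, 1) = op x (b (i, 0))) → b.orientation = o.at_point x

namespace ComplexStructure

variable {n : ℕ} {o : ManifoldOrientation (Fin n × Fin 2) I M}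

/-- The matrix-valued function that represents the operator in the chart at `x₀`. -/
def inChart (J : ComplexStructure o) (x₀ : M) : E → (E →L[ℝ] E) := fun u =>
  inTangentCoordinates I I id id (fun x : M => J.op x) x₀ ((extChartAt I x₀).symm u)

/-- The `C^∞` topology: uniform convergence, on the compact subsets of the charts, of the operators
and of all their derivatives. -/
instance : TopologicalSpace (ComplexStructure o) :=
  ⨅ (x₀ : M) (k : ℕ), TopologicalSpace.induced
    (fun J : ComplexStructure o =>
      UniformOnFun.ofFun {K : Set E | IsCompact K ∧ K ⊆ (extChartAt I x₀).target}
        (iteratedFDerivWithin ℝ k (J.inChart x₀) (extChartAt I x₀).target))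
    inferInstance

end ComplexStructure

/-- The diffeomorphism `f` is `C^∞`-isotopic to the identity. -/
def IsIsotopicToId (f : M ≃ₘ^∞⟮I, I⟯ M) : Prop :=
  ∃ F : ℝ → (M ≃ₘ^∞⟮I, I⟯ M),
    ContMDiff (𝓘(ℝ, ℝ).prod I) I ∞ (fun p : ℝ × M => F p.1 p.2) ∧
    F 0 = Diffeomorph.refl I M ∞ ∧ F 1 = f

/-- `J` and `J'` are in the same orbit of the group of diffeomorphisms isotopic to the identity:
`J' = (df)⁻¹ ∘ J ∘ df` for such a diffeomorphism `f`. -/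
def TeichmullerRel {n : ℕ} {o : ManifoldOrientation (Fin n × Fin 2) I M}
    (J J' : ComplexStructure o) : Prop :=
  ∃ f : M ≃ₘ^∞⟮I, I⟯ M, IsIsotopicToId f ∧
    ∀ (x : M) (v : TangentSpace I x),
      mfderiv I I f x (J'.op x v) = J.op (f x) (mfderiv I I f x v)

/-- The Teichmüller space of the oriented manifold `(M, o)`, with the quotient topology. -/
def TeichmullerSpace {n : ℕ} (o : ManifoldOrientation (Fin n × Fin 2) I M) :=
  Quot (TeichmullerRel (o := o))

instance {n : ℕ} (o : ManifoldOrientation (Fin n × Fin 2) I M) :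
    TopologicalSpace (TeichmullerSpace o) :=
  inferInstanceAs (TopologicalSpace (Quot _))

/-- The class of a complex structure in the Teichmüller space. -/
def TeichmullerSpace.mk {n : ℕ} {o : ManifoldOrientation (Fin n × Fin 2) I M}
    (J : ComplexStructure o) : TeichmullerSpace o :=
  Quot.mk _ J

/-- The component of the Teichmüller space determined by `J₀`: the quotient of the connected
component of `J₀` in the space of complex structures, with the quotient topology. -/
def TeichmullerComponent {n : ℕ} {o : ManifoldOrientation (Fin n × Fin 2) I M}
    (J₀ : ComplexStructure o) :=
  Quot fun J J' : connectedComponent J₀ => TeichmullerRel J.1 J'.1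

instance {n : ℕ} {o : ManifoldOrientation (Fin n × Fin 2) I M} (J₀ : ComplexStructure o) :
    TopologicalSpace (TeichmullerComponent J₀) :=
  inferInstanceAs (TopologicalSpace (Quot _))

/-- The class of a complex structure in the component determined by `J₀`. -/
def TeichmullerComponent.mk {n : ℕ} {o : ManifoldOrientation (Fin n × Fin 2) I M}
    {J₀ : ComplexStructure o} (J : connectedComponent J₀) : TeichmullerComponent J₀ :=
  Quot.mk _ J

/-! ### Hopf surfaces -/

/-- `ℂ² ∖ {0}` -/
def PuncturedPlane : Opens (Fin 2 → ℂ) := ⟨{0}ᶜ, isOpen_compl_singleton⟩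

/-- The quotient of `ℂ² ∖ {0}` by the group generated by the bijection `g`: the points `z` and
`g z` are identified. -/
def HopfSurface (g : (Fin 2 → ℂ) → (Fin 2 → ℂ)) :=
  Quot fun z w : PuncturedPlane => (w : Fin 2 → ℂ) = g z

/-- `(M, J)` is biholomorphic to the Hopf surface `X_g`. As the complex structure of `X_g` is the
one for which the projection `ℂ² ∖ {0} → X_g` is a local biholomorphism, a biholomorphism
`X_g → (M, J)` is a bijection whose composition with this projection is a local diffeomorphism with
complex linear differential. -/
def IsBiholomorphicToHopf {n : ℕ} {o : ManifoldOrientation (Fin n × Fin 2) I M}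
    (J : ComplexStructure o) (g : (Fin 2 → ℂ) → (Fin 2 → ℂ)) : Prop :=
  ∃ φ : HopfSurface g ≃ M,
    IsLocalDiffeomorph 𝓘(ℝ, Fin 2 → ℂ) I ∞ (fun z : PuncturedPlane => φ (Quot.mk _ z)) ∧
    ∀ (z : PuncturedPlane) (v : Fin 2 → ℂ),
      mfderiv 𝓘(ℝ, Fin 2 → ℂ) I (fun z : PuncturedPlane => φ (Quot.mk _ z)) z (Complex.I • v) =
        J.op (φ (Quot.mk _ z))
          (mfderiv 𝓘(ℝ, Fin 2 → ℂ) I (fun z : PuncturedPlane => φ (Quot.mk _ z)) z v)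

end Teichmuller

/-- The smooth manifold `S³ × S¹`. -/
abbrev SphereTimesCircle : Type := Metric.sphere (0 : EuclideanSpace ℝ (Fin 4)) 1 × Circle

end

noncomputable section

/-! Local models of analytic spaces embed in `ℂⁿ`, so an analytic space, Hausdorff or not, is
locally Hausdorff. It therefore suffices to find two distinct classes such that one lies in every
neighbourhood of the other: this cannot happen inside a Hausdorff neighbourhood. The classes come
from the classical jumping of Hopf surfaces, where Jordan blocks with eigenvalue `λ` and
off-diagonal entry tending to `0` are all conjugate to each other but degenerate to `λI`.

To realise this on a fixed manifold, let `P : ℂ² ∖ {0} → M` be a holomorphic covering of `(M, J₀)`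
whose fibres are the orbits of `λ`. The shear `S_t (x, y) = (x + (sin t / 4) log(|x|² + |y|²) y, y)`
satisfies `S_t ∘ λ = A_t ∘ S_t`, where `A_t` is upper triangular with diagonal `λ` and off-diagonal
entry `λ (sin t / 2) log |λ|`, because the logarithm grows by `2 log |λ|` under `λ`. So `P ∘ S_t⁻¹`
is invariant under the complex linear map `A_t`, and multiplication by `i` descends through it to a
complex structure `J_t` for which `M` is the Hopf surface of `A_t`. The family is continuous and
starts at `J₀` (`exists_shear_deformation`). For `t` in `(0, 1]` the `A_t` are conjugate under
diagonal matrices, and the maps `S_p⁻¹ ∘ diag(sin p / sin t, 1) ∘ S_t`, with `p` moving from `t` to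
`1`, commute with `λ` and start at the identity. They descend to an isotopy of `M` whose end carries
`J_t` to `J_1` (`teichmullerRel_of_shear`). Hence every neighbourhood of the class of `J₀` contains
the class of `J_1`, in the whole space as well as in the component.

The two classes differ because the surfaces are not biholomorphic
(`not_isBiholomorphicToHopf_jordan`). On the surface of `λI` the linear vector fields take every
tangent value at every point. On the surface of a Jordan block, every holomorphic vector field is
tangent to the elliptic curve `y = 0`: otherwise, restricting to this line would yield a holomorphic
function on `ℂ ∖ {0}` that a homothety translates by a nonzero constant, hence a single-valued
logarithm.

Finally, a structure `J₀` must exist for either orientation of `S³ × S¹`. Normalising along the flow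
`s ↦ λˢ` gives a covering of the right kind. If it has the wrong orientation, it is precomposed with
an orientation-reversing involution that exchanges `λ` and `λ⁻¹` (`IsParam.exists_isPositiveAt`). -/

theorem AnalyticSpaceStructure.isLocallyHausdorff {X : Type} [TopologicalSpace X]
    (S : AnalyticSpaceStructure X) : IsLocallyHausdorff X := by
  intro x
  obtain ⟨m⟩ := S.locally_model x
  exact ⟨m.W, m.W.2.mem_nhds m.mem, m.isEmbedding.t2Space⟩

/-- A point that lies in every neighbourhood of another one prevents the space from being locally
Hausdorff. -/
theorem not_isLocallyHausdorff_of_specializes {X : Type*} [TopologicalSpace X] {x y : X}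
    (h : y ⤳ x) (hxy : x ≠ y) : ¬ IsLocallyHausdorff X := by
  intro H
  obtain ⟨U, hU, hT⟩ := H x
  have hy : y ∈ U := by
    obtain ⟨V, hVU, hV, hxV⟩ := mem_nhds_iff.1 hU
    exact hVU (h.mem_open hV hxV)
  exact hxy (congrArg Subtype.val
    ((Topology.IsInducing.subtypeVal.specializes_iff (x := (⟨y, hy⟩ : U))
      (y := ⟨x, mem_of_mem_nhds hU⟩)).1 h).eq.symm)

/-! ### Holomorphic functions on the punctured line and homotheties -/

section PuncturedLine

variable {l : ℂ}

theorem exists_zpow_smul_mem_annulus (h0 : 0 < ‖l‖) (h1 : ‖l‖ < 1) {s : ℂ} (hs : s ≠ 0) :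
    ∃ n : ℤ, ‖l‖ ≤ ‖l ^ n * s‖ ∧ ‖l ^ n * s‖ ≤ 1 := by
  obtain ⟨n, hn⟩ := exists_mem_Ioc_zpow (x := ‖s‖) (y := ‖l‖⁻¹) (norm_pos_iff.2 hs)
    (by rw [one_lt_inv₀ h0]; exact h1)
  -- `n` satisfies `‖l‖⁻ⁿ < ‖s‖ ≤ ‖l‖⁻⁽ⁿ⁺¹⁾`, so the exponent `n + 1` brings `s` into the annulus.
  refine ⟨n + 1, ?_, ?_⟩
  · have := hn.1
    rw [norm_mul, norm_zpow, zpow_add₀ h0.ne', zpow_one]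
    rw [inv_zpow] at this
    have hp : 0 < ‖l‖ ^ n := zpow_pos h0 n
    have : 1 ≤ ‖l‖ ^ n * ‖s‖ := by
      rw [inv_lt_iff_one_lt_mul₀ hp] at this
      rw [mul_comm]; exact this.le
    nlinarith
  · have := hn.2
    rw [norm_mul, norm_zpow]
    rw [inv_zpow] at this
    have hp : 0 < ‖l‖ ^ (n + 1) := zpow_pos h0 _
    rw [le_inv_comm₀ (norm_pos_iff.2 hs) hp] at this
    rw [← le_div_iff₀ (norm_pos_iff.2 hs), one_div]
    exact this

/-- A holomorphic function on `ℂ∖{0}` that is invariant under a contracting homothety is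
constant. -/
theorem eq_of_invariant_homothety (h0 : 0 < ‖l‖) (h1 : ‖l‖ < 1) {v : ℂ → ℂ}
    (hv : ∀ s ≠ 0, DifferentiableAt ℂ v s) (hl : ∀ s ≠ 0, v (l * s) = v s) {s t : ℂ}
    (hs : s ≠ 0) (ht : t ≠ 0) : v s = v t := by
  have hl0 : l ≠ 0 := norm_pos_iff.1 h0
  have hz : ∀ (n : ℤ) (s : ℂ), s ≠ 0 → v (l ^ n * s) = v s := by
    intro n
    induction n using Int.induction_on with
    | zero => simp
    | succ n ih =>
      intro s hs
      rw [zpow_add₀ hl0, zpow_one, mul_assoc, ih _ (mul_ne_zero hl0 hs), hl s hs]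
    | pred n ih =>
      intro s hs
      rw [← hl _ (mul_ne_zero (zpow_ne_zero _ hl0) hs), ← mul_assoc, ← zpow_one_add₀ hl0]
      rw [show (1 + (-(n : ℤ) - 1)) = -n by ring, ih s hs]
  have hK : IsCompact {s : ℂ | ‖l‖ ≤ ‖s‖ ∧ ‖s‖ ≤ 1} := by
    refine (isCompact_closedBall (0 : ℂ) 1).of_isClosed_subset ?_ ?_
    · exact (isClosed_le continuous_const continuous_norm).inter
        (isClosed_le continuous_norm continuous_const)
    · intro s hs
      simpa using hs.2
  obtain ⟨C, hC⟩ := hK.exists_bound_of_continuousOn (f := v) (fun s hs =>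
    (hv s (norm_pos_iff.1 (h0.trans_le hs.1))).continuousAt.continuousWithinAt)
  -- A power of `l` moves every point into a compact annulus without changing `v`. Thus `v ∘ exp` is
  -- a bounded entire function, and Liouville applies.
  have hb : Bornology.IsBounded (Set.range fun w => v (Complex.exp w)) := by
    rw [isBounded_iff_forall_norm_le]
    refine ⟨C, ?_⟩
    rintro _ ⟨w, rfl⟩
    obtain ⟨n, hn⟩ := exists_zpow_smul_mem_annulus h0 h1 (Complex.exp_ne_zero w)
    simpa [hz n _ (Complex.exp_ne_zero w)] using hC _ hn
  have hd : Differentiable ℂ fun w => v (Complex.exp w) := fun w =>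
    (hv _ (Complex.exp_ne_zero w)).comp w Complex.differentiable_exp.differentiableAt
  have := hd.apply_eq_apply_of_bounded hb (Complex.log s) (Complex.log t)
  simpa [Complex.exp_log hs, Complex.exp_log ht] using this

/-- A holomorphic function on `ℂ∖{0}` cannot be translated by a contracting homothety. -/
theorem eq_zero_of_translated_by_homothety (h0 : 0 < ‖l‖) (h1 : ‖l‖ < 1) {v : ℂ → ℂ} {c : ℂ}
    (hv : ∀ s ≠ 0, DifferentiableAt ℂ v s) (hl : ∀ s ≠ 0, v (l * s) = v s + c) : c = 0 := by
  have hl0 : l ≠ 0 := norm_pos_iff.1 h0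
  have hd : ∀ s ≠ 0, DifferentiableAt ℂ (fun s => s * deriv v s) s := fun s hs =>
    differentiableAt_id.mul
      ((DifferentiableOn.analyticAt (s := {0}ᶜ)
        (fun z hz => (hv z hz).differentiableWithinAt)
        (isOpen_compl_singleton.mem_nhds hs)).deriv.differentiableAt)
  -- Differentiation kills the constant `c`, so `s v'(s)` is invariant under the homothety and
  -- equals a constant `a`. Then `v ∘ exp` is affine of slope `a`.
  have hi : ∀ s ≠ 0, l * s * deriv v (l * s) = s * deriv v s := by
    intro s hs
    have e : (fun s => v (l * s)) =ᶠ[𝓝 s] fun s => v s + c := by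
      filter_upwards [isOpen_compl_singleton.mem_nhds hs] with z hz using hl z hz
    have h2 := e.deriv_eq
    rw [deriv_add_const] at h2
    have h3 : HasDerivAt (fun s => v (l * s)) (deriv v (l * s) * l) s := by
      have := (hv (l * s) (mul_ne_zero hl0 hs)).hasDerivAt
      exact this.comp s (by simpa using (hasDerivAt_id s).const_mul l)
    rw [h3.deriv] at h2
    rw [← h2]; ring
  set a := (1 : ℂ) * deriv v 1 with ha
  have hconst : ∀ s ≠ 0, s * deriv v s = a := fun s hs =>
    eq_of_invariant_homothety h0 h1 hd hi hs one_ne_zero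
  have hE : ∀ w, HasDerivAt (fun w => v (Complex.exp w) - a * w) 0 w := by
    intro w
    have := ((hv _ (Complex.exp_ne_zero w)).hasDerivAt.comp w (Complex.hasDerivAt_exp w)).sub
      ((hasDerivAt_id w).const_mul a)
    refine this.congr_deriv ?_
    rw [← hconst _ (Complex.exp_ne_zero w)]; ring
  have hcst : ∀ w w', v (Complex.exp w) - a * w = v (Complex.exp w') - a * w' := fun w w' =>
    is_const_of_deriv_eq_zero (fun w => (hE w).differentiableAt) (fun w => (hE w).deriv) w w'
  -- The affine function `v ∘ exp` has period `2πi`, so its slope vanishes: the logarithm is not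
  -- single-valued.
  have ha0 : a = 0 := by
    have := hcst (2 * Real.pi * Complex.I) 0
    rw [Complex.exp_two_pi_mul_I, Complex.exp_zero] at this
    have h2 : a * (2 * Real.pi * Complex.I) = 0 := by linear_combination -this
    exact (mul_eq_zero.1 h2).resolve_right Complex.two_pi_I_ne_zero
  have := hcst (Complex.log l) 0
  rw [Complex.exp_log hl0, Complex.exp_zero, ha0] at this
  have h2 := hl 1 one_ne_zero
  rw [mul_one] at h2
  linear_combination this - h2

/-- Along the eigenline of a Jordan block, a holomorphic vector field that commutes with the block
is tangent to the eigenline. -/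
theorem eq_zero_of_commute_jordan (h0 : 0 < ‖l‖) (h1 : ‖l‖ < 1) {v w : ℂ → ℂ}
    (hv : ∀ s ≠ 0, DifferentiableAt ℂ v s) (hw : ∀ s ≠ 0, DifferentiableAt ℂ w s)
    (hlw : ∀ s ≠ 0, w (l * s) = l * w s) (hlv : ∀ s ≠ 0, v (l * s) = l * v s + w s) :
    w 1 = 0 := by
  have hl0 : l ≠ 0 := norm_pos_iff.1 h0
  have hwc : ∀ s ≠ 0, w s / s = w 1 / 1 := fun s hs =>
    eq_of_invariant_homothety h0 h1 (v := fun s => w s / s)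
      (fun s hs => (hw s hs).div differentiableAt_id hs)
      (fun s hs => by simp only [hlw s hs]; field_simp) hs one_ne_zero
  -- The quotient `w s / s` is the constant `w 1`, so the equation for `v` says that `v s / s` is
  -- translated by `w 1 / l`.
  have : w 1 / l = 0 := by
    refine eq_zero_of_translated_by_homothety h0 h1 (v := fun s => v s / s)
      (fun s hs => (hv s hs).div differentiableAt_id hs) fun s hs => ?_
    have := hwc s hs
    rw [div_one, div_eq_iff hs] at this
    simp only [hlv s hs, this]
    field_simp
  exact (div_eq_zero_iff.1 this).resolve_right hl0

end PuncturedLine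

/-! ### Differentials of parametrizations and operators read in them -/

/-- The complex plane. -/
abbrev C2 : Type := Fin 2 → ℂ

/-- Multiplication by `i`, as a real linear map. -/
def mulI : C2 →L[ℝ] C2 := (Complex.I • ContinuousLinearMap.id ℂ C2).restrictScalars ℝ

@[simp] theorem mulI_apply (v : C2) : mulI v = Complex.I • v := rfl

section Param

variable {E : Type*} [NormedAddCommGroup E] [NormedSpace ℝ E] {H : Type*} [TopologicalSpace H]
  {I : ModelWithCorners ℝ E H} {M : Type*} [TopologicalSpace M] [ChartedSpace H M]
  {F : Type*} [NormedAddCommGroup F] [NormedSpace ℝ F]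

variable (I) in
/-- The differential of a map from a normed space to a manifold. -/
def tder (P : F → M) (z : F) : F →L[ℝ] TangentSpace I (P z) := mfderiv 𝓘(ℝ, F) I P z

theorem IsLocalDiffeomorphAt.exists_tder_equiv {P : F → M} {z : F}
    (hP : IsLocalDiffeomorphAt 𝓘(ℝ, F) I ∞ P z) :
    ∃ e : F ≃L[ℝ] TangentSpace I (P z), (e : F →L[ℝ] TangentSpace I (P z)) = tder I P z :=
  ⟨hP.mfderivToContinuousLinearEquiv (by simp), rfl⟩

theorem IsLocalDiffeomorphAt.eventually {P : F → M} {z : F}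
    (hP : IsLocalDiffeomorphAt 𝓘(ℝ, F) I ∞ P z) :
    ∀ᶠ w in 𝓝 z, IsLocalDiffeomorphAt 𝓘(ℝ, F) I ∞ P w := by
  obtain ⟨Φ, hz, h⟩ := hP
  filter_upwards [Φ.open_source.mem_nhds hz] with w hw using ⟨Φ, hw, h⟩

theorem tder_comp {F' : Type*} [NormedAddCommGroup F'] [NormedSpace ℝ F'] {P : F → M}
    {φ : F' → F} {z : F'} (hP : MDifferentiableAt 𝓘(ℝ, F) I P (φ z))
    (hφ : DifferentiableAt ℝ φ z) :
    tder I (fun w => P (φ w)) z = (tder I P (φ z)).comp (fderiv ℝ φ z) := by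
  have h := mfderiv_comp z hP hφ.mdifferentiableAt
  rw [mfderiv_eq_fderiv] at h
  exact h

theorem fderiv_comp_tder {E' : Type*} [NormedAddCommGroup E'] [NormedSpace ℝ E'] {P : F → M}
    {c : M → E'} {z : F} (hP : MDifferentiableAt 𝓘(ℝ, F) I P z)
    (hc : MDifferentiableAt I 𝓘(ℝ, E') c (P z)) (v : F) :
    fderiv ℝ (fun w => c (P w)) z v = mfderiv I 𝓘(ℝ, E') c (P z) (tder I P z v) := by
  have h := mfderiv_comp z hc hP
  rw [← mfderiv_eq_fderiv]
  exact congrArg (fun L => L v) h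

theorem tder_mcomp {H' E' M' : Type*} [TopologicalSpace H'] [NormedAddCommGroup E']
    [NormedSpace ℝ E'] {I' : ModelWithCorners ℝ E' H'} [TopologicalSpace M'] [ChartedSpace H' M']
    {P : F → M} {f : M → M'} {z : F} (hP : MDifferentiableAt 𝓘(ℝ, F) I P z)
    (hf : MDifferentiableAt I I' f (P z)) (v : F) :
    tder I' (fun w => f (P w)) z v = mfderiv I I' f (P z) (tder I P z v) :=
  congrArg (fun L => L v) (mfderiv_comp z hf hP)

/-- The tangent spaces at `P z` and `Q z` are different types, although both unfold to `E`. Vectors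
at equal points are compared in `E`, here and below. -/
theorem Filter.EventuallyEq.tder_eq {P Q : F → M} {z : F} (h : P =ᶠ[𝓝 z] Q) (v : F) :
    (tder I P z v : E) = (tder I Q z v : E) := by
  unfold tder
  rw [h.mfderiv_eq]
  rfl

/-- An operator that becomes the multiplication by `i` in a parametrization is integrable. -/
theorem mlieBracket_eq_of_param [IsManifold I ∞ M] [CompleteSpace E]
    {op : ∀ x : M, TangentSpace I x →L[ℝ] TangentSpace I x}
    {P : C2 → M} {z : C2} (hP : IsLocalDiffeomorphAt 𝓘(ℝ, C2) I ∞ P z)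
    (hop : ∀ᶠ w in 𝓝 z, ∀ v : C2, op (P w) (tder I P w v) = tder I P w (mulI v))
    {X Y : ∀ y : M, TangentSpace I y}
    (hX : MDifferentiableAt I I.tangent (fun y => (⟨y, X y⟩ : TangentBundle I M)) (P z))
    (hY : MDifferentiableAt I I.tangent (fun y => (⟨y, Y y⟩ : TangentBundle I M)) (P z))
    (hJX : MDifferentiableAt I I.tangent (fun y => (⟨y, op y (X y)⟩ : TangentBundle I M)) (P z))
    (hJY : MDifferentiableAt I I.tangent (fun y => (⟨y, op y (Y y)⟩ : TangentBundle I M)) (P z)) :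
    VectorField.mlieBracket I X (fun y => op y (Y y)) (P z) +
        VectorField.mlieBracket I (fun y => op y (X y)) Y (P z) =
      op (P z) (VectorField.mlieBracket I X Y (P z) -
        VectorField.mlieBracket I (fun y => op y (X y)) (fun y => op y (Y y)) (P z)) := by
  have hPz : ContMDiffAt 𝓘(ℝ, C2) I ∞ P z := hP.contMDiffAt
  have h2 : minSmoothness ℝ 2 ≤ (∞ : ℕ∞ω) := by
    rw [minSmoothness_of_isRCLikeNormedField]; exact WithTop.coe_le_coe.2 le_top
  -- The bracket is natural under `P`, and pulling back turns the operator into the constant linear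
  -- map `mulI`. What remains is an identity between derivatives on `ℂ²` that follows from `i² =
  -- -1`.
  let pull : (∀ y : M, TangentSpace I y) → C2 → C2 := fun V w => (tder I P w).inverse (V (P w))
  have key : ∀ {V W : ∀ y : M, TangentSpace I y},
      MDifferentiableAt I I.tangent (fun y => (⟨y, V y⟩ : TangentBundle I M)) (P z) →
      MDifferentiableAt I I.tangent (fun y => (⟨y, W y⟩ : TangentBundle I M)) (P z) →
      (tder I P z).inverse (VectorField.mlieBracket I V W (P z)) =
        VectorField.lieBracket ℝ (pull V) (pull W) z := by
    intro V W hV hW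
    have : IsManifold I (minSmoothness ℝ 2) M := by
      rw [minSmoothness_of_isRCLikeNormedField]; infer_instance
    refine (VectorField.mpullback_mlieBracket hV hW hPz h2).trans ?_
    refine (congrFun VectorField.mlieBracketWithin_eq_lieBracketWithin z).trans ?_
    exact congrFun VectorField.lieBracketWithin_univ z
  have hinv : ∀ w, IsLocalDiffeomorphAt 𝓘(ℝ, C2) I ∞ P w →
      (∀ v : C2, op (P w) (tder I P w v) = tder I P w (mulI v)) →
      ∀ u : TangentSpace I (P w), (tder I P w).inverse (op (P w) u) =
        mulI ((tder I P w).inverse u) := by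
    intro w hw hop u
    obtain ⟨e, he⟩ := hw.exists_tder_equiv
    rw [← he] at hop ⊢
    rw [ContinuousLinearMap.inverse_equiv]
    have h1 := hop (e.symm u)
    simp only [ContinuousLinearEquiv.coe_coe, ContinuousLinearEquiv.apply_symm_apply] at h1 ⊢
    rw [h1, ContinuousLinearEquiv.symm_apply_apply]
  have hpull : ∀ V : ∀ y : M, TangentSpace I y,
      pull (fun y => op y (V y)) =ᶠ[𝓝 z] fun w => mulI (pull V w) := by
    intro V
    filter_upwards [hP.eventually, hop] with w hw hw'
    exact hinv w hw hw' (V (P w))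
  have hi := hinv z hP hop.self_of_nhds
  obtain ⟨e, he⟩ := hP.exists_tder_equiv
  have hinj : Function.Injective (tder I P z).inverse := by
    rw [← he, ContinuousLinearMap.inverse_equiv]
    exact e.symm.injective
  apply hinj
  rw [map_add, hi, map_sub, key hX hJY, key hJX hY, key hX hY, key hJX hJY,
    (Filter.EventuallyEq.refl _ _).lieBracket_vectorField_eq (hpull Y),
    (hpull X).lieBracket_vectorField_eq (Filter.EventuallyEq.refl _ _),
    (hpull X).lieBracket_vectorField_eq (hpull Y)]
  generalize pull X = X'
  generalize pull Y = Y'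
  have hs : ∀ Z : C2 → C2, fderiv ℝ (fun w => mulI (Z w)) z = mulI ∘L fderiv ℝ Z z := by
    intro Z
    have : (fun w => mulI (Z w)) = Complex.I • Z := rfl
    rw [this, fderiv_const_smul_field]
    rfl
  simp only [VectorField.lieBracket_eq]
  rw [hs X', hs Y']
  have hII : ∀ v : C2, mulI (mulI v) = -v := fun v => by simp [smul_smul]
  simp only [ContinuousLinearMap.comp_apply, map_sub, hII]
  abel

/-- The expression in a chart of an operator given in a local parametrization. -/
theorem exists_inTangentCoordinates_eq [IsManifold I ∞ M] [I.Boundaryless] {P : F → M} {z₀ : F}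
    (hP : IsLocalDiffeomorphAt 𝓘(ℝ, F) I ∞ P z₀) {x₀ : M} {u₀ : E}
    (hu₀ : u₀ ∈ (extChartAt I x₀).target) (h₀ : P z₀ = (extChartAt I x₀).symm u₀) :
    ∃ (q : E → F) (G : F → E), ContDiffAt ℝ ∞ q u₀ ∧ q u₀ = z₀ ∧ ContDiffAt ℝ ∞ G z₀ ∧
      ∀ᶠ u in 𝓝 u₀, ∀ (op : ∀ x : M, TangentSpace I x →L[ℝ] TangentSpace I x) (j : F →L[ℝ] F),
        (∀ v, op (P (q u)) (tder I P (q u) v) = tder I P (q u) (j v)) →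
        inTangentCoordinates I I id id (fun x => op x) x₀ ((extChartAt I x₀).symm u) =
          (fderiv ℝ G (q u)).comp (j.comp (fderiv ℝ q u)) := by
  have htgt : ∀ᶠ u in 𝓝 u₀, u ∈ (extChartAt I x₀).target :=
    (isOpen_extChartAt_target x₀).mem_nhds hu₀
  have hsymm : ∀ u ∈ (extChartAt I x₀).target,
      ContMDiffAt 𝓘(ℝ, E) I ∞ (extChartAt I x₀).symm u := fun u hu =>
    (contMDiffOn_extChartAt_symm x₀).contMDiffAt ((isOpen_extChartAt_target x₀).mem_nhds hu)
  have hext : ∀ y ∈ (extChartAt I x₀).source, ContMDiffAt I 𝓘(ℝ, E) ∞ (extChartAt I x₀) y :=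
    fun y hy => contMDiffAt_extChartAt' (by simpa using hy)
  let Q := hP.localInverse
  have hQ : ContMDiffAt I 𝓘(ℝ, F) ∞ Q (P z₀) := hP.localInverse_contMDiffAt
  have hQz : Q (P z₀) = z₀ := hP.localInverse_left_inv hP.localInverse_mem_target
  -- `q` is the inverse chart followed by a local inverse of `P`, and `G` will be the chart after
  -- `P`. Neither depends on `op` or `j`, so the same formula serves for a whole family of
  -- operators.
  let q : E → F := fun u => Q ((extChartAt I x₀).symm u)
  have hqs : ContDiffAt ℝ ∞ q u₀ := by
    rw [h₀] at hQ
    exact (hQ.comp u₀ (hsymm u₀ hu₀)).contDiffAt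
  have hq0 : q u₀ = z₀ := by simp only [q]; rw [← h₀, hQz]
  have hPq : ∀ᶠ u in 𝓝 u₀, P (q u) = (extChartAt I x₀).symm u := by
    have hc : Filter.Tendsto (extChartAt I x₀).symm (𝓝 u₀) (𝓝 (P z₀)) := by
      rw [h₀]; exact (hsymm u₀ hu₀).continuousAt
    exact hc.eventually hP.localInverse_eventuallyEq_right
  have hPev : ∀ᶠ u in 𝓝 u₀, IsLocalDiffeomorphAt 𝓘(ℝ, F) I ∞ P (q u) := by
    have : Filter.Tendsto q (𝓝 u₀) (𝓝 z₀) := by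
      have := hqs.continuousAt.tendsto
      rwa [hq0] at this
    exact this.eventually hP.eventually
  have hqev : ∀ᶠ u in 𝓝 u₀, DifferentiableAt ℝ q u := by
    have := (hqs.of_le (m := 1) (by exact_mod_cast le_top)).eventually (by simp)
    filter_upwards [this] with u hu using hu.differentiableAt (by simp)
  refine ⟨q, fun z => extChartAt I x₀ (P z), hqs, hq0, ?_, ?_⟩
  · refine ((hext (P z₀) ?_).comp z₀ hP.contMDiffAt).contDiffAt
    rw [h₀]
    exact (extChartAt I x₀).map_target hu₀
  filter_upwards [htgt, hPq.eventually_nhds, hPev, hqev] with u hu hPq hPu hqu op j hop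
  have hy : (extChartAt I x₀).symm u ∈ (chartAt H x₀).source := by
    simpa using (extChartAt I x₀).map_target hu
  have hd : ∀ v, (mfderivWithin 𝓘(ℝ, E) I (extChartAt I x₀).symm (Set.range I) u v : E) =
      (tder I P (q u) (fderiv ℝ q u v) : E) := by
    intro v
    rw [I.range_eq_univ, mfderivWithin_univ]
    have h1 := Filter.EventuallyEq.tder_eq (I := I) hPq v
    rw [tder_comp (hPu.contMDiffAt.mdifferentiableAt (by simp)) hqu] at h1
    exact h1.symm
  refine (inTangentCoordinates_eq_mfderiv_comp (I := I) (I' := I) (f := id) (g := id) (ϕ := op)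
    hy hy).trans ?_
  have main : ∀ (y : M) (_ : P (q u) = y) (v : E) (a : TangentSpace I y)
      (_ : (a : E) = (tder I P (q u) (fderiv ℝ q u v) : E)),
      mfderiv I 𝓘(ℝ, E) (extChartAt I x₀) y (op y a) =
        fderiv ℝ (fun z => extChartAt I x₀ (P z)) (q u) (j (fderiv ℝ q u v)) := by
    rintro y rfl v a ha
    have ha' : a = tder I P (q u) (fderiv ℝ q u v) := ha
    rw [ha', hop, fderiv_comp_tder (hPu.contMDiffAt.mdifferentiableAt (by simp))]
    refine (hext _ ?_).mdifferentiableAt (by simp)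
    rw [hPq.self_of_nhds]
    exact (extChartAt I x₀).map_target hu
  refine ContinuousLinearMap.ext fun v => main _ hPq.self_of_nhds v _ ?_
  have hr : extChartAt I x₀ ((extChartAt I x₀).symm u) = u := (extChartAt I x₀).right_inv hu
  refine Eq.trans ?_ (hd v)
  simp only [id]
  rw [hr]
  rfl

end Param

/-! ### Complex structures defined through a parametrization -/

section Construction

variable {E : Type*} [NormedAddCommGroup E] [NormedSpace ℝ E] {H : Type*} [TopologicalSpace H]
  {I : ModelWithCorners ℝ E H} {M : Type*} [TopologicalSpace M] [ChartedSpace H M]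

variable (I) in
/-- A surjective local diffeomorphism from `ℂ² ∖ {0}` to `M`, given by a map on `ℂ²` with an
arbitrary value at `0`. -/
structure IsParam (P : C2 → M) : Prop where
  isLocalDiffeomorphAt : ∀ z ≠ 0, IsLocalDiffeomorphAt 𝓘(ℝ, C2) I ∞ P z
  exists_eq : ∀ x, ∃ z ≠ 0, P z = x

theorem IsParam.mdifferentiableAt {P : C2 → M} (hP : IsParam I P) {z : C2} (hz : z ≠ 0) :
    MDifferentiableAt 𝓘(ℝ, C2) I P z :=
  (hP.isLocalDiffeomorphAt z hz).contMDiffAt.mdifferentiableAt (by simp)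

/-- In the parametrization `P`, the operator `op` is the operator `j`. -/
def ReadsAs (P : C2 → M) (op : ∀ x : M, TangentSpace I x →L[ℝ] TangentSpace I x)
    (j : C2 → C2 →L[ℝ] C2) : Prop :=
  ∀ z ≠ 0, ∀ v, op (P z) (tder I P z v) = tder I P z (j z v)

theorem IsParam.op_ext {P : C2 → M} (hP : IsParam I P)
    {op op' : ∀ x : M, TangentSpace I x →L[ℝ] TangentSpace I x} {j : C2 → C2 →L[ℝ] C2}
    (h : ReadsAs P op j) (h' : ReadsAs P op' j) : op = op' := by
  funext x
  obtain ⟨z, hz, rfl⟩ := hP.exists_eq x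
  obtain ⟨e, he⟩ := (hP.isLocalDiffeomorphAt z hz).exists_tder_equiv
  ext v
  obtain ⟨w, rfl⟩ := e.surjective v
  have h1 := h z hz w
  have h2 := h' z hz w
  rw [← he] at h1 h2
  exact h1.trans h2.symm

/-- The multiplication by `i` descends to `M` if the parametrization is, up to complex linear maps,
injective. -/
theorem IsParam.exists_readsAs_mulI {P : C2 → M} (hP : IsParam I P)
    (hdeck : ∀ z ≠ 0, ∀ w ≠ 0, P z = P w →
      ∃ A : C2 →L[ℂ] C2, A z = w ∧ ∀ y ≠ 0, P (A y) = P y) :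
    ∃ op : ∀ x : M, TangentSpace I x →L[ℝ] TangentSpace I x, ReadsAs P op fun _ => mulI := by
  have : ∀ x : M, ∃ L : E →L[ℝ] E, ∀ z ≠ 0, P z = x → ∀ v,
      L (tder I P z v : E) = (tder I P z (mulI v) : E) := by
    intro x
    obtain ⟨z₀, hz₀, rfl⟩ := hP.exists_eq x
    obtain ⟨e, he⟩ := (hP.isLocalDiffeomorphAt z₀ hz₀).exists_tder_equiv
    let e' : C2 ≃L[ℝ] E := e
    have he' : ∀ v, e' v = (tder I P z₀ v : E) := fun v => by rw [← he]; rfl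
    refine ⟨(e' : C2 →L[ℝ] E) ∘L mulI ∘L (e'.symm : E →L[ℝ] C2), fun z hz hzx v => ?_⟩
    obtain ⟨A, hAz, hA⟩ := hdeck z hz z₀ hz₀ hzx
    -- Two preimages of a point differ by a complex linear `A` with `P ∘ A = P`. Since `A` commutes
    -- with `i`, the operator built at `z₀` is also the one seen from `z`.
    have key : ∀ v, (tder I P z v : E) = e' (A v) := by
      intro v
      have h1 : (fun y => P (A.restrictScalars ℝ y)) =ᶠ[𝓝 z] P := by
        filter_upwards [isOpen_compl_singleton.mem_nhds hz] with y hy using hA y hy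
      have h2 := h1.tder_eq (I := I) v
      subst hAz
      rw [tder_comp (F' := C2) (P := P) (φ := A.restrictScalars ℝ) (z := z)
        (hP.mdifferentiableAt hz₀) (A.restrictScalars ℝ).differentiableAt,
        ContinuousLinearMap.fderiv] at h2
      rw [← h2, he']
      rfl
    rw [key, key]
    simp
  choose L hL using this
  exact ⟨fun x => L x, fun z hz v => hL (P z) z hz rfl v⟩

variable [IsManifold I ∞ M] [I.Boundaryless]

/-- In a chart the operator is `dG(q) ∘ j(q) ∘ dq` with `G` and `q` smooth, and it inherits the
smoothness of `j`. -/
theorem contMDiff_of_readsAs {P : C2 → M} (hP : IsParam I P)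
    {op : ∀ x : M, TangentSpace I x →L[ℝ] TangentSpace I x} {j : C2 → C2 →L[ℝ] C2}
    (hj : ∀ z ≠ 0, ContDiffAt ℝ ∞ j z) (hop : ReadsAs P op j) :
    ContMDiff I (I.prod 𝓘(ℝ, E →L[ℝ] E)) ∞
      (fun x => Bundle.TotalSpace.mk' (E →L[ℝ] E)
        (E := fun x : M => TangentSpace I x →L[ℝ] TangentSpace I x) x (op x)) := by
  intro x₀
  rw [contMDiffAt_hom_bundle]
  refine ⟨contMDiffAt_id, ?_⟩
  obtain ⟨z₀, hz₀, h₀⟩ := hP.exists_eq x₀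
  obtain ⟨q, G, hq, hq0, hG, h⟩ := exists_inTangentCoordinates_eq (hP.isLocalDiffeomorphAt z₀ hz₀)
    (mem_extChartAt_target (I := I) x₀) (h₀.trans (extChartAt_to_inv x₀).symm)
  have hs : ContDiffAt ℝ ∞ (fun u => (fderiv ℝ G (q u)).comp ((j (q u)).comp (fderiv ℝ q u)))
      (extChartAt I x₀ x₀) := by
    have h1 : ContDiffAt ℝ ∞ (fderiv ℝ q) (extChartAt I x₀ x₀) := hq.fderiv_right (by simp)
    have h2 : ContDiffAt ℝ ∞ (fun u => fderiv ℝ G (q u)) (extChartAt I x₀ x₀) := by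
      refine ContDiffAt.comp _ ?_ hq
      rw [hq0]
      exact hG.fderiv_right (by simp)
    have h3 : ContDiffAt ℝ ∞ (fun u => j (q u)) (extChartAt I x₀ x₀) := by
      refine ContDiffAt.comp _ ?_ hq
      rw [hq0]
      exact hj z₀ hz₀
    exact h2.clm_comp (h3.clm_comp h1)
  have hc := hs.contMDiffAt.comp x₀ (contMDiffAt_extChartAt (I := I) (n := ∞) (x := x₀))
  refine hc.congr_of_eventuallyEq ?_
  have hqz : ∀ᶠ u in 𝓝 (extChartAt I x₀ x₀), q u ≠ 0 :=
    hq.continuousAt.eventually (isOpen_compl_singleton.mem_nhds (by rw [hq0]; exact hz₀))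
  have hcont : Filter.Tendsto (extChartAt I x₀) (𝓝 x₀) (𝓝 (extChartAt I x₀ x₀)) :=
    continuousAt_extChartAt x₀
  filter_upwards [hcont.eventually h, hcont.eventually hqz, extChartAt_source_mem_nhds (I := I) x₀]
    with y hy hqy hys
  have := hy op (j (q (extChartAt I x₀ y))) (hop _ hqy)
  rw [(extChartAt I x₀).left_inv hys] at this
  exact this

variable {n : ℕ} {o : ManifoldOrientation (Fin n × Fin 2) I M}

/-- The complex structure that is given by an operator `j` in a parametrization and by the
multiplication by `i` in another one. -/
theorem exists_complexStructure [CompleteSpace E] {P p : C2 → M} (hP : IsParam I P)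
    (hp : IsParam I p) {op : ∀ x : M, TangentSpace I x →L[ℝ] TangentSpace I x}
    {j : C2 → C2 →L[ℝ] C2} (hj : ∀ z ≠ 0, ContDiffAt ℝ ∞ j z) (hop : ReadsAs P op j)
    (hpop : ReadsAs p op fun _ => mulI)
    (horient : ∀ (x : M) (b : Module.Basis (Fin n × Fin 2) ℝ (TangentSpace I x)),
      (∀ i, b (i, 1) = op x (b (i, 0))) → b.orientation = o.at_point x) :
    ∃ J : ComplexStructure o, J.op = op := by
  have hsm := contMDiff_of_readsAs hP hj hop
  refine ⟨⟨op, hsm, ?_, ?_, horient⟩, rfl⟩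
  · intro x v
    obtain ⟨z, hz, rfl⟩ := hp.exists_eq x
    obtain ⟨e, he⟩ := (hp.isLocalDiffeomorphAt z hz).exists_tder_equiv
    obtain ⟨w, rfl⟩ := e.surjective v
    have h1 := hpop z hz
    rw [← he] at h1
    have h2 : mulI (mulI w) = -w := by simp [smul_smul]
    have h3 := (congrArg (op (p z)) (h1 w)).trans (h1 (mulI w))
    rw [h2] at h3
    exact h3.trans (map_neg e w)
  · intro x X Y hX hY
    obtain ⟨z, hz, rfl⟩ := hp.exists_eq x
    have hX' := hX.mdifferentiableAt (n := ∞) (by simp)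
    have hY' := hY.mdifferentiableAt (n := ∞) (by simp)
    refine mlieBracket_eq_of_param (hp.isLocalDiffeomorphAt z hz) ?_ hX' hY' ?_ ?_
    · filter_upwards [isOpen_compl_singleton.mem_nhds hz] with w hw using hpop w hw
    · exact ((hsm _).clm_bundle_apply hX).mdifferentiableAt (by simp)
    · exact ((hsm _).clm_bundle_apply hY).mdifferentiableAt (by simp)

end Construction

/-! ### Continuity of families in the `C^∞` topology -/

/-- The iterated derivatives of a smooth family of functions are smooth in the parameter. -/
theorem contDiffAt_iteratedFDeriv_family {E G : Type*} [NormedAddCommGroup E] [NormedSpace ℝ E]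
    [NormedAddCommGroup G] [NormedSpace ℝ G] {f : ℝ → E → G} {S : Set E}
    (hf : ∀ t, ∀ u ∈ S, ContDiffAt ℝ ∞ (fun p : ℝ × E => f p.1 p.2) (t, u)) (k : ℕ) :
    ∀ t, ∀ u ∈ S, ContDiffAt ℝ ∞ (fun p : ℝ × E => iteratedFDeriv ℝ k (f p.1) p.2) (t, u) := by
  induction k with
  | zero =>
    intro t u hu
    simp only [iteratedFDeriv_zero_eq_comp]
    exact (continuousMultilinearCurryFin0 ℝ E G).symm.contDiff.contDiffAt.comp _ (hf t u hu)
  | succ k ih =>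
    intro t u hu
    simp only [iteratedFDeriv_succ_eq_comp_left]
    have h : ContDiffAt ℝ ∞ (fun p : ℝ × E => fderiv ℝ (iteratedFDeriv ℝ k (f p.1)) p.2) (t, u) :=
      ContDiffAt.fderiv (f := fun p : ℝ × E => iteratedFDeriv ℝ k (f p.1)) (n := ∞)
        ((ih t u hu).comp (f := fun q : (ℝ × E) × E => (q.1.1, q.2)) ((t, u), u)
          ((contDiff_fst.fst.prodMk contDiff_snd).contDiffAt)) contDiffAt_snd (by simp)
    exact h.continuousLinearMap_comp
      ((continuousMultilinearCurryLeftEquiv ℝ (fun _ : Fin (k + 1) => E) G).symm :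
        _ →L[ℝ] E [×(k + 1)]→L[ℝ] G)

section Continuity

variable {E : Type*} [NormedAddCommGroup E] [NormedSpace ℝ E] {H : Type*} [TopologicalSpace H]
  {I : ModelWithCorners ℝ E H} {M : Type*} [TopologicalSpace M] [ChartedSpace H M]
  [IsManifold I ∞ M] {n : ℕ} {o : ManifoldOrientation (Fin n × Fin 2) I M}

/-- Joint smoothness makes every iterated derivative jointly continuous in `(t, u)`. Over a compact
set of values of `u`, joint continuity implies uniform convergence as `t` varies, which is what the
topology asks for. -/
theorem ComplexStructure.continuous_of_contDiffAt_inChart [I.Boundaryless]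
    {J : ℝ → ComplexStructure o}
    (hJ : ∀ (x₀ : M) (t : ℝ), ∀ u ∈ (extChartAt I x₀).target,
      ContDiffAt ℝ ∞ (fun p : ℝ × E => (J p.1).inChart x₀ p.2) (t, u)) : Continuous J := by
  rw [continuous_iInf_rng]
  intro x₀
  rw [continuous_iInf_rng]
  intro k
  rw [continuous_induced_rng, continuous_iff_continuousAt]
  intro t
  refine UniformOnFun.tendsto_iff_tendstoUniformlyOn.2 fun K hK => ?_
  have hc : ContinuousOn (Function.uncurry fun t u =>
      iteratedFDerivWithin ℝ k ((J t).inChart x₀) (extChartAt I x₀).target u) (Set.univ ×ˢ K) := by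
    rintro ⟨t, u⟩ ⟨-, hu⟩
    have h := (contDiffAt_iteratedFDeriv_family (f := fun t => (J t).inChart x₀) (hJ x₀) k t u
      (hK.2 hu)).continuousAt.continuousWithinAt (s := Set.univ ×ˢ K)
    refine h.congr ?_ ?_
    · rintro ⟨t, u⟩ ⟨-, hu⟩
      exact iteratedFDerivWithin_of_isOpen k (isOpen_extChartAt_target x₀) (hK.2 hu)
    · exact iteratedFDerivWithin_of_isOpen k (isOpen_extChartAt_target x₀) (hK.2 hu)
  intro v hv
  obtain ⟨w, hw, h⟩ := hK.1.mem_uniformity_of_prod hc (Set.mem_univ t) (symm_le_uniformity hv)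
  rw [nhdsWithin_univ] at hw
  filter_upwards [hw] with s hs u hu using h s hs u hu

/-- Complex structures that depend smoothly on a parameter, when read in a parametrization, form a
continuous family. -/
theorem ComplexStructure.continuous_of_readsAs [I.Boundaryless] {P : C2 → M} (hP : IsParam I P)
    {J : ℝ → ComplexStructure o} {j : ℝ → C2 → C2 →L[ℝ] C2}
    (hj : ∀ t, ∀ z ≠ 0, ContDiffAt ℝ ∞ (fun p : ℝ × C2 => j p.1 p.2) (t, z))
    (hJ : ∀ t, ReadsAs P (J t).op (j t)) : Continuous J := by
  refine continuous_of_contDiffAt_inChart fun x₀ t u hu => ?_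
  obtain ⟨z₀, hz₀, h₀⟩ := hP.exists_eq ((extChartAt I x₀).symm u)
  obtain ⟨q, G, hq, hq0, hG, h⟩ := exists_inTangentCoordinates_eq
    (hP.isLocalDiffeomorphAt z₀ hz₀) hu h₀
  have hq' : ContDiffAt ℝ ∞ (fun p : ℝ × E => q p.2) (t, u) :=
    ContDiffAt.comp (g := q) _ hq contDiffAt_snd
  have hs : ContDiffAt ℝ ∞ (fun p : ℝ × E =>
      (fderiv ℝ G (q p.2)).comp ((j p.1 (q p.2)).comp (fderiv ℝ q p.2))) (t, u) := by
    have h1 : ContDiffAt ℝ ∞ (fun p : ℝ × E => fderiv ℝ q p.2) (t, u) :=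
      ContDiffAt.comp (g := fderiv ℝ q) _ (hq.fderiv_right (by simp)) contDiffAt_snd
    have h2 : ContDiffAt ℝ ∞ (fun p : ℝ × E => fderiv ℝ G (q p.2)) (t, u) := by
      refine ContDiffAt.comp (g := fderiv ℝ G) _ ?_ hq'
      rw [hq0]
      exact hG.fderiv_right (by simp)
    have h3 : ContDiffAt ℝ ∞ (fun p : ℝ × E => j p.1 (q p.2)) (t, u) := by
      refine ContDiffAt.comp (g := fun p : ℝ × C2 => j p.1 p.2) (f := fun p : ℝ × E => (p.1, q p.2))
        _ ?_ (contDiffAt_fst.prodMk hq')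
      simp only [hq0]
      exact hj t z₀ hz₀
    exact h2.clm_comp (h3.clm_comp h1)
  refine hs.congr_of_eventuallyEq ?_
  have hqz : ∀ᶠ u in 𝓝 u, q u ≠ 0 :=
    hq.continuousAt.eventually (isOpen_compl_singleton.mem_nhds (by rw [hq0]; exact hz₀))
  have htend : Filter.Tendsto (Prod.snd : ℝ × E → E) (𝓝 (t, u)) (𝓝 u) :=
    continuous_snd.continuousAt
  filter_upwards [htend.eventually (h.and hqz)] with p hp
  exact hp.1 (J p.1).op (j p.1 (q p.2)) (hJ p.1 _ hp.2)

end Continuity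

/-! ### Non-separation caused by a jumping family -/

section Degeneration

variable {E : Type*} [NormedAddCommGroup E] [NormedSpace ℝ E] {H : Type*} [TopologicalSpace H]
  {I : ModelWithCorners ℝ E H} {M : Type*} [TopologicalSpace M] [ChartedSpace H M]
  [IsManifold I ∞ M] {n : ℕ} {o : ManifoldOrientation (Fin n × Fin 2) I M}

/-- An open set containing `γ 0` contains `γ t` for small `t > 0`, and this point is already `γ 1`.
-/
theorem specializes_of_curve {X : Type*} [TopologicalSpace X] {γ : ℝ → X} (hγ : Continuous γ)
    (h : ∀ t ∈ Set.Ioc (0 : ℝ) 1, γ t = γ 1) : γ 1 ⤳ γ 0 := by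
  rw [specializes_iff_forall_open]
  intro s hs h0
  have h1 : ∀ᶠ t in 𝓝[>] (0 : ℝ), γ t ∈ s :=
    hγ.continuousAt.continuousWithinAt.eventually (hs.mem_nhds h0)
  obtain ⟨t, ht, ht'⟩ := (h1.and (Ioc_mem_nhdsGT (zero_lt_one' ℝ))).exists
  rwa [h t ht'] at ht

/-- A family of complex structures that are all equivalent except the first one. -/
structure IsDegeneration (J : ℝ → ComplexStructure o) : Prop where
  continuous : Continuous J
  rel : ∀ t ∈ Set.Ioc (0 : ℝ) 1, TeichmullerRel (J 1) (J t)
  mk_ne : TeichmullerSpace.mk (J 0) ≠ TeichmullerSpace.mk (J 1)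

namespace IsDegeneration

variable {J : ℝ → ComplexStructure o}

theorem mem_connectedComponent (h : IsDegeneration J) (t : ℝ) : J t ∈ connectedComponent (J 0) :=
  (isPreconnected_range h.continuous).subset_connectedComponent (Set.mem_range_self 0)
    (Set.mem_range_self t)

theorem specializes (h : IsDegeneration J) : TeichmullerSpace.mk (J 1) ⤳ TeichmullerSpace.mk (J 0) :=
  specializes_of_curve (γ := fun t => TeichmullerSpace.mk (J t))
    (continuous_quot_mk.comp h.continuous) fun t ht => (Quot.sound (h.rel t ht)).symm

theorem specializes_component (h : IsDegeneration J) :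
    TeichmullerComponent.mk ⟨J 1, h.mem_connectedComponent 1⟩ ⤳
      TeichmullerComponent.mk ⟨J 0, h.mem_connectedComponent 0⟩ :=
  specializes_of_curve
    (γ := fun t => TeichmullerComponent.mk (J₀ := J 0) ⟨J t, h.mem_connectedComponent t⟩)
    (continuous_quot_mk.comp (h.continuous.subtype_mk _)) fun t ht =>
      Eq.symm (Quot.sound (r := fun J' J'' : connectedComponent (J 0) => TeichmullerRel J'.1 J''.1)
        (h.rel t ht))

/-- The quotient of the connected component maps to the whole Teichmüller space, and the images of
the two classes differ there. -/
theorem component_ne (h : IsDegeneration J) :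
    TeichmullerComponent.mk (J₀ := J 0) ⟨J 0, h.mem_connectedComponent 0⟩ ≠
      TeichmullerComponent.mk ⟨J 1, h.mem_connectedComponent 1⟩ := fun he =>
  h.mk_ne (congrArg (Quot.lift (fun J' : connectedComponent (J 0) => TeichmullerSpace.mk J'.1)
    fun _ _ hr => Quot.sound hr) he)

theorem not_isLocallyHausdorff (h : IsDegeneration J) : ¬ IsLocallyHausdorff (TeichmullerSpace o) :=
  not_isLocallyHausdorff_of_specializes h.specializes h.mk_ne

theorem not_isLocallyHausdorff_component (h : IsDegeneration J) : ¬ IsLocallyHausdorff (TeichmullerComponent (J 0)) :=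
  not_isLocallyHausdorff_of_specializes h.specializes_component h.component_ne

theorem not_disjoint_nhds (h : IsDegeneration J) :
    ¬ Disjoint (𝓝 (TeichmullerSpace.mk (J 0))) (𝓝 (TeichmullerSpace.mk (J 1))) := fun hd =>
  Filter.NeBot.ne inferInstance (hd.eq_bot_of_ge h.specializes)

theorem mem_of_mem_nhds (h : IsDegeneration J)
    {U : Set (TeichmullerComponent (J 0))}
    (hU : U ∈ 𝓝 (TeichmullerComponent.mk ⟨J 0, h.mem_connectedComponent 0⟩)) :
    TeichmullerComponent.mk ⟨J 1, h.mem_connectedComponent 1⟩ ∈ U :=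
  _root_.mem_of_mem_nhds (h.specializes_component hU)

end IsDegeneration

end Degeneration

/-! ### Local diffeomorphisms on an open subset and on the ambient space -/

section LocalDiffeo

variable {E₁ E₂ H₁ H₂ M₁ M₂ : Type*} [NormedAddCommGroup E₁] [NormedSpace ℝ E₁]
  [NormedAddCommGroup E₂] [NormedSpace ℝ E₂] [TopologicalSpace H₁] [TopologicalSpace H₂]
  {I₁ : ModelWithCorners ℝ E₁ H₁} {I₂ : ModelWithCorners ℝ E₂ H₂} [TopologicalSpace M₁]
  [TopologicalSpace M₂] [ChartedSpace H₁ M₁] [ChartedSpace H₂ M₂]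

theorem IsLocalDiffeomorphAt.congr_of_eventuallyEq {f g : M₁ → M₂} {x : M₁}
    (hf : IsLocalDiffeomorphAt I₁ I₂ ∞ f x) (h : g =ᶠ[𝓝 x] f) :
    IsLocalDiffeomorphAt I₁ I₂ ∞ g x := by
  obtain ⟨Φ, hx, hΦ⟩ := hf
  obtain ⟨s, hs, hso, hxs⟩ := mem_nhds_iff.1 h
  let Φ' := Φ.toOpenPartialHomeomorph.restrOpen s hso
  have hsrc : Φ'.source = Φ.source ∩ s := rfl
  have htgt : Φ'.target ⊆ Φ.target := fun y hy => by
    have : y ∈ Φ.target ∩ _ := hy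
    exact this.1
  refine ⟨{ toPartialEquiv := Φ'.toPartialEquiv
            open_source := Φ'.open_source
            open_target := Φ'.open_target
            contMDiffOn_toFun := Φ.contMDiffOn_toFun.mono Set.inter_subset_left
            contMDiffOn_invFun := Φ.contMDiffOn_invFun.mono htgt }, ⟨hx, hxs⟩, ?_⟩
  rintro y ⟨hy, hys⟩
  exact (hs hys).trans (hΦ hy)

/-- The inclusion of an open subset, as a partial diffeomorphism. -/
def TopologicalSpace.Opens.partialDiffeomorph (U : Opens M₁) (h : Nonempty U) :
    PartialDiffeomorph I₁ I₁ U M₁ ∞ where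
  toPartialEquiv := (U.openPartialHomeomorphSubtypeCoe h).toPartialEquiv
  open_source := (U.openPartialHomeomorphSubtypeCoe h).open_source
  open_target := (U.openPartialHomeomorphSubtypeCoe h).open_target
  contMDiffOn_toFun := contMDiff_subtype_val.contMDiffOn
  contMDiffOn_invFun := by
    intro x hx
    refine ContMDiffAt.contMDiffWithinAt ?_
    rw [← ContMDiffAt.subtypeVal_comp_iff]
    refine contMDiffAt_id.congr_of_eventuallyEq ?_
    filter_upwards [(U.openPartialHomeomorphSubtypeCoe h).open_target.mem_nhds hx] with y hy
    exact (U.openPartialHomeomorphSubtypeCoe h).right_inv hy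

theorem isLocalDiffeomorphAt_subtype_iff {U : Opens M₁} {f : M₁ → M₂} {x : U} :
    IsLocalDiffeomorphAt I₁ I₂ ∞ (fun y : U => f y) x ↔ IsLocalDiffeomorphAt I₁ I₂ ∞ f x := by
  have hx : (x : M₁) ∈ (U.partialDiffeomorph (I₁ := I₁) ⟨x⟩).target :=
    (U.openPartialHomeomorphSubtypeCoe ⟨x⟩).map_source (x := x) (by simp)
  constructor
  · intro h
    have hi : (U.partialDiffeomorph (I₁ := I₁) ⟨x⟩).symm x = x :=
      (U.openPartialHomeomorphSubtypeCoe ⟨x⟩).left_inv (x := x) (by simp)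
    have h1 := (U.partialDiffeomorph (I₁ := I₁) ⟨x⟩).symm.isLocalDiffeomorphAt _ _ _ hx
    rw [← hi] at h
    refine (IsLocalDiffeomorphAt.comp I₂ M₂ h1 h).congr_of_eventuallyEq ?_
    filter_upwards [(U.partialDiffeomorph (I₁ := I₁) ⟨x⟩).open_target.mem_nhds hx] with y hy
    exact congrArg f ((U.openPartialHomeomorphSubtypeCoe ⟨x⟩).right_inv hy).symm
  · intro h
    have h1 := (U.partialDiffeomorph (I₁ := I₁) ⟨x⟩).isLocalDiffeomorphAt _ _ _
      (Set.mem_univ x)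
    exact IsLocalDiffeomorphAt.comp I₂ M₂ h1 h

end LocalDiffeo

theorem mfderiv_subtype_val_apply {F : Type*} [NormedAddCommGroup F] [NormedSpace ℝ F]
    (U : Opens F) (x : U) (v : F) :
    (mfderiv 𝓘(ℝ, F) 𝓘(ℝ, F) (Subtype.val : U → F) x v : F) = v := by
  have hd : MDifferentiableAt 𝓘(ℝ, F) 𝓘(ℝ, F) (Subtype.val : U → F) x :=
    (contMDiff_subtype_val (n := 1) x).mdifferentiableAt (by simp)
  have h := U.chartAt_subtype_val_symm_eventuallyEq (H := F) (x := x)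
  have h' : writtenInExtChartAt 𝓘(ℝ, F) 𝓘(ℝ, F) x (Subtype.val : U → F) =ᶠ[𝓝 (x : F)] id := by
    filter_upwards [h] with y hy
    exact hy.symm
  have h2 := h'.fderiv_eq (𝕜 := ℝ)
  rw [fderiv_id] at h2
  refine (congrArg (fun L => L v) hd.mfderiv).trans ?_
  simp only [modelWithCornersSelf_coe, Set.range_id, fderivWithin_univ]
  exact congrArg (fun L => L v) h2

/-! ### Biholomorphisms with Hopf surfaces as parametrizations -/

section Hopf

variable {E : Type*} [NormedAddCommGroup E] [NormedSpace ℝ E] {H : Type*} [TopologicalSpace H]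
  {I : ModelWithCorners ℝ E H} {M : Type*} [TopologicalSpace M] [ChartedSpace H M]

theorem mfderiv_punctured {P : C2 → M} {z : PuncturedPlane}
    (hP : IsLocalDiffeomorphAt 𝓘(ℝ, C2) I ∞ P z) (v : C2) :
    (mfderiv 𝓘(ℝ, C2) I (fun w : PuncturedPlane => P w) z v : E) = (tder I P z v : E) := by
  have h := mfderiv_comp z (hP.contMDiffAt.mdifferentiableAt (by simp))
    ((contMDiff_subtype_val (I := 𝓘(ℝ, C2)) (n := 1) z).mdifferentiableAt (by simp))
  refine (congrArg (fun L => L v) h).trans ?_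
  exact congrArg (tder I P z) (mfderiv_subtype_val_apply PuncturedPlane z v)

variable [IsManifold I ∞ M] {n : ℕ} {o : ManifoldOrientation (Fin n × Fin 2) I M}
  {J : ComplexStructure o} {g : C2 → C2}

/-- The covering, defined on the subtype `ℂ² ∖ {0}`, is extended to `ℂ²` by an irrelevant value at
`0`, so that its differentials have the vector space `ℂ²` as source. -/
theorem IsBiholomorphicToHopf.exists_param (h : IsBiholomorphicToHopf J g) :
    ∃ (φ : HopfSurface g ≃ M) (P : C2 → M), IsParam I P ∧
      (∀ z : PuncturedPlane, φ (Quot.mk _ z) = P z) ∧ ReadsAs P J.op fun _ => mulI := by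
  obtain ⟨φ, hφ, hJ⟩ := h
  classical
  let P : C2 → M := fun z =>
    if hz : z ≠ 0 then φ (Quot.mk _ ⟨z, hz⟩) else φ (Quot.mk _ ⟨fun _ => 1, by
      intro h; exact one_ne_zero (congrFun h 0)⟩)
  have hPφ : ∀ z : PuncturedPlane, φ (Quot.mk _ z) = P z := by
    intro z
    simp only [P]
    rw [dif_pos (show (z : C2) ≠ 0 from z.2)]
  have hfun : (fun z : PuncturedPlane => φ (Quot.mk _ z)) = fun z : PuncturedPlane => P z :=
    funext hPφ
  have hloc : ∀ z ≠ 0, IsLocalDiffeomorphAt 𝓘(ℝ, C2) I ∞ P z := by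
    intro z hz
    have h1 := hφ ⟨z, hz⟩
    rw [hfun] at h1
    exact isLocalDiffeomorphAt_subtype_iff.1 h1
  refine ⟨φ, P, ⟨hloc, fun x => ?_⟩, hPφ, fun z hz v => ?_⟩
  · obtain ⟨q, rfl⟩ := φ.surjective x
    obtain ⟨z, rfl⟩ := Quot.exists_rep q
    exact ⟨z, z.2, (hPφ z).symm⟩
  · have h1 := hJ ⟨z, hz⟩ v
    have key : ∀ (f : PuncturedPlane → M) (_ : f = fun z : PuncturedPlane => P z),
        mfderiv 𝓘(ℝ, C2) I f ⟨z, hz⟩ (Complex.I • v) = J.op (f ⟨z, hz⟩)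
          (mfderiv 𝓘(ℝ, C2) I f ⟨z, hz⟩ v) → 
        J.op (P z) (tder I P z v) = tder I P z (mulI v) := by
      rintro f rfl hf
      have e1 := mfderiv_punctured (z := ⟨z, hz⟩) (hloc z hz) v
      have e2 := mfderiv_punctured (z := ⟨z, hz⟩) (hloc z hz) (mulI v)
      exact ((congrArg (J.op (P z)) e1).symm.trans hf.symm).trans e2
    exact key _ hfun h1

theorem isBiholomorphicToHopf_of_param (φ : HopfSurface g ≃ M) {P : C2 → M}
    (hP : ∀ z ≠ 0, IsLocalDiffeomorphAt 𝓘(ℝ, C2) I ∞ P z)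
    (hφ : ∀ z : PuncturedPlane, φ (Quot.mk _ z) = P z) (hJ : ReadsAs P J.op fun _ => mulI) :
    IsBiholomorphicToHopf J g := by
  have hfun : (fun z : PuncturedPlane => φ (Quot.mk _ z)) = fun z : PuncturedPlane => P z :=
    funext hφ
  refine ⟨φ, ?_, ?_⟩
  · rw [hfun]
    exact fun z => isLocalDiffeomorphAt_subtype_iff.2 (hP z z.2)
  · intro z v
    have key : ∀ (f : PuncturedPlane → M) (_ : f = fun z : PuncturedPlane => P z),
        mfderiv 𝓘(ℝ, C2) I f z (Complex.I • v) = J.op (f z) (mfderiv 𝓘(ℝ, C2) I f z v) := by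
      rintro f rfl
      have e1 := mfderiv_punctured (hP z z.2) v
      have e2 := mfderiv_punctured (hP z z.2) (mulI v)
      exact e2.trans ((hJ z z.2 v).symm.trans (congrArg (J.op (P z)) e1).symm)
    exact key _ hfun

end Hopf

/-! ### Homothety and Jordan Hopf surfaces are not biholomorphic -/

section Rigidity

variable {E : Type*} [NormedAddCommGroup E] [NormedSpace ℝ E] {H : Type*} [TopologicalSpace H]
  {I : ModelWithCorners ℝ E H} {M : Type*} [TopologicalSpace M] [ChartedSpace H M]

theorem IsParam.tder_injective {P : C2 → M} (hP : IsParam I P) {z : C2} (hz : z ≠ 0) :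
    Function.Injective (tder I P z) := by
  obtain ⟨e, he⟩ := (hP.isLocalDiffeomorphAt z hz).exists_tder_equiv
  rw [← he]
  exact e.injective

/-- The differential of a parametrization is compatible with the linear maps that leave the
parametrization invariant. -/
theorem IsParam.tder_of_invariant {P : C2 → M} (hP : IsParam I P) {A : C2 →L[ℂ] C2} {z w : C2}
    (hz : z ≠ 0) (hw : w ≠ 0) (hAz : A z = w) (hA : ∀ y ≠ 0, P (A y) = P y) (v : C2) :
    (tder I P w (A v) : E) = (tder I P z v : E) := by
  have h1 : (fun y => P (A.restrictScalars ℝ y)) =ᶠ[𝓝 z] P := by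
    filter_upwards [isOpen_compl_singleton.mem_nhds hz] with y hy using hA y hy
  have h2 := h1.tder_eq (I := I) v
  subst hAz
  rw [tder_comp (F' := C2) (P := P) (φ := A.restrictScalars ℝ) (z := z)
    (hP.mdifferentiableAt hw) (A.restrictScalars ℝ).differentiableAt,
    ContinuousLinearMap.fderiv] at h2
  exact h2

/-- The change of coordinates `q` is a local inverse of `P` after `R`. Both parametrizations read
the same operator as `i`, so `dq` commutes with `i`, that is, `q` is holomorphic. -/
theorem IsParam.exists_transition {P R : C2 → M} (hP : IsParam I P) (hR : IsParam I R)
    {op : ∀ x : M, TangentSpace I x →L[ℝ] TangentSpace I x}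
    (hPop : ReadsAs P op fun _ => mulI) (hRop : ReadsAs R op fun _ => mulI) {z₀ w₀ : C2}
    (hz₀ : z₀ ≠ 0) (hw₀ : w₀ ≠ 0) (h₀ : P z₀ = R w₀) :
    ∃ q : C2 → C2, ContDiffAt ℝ ∞ q w₀ ∧ q w₀ = z₀ ∧ ∀ᶠ w in 𝓝 w₀, q w ≠ 0 ∧ P (q w) = R w ∧
      (∀ v, (tder I R w v : E) = (tder I P (q w) (fderiv ℝ q w v) : E)) ∧
      ∀ v, fderiv ℝ q w (mulI v) = mulI (fderiv ℝ q w v) := by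
  have hl := hP.isLocalDiffeomorphAt z₀ hz₀
  have hRc := (hR.isLocalDiffeomorphAt w₀ hw₀).contMDiffAt
  obtain ⟨q, hqe⟩ : ∃ q : C2 → C2, q = fun w => hl.localInverse (R w) := ⟨_, rfl⟩
  have hq : ContDiffAt ℝ ∞ q w₀ := by
    have h1 := hl.localInverse_contMDiffAt
    rw [h₀] at h1
    rw [hqe]
    exact (h1.comp w₀ hRc).contDiffAt
  have hq0 : q w₀ = z₀ := by
    rw [hqe]
    simp only [← h₀]
    exact hl.localInverse_left_inv hl.localInverse_mem_target
  refine ⟨q, hq, hq0, ?_⟩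
  have hPq : ∀ᶠ w in 𝓝 w₀, P (q w) = R w := by
    have : Filter.Tendsto R (𝓝 w₀) (𝓝 (P z₀)) := by rw [h₀]; exact hRc.continuousAt
    rw [hqe]
    exact this.eventually hl.localInverse_eventuallyEq_right
  have hq1 : ∀ᶠ w in 𝓝 w₀, DifferentiableAt ℝ q w := by
    have := (hq.of_le (m := 1) (by exact_mod_cast le_top)).eventually (by simp)
    filter_upwards [this] with u hu using hu.differentiableAt (by simp)
  have hqz : ∀ᶠ w in 𝓝 w₀, q w ≠ 0 :=
    hq.continuousAt.eventually (isOpen_compl_singleton.mem_nhds (by rw [hq0]; exact hz₀))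
  filter_upwards [hPq.eventually_nhds, hq1, hqz, isOpen_compl_singleton.mem_nhds hw₀]
    with w hPw hqw hqwz hwz
  have hd : ∀ v, (tder I R w v : E) = (tder I P (q w) (fderiv ℝ q w v) : E) := by
    intro v
    have h1 := Filter.EventuallyEq.tder_eq (I := I) hPw v
    rw [tder_comp (hP.mdifferentiableAt hqwz) hqw] at h1
    exact h1.symm
  refine ⟨hqwz, hPw.self_of_nhds, hd, fun v => hP.tder_injective hqwz ?_⟩
  have aux : ∀ (y : M) (_ : P (q w) = y) (a : TangentSpace I y) (b : TangentSpace I (P (q w))),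
      (a : E) = (b : E) → (op y a : E) = (op (P (q w)) b : E) := by
    rintro _ rfl a b h
    exact congrArg (op (P (q w))) h
  exact (hd (mulI v)).symm.trans ((hRop w hwz v).symm.trans
    ((aux _ hPw.self_of_nhds _ _ (hd v)).trans (hPop _ hqwz _)))

/-- A smooth vector field that is transformed to a complex linear one by a holomorphic map with
invertible differential is holomorphic. -/
theorem differentiableAt_of_pushforward_linear {q V : C2 → C2} {w₀ : C2} (B : C2 →L[ℂ] C2)
    (hq : ContDiffAt ℝ ∞ q w₀) (hinj : Function.Injective (fderiv ℝ q w₀))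
    (hqI : ∀ᶠ w in 𝓝 w₀, ∀ v, fderiv ℝ q w (mulI v) = mulI (fderiv ℝ q w v))
    (hV : ∀ᶠ w in 𝓝 w₀, fderiv ℝ q w (V w) = B (q w)) : DifferentiableAt ℂ V w₀ := by
  have hq' : ContDiffAt ℝ ∞ (fderiv ℝ q) w₀ := hq.fderiv_right (by simp)
  have hqd : DifferentiableAt ℝ q w₀ := hq.differentiableAt (by simp)
  have hqd' : DifferentiableAt ℝ (fderiv ℝ q) w₀ := hq'.differentiableAt (by simp)
  obtain ⟨e, he⟩ : ∃ e : C2 ≃L[ℝ] C2, (e : C2 →L[ℝ] C2) = fderiv ℝ q w₀ :=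
    ⟨(LinearEquiv.ofInjectiveEndo (fderiv ℝ q w₀ : C2 →ₗ[ℝ] C2) hinj).toContinuousLinearEquiv,
      by ext v; rfl⟩
  -- Near `w₀` the field `V` is `(dq)⁻¹ (B q)`, so its real differentiability need not be assumed.
  have hinv : ContDiffAt ℝ ∞ (fun w => (fderiv ℝ q w).inverse (B.restrictScalars ℝ (q w))) w₀ := by
    have h1 : ContDiffAt ℝ ∞ (fun w => (fderiv ℝ q w).inverse) w₀ := by
      refine ContDiffAt.comp (g := ContinuousLinearMap.inverse) _ ?_ hq'
      rw [← he]
      exact contDiffAt_map_inverse e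
    exact h1.clm_apply ((B.restrictScalars ℝ).contDiff.contDiffAt.comp _ hq)
  have hunit : ∀ᶠ w in 𝓝 w₀, ∃ e : C2 ≃L[ℝ] C2, (e : C2 →L[ℝ] C2) = fderiv ℝ q w :=
    hq'.continuousAt.eventually (he ▸ e.nhds)
  have hVd : DifferentiableAt ℝ V w₀ := by
    refine (hinv.differentiableAt (by simp)).congr_of_eventuallyEq ?_
    filter_upwards [hV, hunit] with w hw ⟨e, he⟩
    rw [← he] at hw ⊢
    rw [ContinuousLinearMap.inverse_equiv]
    exact (e.symm_apply_eq.2 hw.symm).symm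
  -- The derivative of `dq(V) = B q`: `q''(h, V) + dq(V' h) = B (dq h)`.
  have h1 : ∀ h, fderiv ℝ (fderiv ℝ q) w₀ h (V w₀) + fderiv ℝ q w₀ (fderiv ℝ V w₀ h) =
      B (fderiv ℝ q w₀ h) := by
    intro h
    have hl := hqd'.hasFDerivAt.clm_apply hVd.hasFDerivAt
    have hr := ((B.restrictScalars ℝ).hasFDerivAt (x := q w₀)).comp w₀ hqd.hasFDerivAt
    have := (hr.congr_of_eventuallyEq (f₁ := fun w => fderiv ℝ q w (V w)) hV).unique hl
    have := congrArg (fun L => L h) this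
    simp at this
    rw [this]
    abel
  have h2 : ∀ v h, fderiv ℝ (fderiv ℝ q) w₀ h (mulI v) =
      mulI (fderiv ℝ (fderiv ℝ q) w₀ h v) := by
    intro v h
    have hl := hqd'.hasFDerivAt.clm_apply (hasFDerivAt_const (mulI v) w₀)
    have hr := (mulI.hasFDerivAt (x := fderiv ℝ q w₀ v)).comp w₀
      (hqd'.hasFDerivAt.clm_apply (hasFDerivAt_const v w₀))
    have := (hr.congr_of_eventuallyEq (f₁ := fun w => fderiv ℝ q w (mulI v))
      (by filter_upwards [hqI] with w hw using hw v)).unique hl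
    have := congrArg (fun L => L h) this
    simpa using this.symm
  have hsymm : ∀ v h, fderiv ℝ (fderiv ℝ q) w₀ h v = fderiv ℝ (fderiv ℝ q) w₀ v h := by
    have : IsSymmSndFDerivAt ℝ q w₀ := hq.isSymmSndFDerivAt (by
      rw [minSmoothness_of_isRCLikeNormedField]; exact WithTop.coe_le_coe.2 le_top)
    intro v h
    exact this h v
  -- By symmetry `q''` is complex linear in each variable, and so is every other term of `h1` except
  -- `dq(V' h)`. Hence `dq(V' h)` is complex linear in `h`, and injectivity of `dq` gives the same
  -- for `V'`.
  have hVI : ∀ h, fderiv ℝ V w₀ (mulI h) = mulI (fderiv ℝ V w₀ h) := by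
    intro h
    apply hinj
    have a := h1 (mulI h)
    have b := h1 h
    rw [hsymm, h2, hsymm, hqI.self_of_nhds] at a
    rw [hqI.self_of_nhds]
    have c := congrArg mulI b
    have hB : B (mulI (fderiv ℝ q w₀ h)) = mulI (B (fderiv ℝ q w₀ h)) := map_smul B _ _
    rw [map_add] at c
    rw [hB] at a
    exact add_left_cancel (a.trans c.symm)
  rw [differentiableAt_iff_restrictScalars ℝ hVd]
  refine ⟨LinearMap.toContinuousLinearMap
    { toFun := fderiv ℝ V w₀, map_add' := map_add _, map_smul' := fun c v => ?_ }, by ext v; rfl⟩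
  have hc : c • v = c.re • v + c.im • mulI v := by
    conv_lhs => rw [← Complex.re_add_im c]
    rw [add_smul, mul_smul]
    rfl
  have hc' : c • fderiv ℝ V w₀ v = c.re • fderiv ℝ V w₀ v + c.im • mulI (fderiv ℝ V w₀ v) := by
    conv_lhs => rw [← Complex.re_add_im c]
    rw [add_smul, mul_smul]
    rfl
  rw [RingHom.id_apply, hc, hc', map_add, map_smul, map_smul, hVI]

theorem mulVec_scalar (l : ℂ) (z : C2) : (!![l, 0; 0, l] : Matrix _ _ ℂ).mulVec z = l • z := by
  ext i
  fin_cases i <;> simp [Matrix.mulVec, dotProduct, Fin.sum_univ_two]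

theorem mulVec_jordan (l c : ℂ) (z : C2) :
    (!![l, c; 0, l] : Matrix _ _ ℂ).mulVec z = ![l * z 0 + c * z 1, l * z 1] := by
  ext i
  fin_cases i <;> simp [Matrix.mulVec, dotProduct, Fin.sum_univ_two]

theorem HopfSurface.mk_eq {g : C2 → C2} {z w : PuncturedPlane} (h : (w : C2) = g z) :
    (Quot.mk _ z : HopfSurface g) = Quot.mk _ w :=
  Quot.sound h

theorem exists_zpow_smul_of_mk_eq {l : ℂ} (hl : l ≠ 0) {z w : PuncturedPlane}
    (h : (Quot.mk _ z : HopfSurface (!![l, 0; 0, l] : Matrix _ _ ℂ).mulVec) = Quot.mk _ w) :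
    ∃ k : ℤ, (w : C2) = l ^ k • (z : C2) := by
  have h' := Quot.eqvGen_exact h
  clear h
  induction h' with
  | rel z w h => exact ⟨1, by rw [h, mulVec_scalar, zpow_one]⟩
  | refl z => exact ⟨0, by simp⟩
  | symm z w _ ih =>
    obtain ⟨k, hk⟩ := ih
    exact ⟨-k, by rw [hk, smul_smul, zpow_neg, inv_mul_cancel₀ (zpow_ne_zero k hl), one_smul]⟩
  | trans x y z _ _ ih ih' =>
    obtain ⟨k, hk⟩ := ih
    obtain ⟨k', hk'⟩ := ih'
    exact ⟨k' + k, by rw [hk', hk, smul_smul, zpow_add₀ hl]⟩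

theorem invariant_zpow_smul {l : ℂ} (hl : l ≠ 0) {X : Type*} {P : C2 → X}
    (hP : ∀ z ≠ 0, P (l • z) = P z) (k : ℤ) : ∀ z ≠ 0, P (l ^ k • z) = P z := by
  induction k using Int.induction_on with
  | zero => simp
  | succ n ih =>
    intro z hz
    rw [zpow_add₀ hl, zpow_one, mul_smul, ih _ (smul_ne_zero hl hz), hP z hz]
  | pred n ih =>
    intro z hz
    rw [← hP _ (smul_ne_zero (zpow_ne_zero _ hl) hz), smul_smul, ← zpow_one_add₀ hl,
      show (1 + (-(n : ℤ) - 1)) = -n by ring, ih z hz]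

variable [IsManifold I ∞ M] {n : ℕ} {o : ManifoldOrientation (Fin n × Fin 2) I M}
  {J : ComplexStructure o}

/-- The Hopf surface of a homothety is not biholomorphic to the Hopf surface of a Jordan block. -/
theorem not_isBiholomorphicToHopf_jordan {l : ℂ} (h0 : 0 < ‖l‖) (h1 : ‖l‖ < 1)
    (hJ : IsBiholomorphicToHopf J (!![l, 0; 0, l] : Matrix _ _ ℂ).mulVec) :
    ¬ IsBiholomorphicToHopf J (!![l, 1; 0, l] : Matrix _ _ ℂ).mulVec := by
  intro hJ'
  have hl : l ≠ 0 := norm_pos_iff.1 h0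
  obtain ⟨φ, P, hP, hφ, hPJ⟩ := hJ.exists_param
  obtain ⟨ψ, R, hR, hψ, hRJ⟩ := hJ'.exists_param
  have hPl : ∀ z ≠ 0, P (l • z) = P z := by
    intro z hz
    have := hφ ⟨l • z, smul_ne_zero hl hz⟩
    rw [← this, ← hφ ⟨z, hz⟩]
    exact congrArg φ (HopfSurface.mk_eq (mulVec_scalar l z).symm).symm
  have hPorb : ∀ z ≠ 0, ∀ w ≠ 0, P z = P w → ∃ k : ℤ, w = l ^ k • z := by
    intro z hz w hw h
    rw [← hφ ⟨z, hz⟩, ← hφ ⟨w, hw⟩] at h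
    exact exists_zpow_smul_of_mk_eq hl (φ.injective h)
  let A : C2 →L[ℂ] C2 := (Matrix.toLin' (!![l, 1; 0, l] : Matrix _ _ ℂ)).toContinuousLinearMap
  have hA : ∀ z, A z = ![l * z 0 + z 1, l * z 1] := by
    intro z
    have := mulVec_jordan l 1 z
    rw [one_mul] at this
    exact this
  have hA0 : ∀ z ≠ 0, A z ≠ 0 := by
    intro z hz h
    apply hz
    rw [hA] at h
    have e1 : l * z 1 = 0 := congrFun h 1
    have e0 : l * z 0 + z 1 = 0 := congrFun h 0
    have f1 : z 1 = 0 := (mul_eq_zero.1 e1).resolve_left hl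
    rw [f1, add_zero] at e0
    have f0 : z 0 = 0 := (mul_eq_zero.1 e0).resolve_left hl
    ext i
    fin_cases i
    · exact f0
    · exact f1
  have hRA : ∀ z ≠ 0, R (A z) = R z := by
    intro z hz
    rw [← hψ ⟨A z, hA0 z hz⟩, ← hψ ⟨z, hz⟩]
    exact congrArg ψ (HopfSurface.mk_eq rfl).symm
  -- a linear map `B` gives a vector field on `M`, which is `V` in the parametrization `R`
  have hfield : ∀ B : C2 →L[ℂ] C2, ∃ V : C2 → C2, ∀ w ≠ 0, ∀ z ≠ 0, P z = R w →
      (tder I R w (V w) : E) = (tder I P z (B z) : E) := by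
    intro B
    have : ∀ w : C2, ∃ v : C2, w ≠ 0 → ∀ z ≠ 0, P z = R w →
        (tder I R w v : E) = (tder I P z (B z) : E) := by
      intro w
      by_cases hw : w = 0
      · exact ⟨0, fun h => (h hw).elim⟩
      obtain ⟨z₀, hz₀, h₀⟩ := hP.exists_eq (R w)
      obtain ⟨e, he⟩ := (hR.isLocalDiffeomorphAt w hw).exists_tder_equiv
      let e' : C2 ≃L[ℝ] E := e
      refine ⟨e'.symm (tder I P z₀ (B z₀) : E), fun _ z hz hzw => ?_⟩
      have h1 : ∀ v : C2, (tder I R w v : E) = e' v := fun v => by rw [← he]; rfl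
      rw [h1]
      refine (e'.apply_symm_apply _).trans ?_
      obtain ⟨k, rfl⟩ := hPorb z₀ hz₀ z hz (h₀.trans hzw.symm)
      have := hP.tder_of_invariant (A := l ^ k • ContinuousLinearMap.id ℂ C2) hz₀ hz rfl
        (invariant_zpow_smul hl hPl k) (B z₀)
      refine this.symm.trans ?_
      rw [map_smul]
      rfl
    choose V hV using this
    exact ⟨V, fun w hw => hV w hw⟩
  -- such a vector field is tangent to the axis
  have haxis : ∀ (B : C2 →L[ℂ] C2) (V : C2 → C2), (∀ w ≠ 0, ∀ z ≠ 0, P z = R w →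
      (tder I R w (V w) : E) = (tder I P z (B z) : E)) → V ![1, 0] 1 = 0 := by
    intro B V hV
    -- `w` and `A w` lie over the same point of `M`, and `V` represents the same tangent vector at
    -- both. `R ∘ A = R` compares the two readings.
    have hVA : ∀ w ≠ 0, V (A w) = A (V w) := by
      intro w hw
      apply hR.tder_injective (hA0 w hw)
      obtain ⟨z, hz, hzw⟩ := hP.exists_eq (R w)
      have e1 := hV w hw z hz hzw
      have e2 := hV (A w) (hA0 w hw) z hz (hzw.trans (hRA w hw).symm)
      exact e2.trans (e1.symm.trans (hR.tder_of_invariant hw (hA0 w hw) rfl hRA (V w)).symm)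
    have hVd : ∀ w ≠ 0, DifferentiableAt ℂ V w := by
      intro w hw
      obtain ⟨z, hz, hzw⟩ := hP.exists_eq (R w)
      obtain ⟨q, hq, hq0, hev⟩ := hP.exists_transition hR hPJ hRJ hz hw hzw
      refine differentiableAt_of_pushforward_linear B hq ?_ ?_ ?_
      · intro v v' hvv
        apply hR.tder_injective hw
        have h := hev.self_of_nhds.2.2.1
        exact (h v).trans ((congrArg (tder I P (q w)) hvv).trans (h v').symm)
      · filter_upwards [hev] with y hy using hy.2.2.2
      · filter_upwards [hev, isOpen_compl_singleton.mem_nhds hw] with y hy hy0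
        apply hP.tder_injective hy.1
        exact (hy.2.2.1 (V y)).symm.trans (hV y hy0 (q y) hy.1 hy.2.1)
    have hc : ∀ s : ℂ, s ≠ 0 → (![s, 0] : C2) ≠ 0 := fun s hs h => hs (congrFun h 0)
    have hcd : ∀ s : ℂ, DifferentiableAt ℂ (fun s : ℂ => (![s, 0] : C2)) s := by
      intro s
      rw [differentiableAt_pi]
      intro i
      fin_cases i
      · exact differentiableAt_id
      · exact differentiableAt_const _
    have hcomp : ∀ i, ∀ s ≠ 0, DifferentiableAt ℂ (fun s : ℂ => V ![s, 0] i) s := by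
      intro i s hs
      have := (hVd _ (hc s hs)).comp s (hcd s)
      exact differentiableAt_pi.1 this i
    have hAs : ∀ s : ℂ, A ![s, 0] = ![l * s, 0] := by
      intro s
      rw [hA]
      simp
    refine eq_zero_of_commute_jordan h0 h1 (v := fun s => V ![s, 0] 0)
      (w := fun s => V ![s, 0] 1) (hcomp 0) (hcomp 1) ?_ ?_
    · intro s hs
      have := hVA _ (hc s hs)
      rw [hAs, hA] at this
      exact congrFun this 1
    · intro s hs
      have := hVA _ (hc s hs)
      rw [hAs, hA] at this
      exact congrFun this 0
  have hw : (![1, 0] : C2) ≠ 0 := fun h => one_ne_zero (congrFun h 0)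
  obtain ⟨z, hz, hzw⟩ := hP.exists_eq (R ![1, 0])
  obtain ⟨e, he⟩ := (hP.isLocalDiffeomorphAt z hz).exists_tder_equiv
  let e' : C2 ≃L[ℝ] E := e
  -- A linear map takes any prescribed value at the nonzero vector `z`. Here the value is the vector
  -- read by `R` as `(0, 1)` at `(1, 0)`, which is transverse to the axis and contradicts `haxis`.
  obtain ⟨B, hB⟩ : ∃ B : C2 →L[ℂ] C2, B z = e'.symm (tder I R ![1, 0] ![0, 1] : E) := by
    obtain ⟨f, hf⟩ := SeparatingDual.exists_eq_one (R := ℂ) hz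
    exact ⟨f.smulRight (e'.symm (tder I R ![1, 0] ![0, 1] : E)), by simp [hf]⟩
  obtain ⟨V, hV⟩ := hfield B
  have h2 := haxis B V hV
  have h3 : V ![1, 0] = ![0, 1] := by
    apply hR.tder_injective hw
    refine (hV _ hw z hz hzw).trans ?_
    rw [hB, ← he]
    exact e'.apply_symm_apply _
  rw [h3] at h2
  exact one_ne_zero h2

end Rigidity

/-! ### The logarithmic shear of the plane -/

/-- The logarithm of the square of the hermitian norm on `ℂ²`. -/
def logNormSq (z : C2) : ℝ := Real.log (‖z 0‖ ^ 2 + ‖z 1‖ ^ 2)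

theorem normSq_pos {z : C2} (hz : z ≠ 0) : 0 < ‖z 0‖ ^ 2 + ‖z 1‖ ^ 2 := by
  by_contra! h
  apply hz
  have h0 : ‖z 0‖ = 0 := by nlinarith [sq_nonneg ‖z 0‖, sq_nonneg ‖z 1‖]
  have h1 : ‖z 1‖ = 0 := by nlinarith [sq_nonneg ‖z 0‖, sq_nonneg ‖z 1‖]
  ext i
  fin_cases i
  · exact norm_eq_zero.1 h0
  · exact norm_eq_zero.1 h1

theorem contDiff_normSq : ContDiff ℝ ∞ fun z : C2 => ‖z 0‖ ^ 2 + ‖z 1‖ ^ 2 :=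
  ((contDiff_apply ℝ ℂ 0).norm_sq ℝ).add ((contDiff_apply ℝ ℂ 1).norm_sq ℝ)

theorem contDiffAt_logNormSq {z : C2} (hz : z ≠ 0) : ContDiffAt ℝ ∞ logNormSq z :=
  contDiff_normSq.contDiffAt.log (normSq_pos hz).ne'

theorem logNormSq_zpow_smul {l : ℂ} (hl : l ≠ 0) (k : ℤ) {z : C2} (hz : z ≠ 0) :
    logNormSq (l ^ k • z) = logNormSq z + 2 * k * Real.log ‖l‖ := by
  have h : ‖(l ^ k • z) 0‖ ^ 2 + ‖(l ^ k • z) 1‖ ^ 2 =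
      (‖l‖ ^ k) ^ 2 * (‖z 0‖ ^ 2 + ‖z 1‖ ^ 2) := by
    simp only [Pi.smul_apply, smul_eq_mul, norm_mul, norm_zpow]
    ring
  have hp : 0 < ‖l‖ ^ k := zpow_pos (norm_pos_iff.2 hl) k
  rw [logNormSq, h, Real.log_mul (by positivity) (normSq_pos hz).ne', Real.log_pow, Real.log_zpow,
    logNormSq]
  push_cast
  ring

/-- With `r` and `s` the norms of `(x, a)` and `(y, a)`, this combines `log r - log s ≤ (r - s) /
s`, `r - s ≤ ‖x - y‖` and `‖a‖ ≤ s`. The factor `2` comes from the squares. The bound is uniform in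
`a`, so on every line `y = a` the shear is a controlled perturbation of the identity. -/
theorem abs_log_sub_log_mul_le (a x y : ℂ) :
    |Real.log (‖x‖ ^ 2 + ‖a‖ ^ 2) - Real.log (‖y‖ ^ 2 + ‖a‖ ^ 2)| * ‖a‖ ≤ 2 * ‖x - y‖ := by
  rcases eq_or_ne a 0 with rfl | ha
  · simp
  have ha' : 0 < ‖a‖ := norm_pos_iff.2 ha
  have key : ∀ x y : ℂ, (Real.log (‖x‖ ^ 2 + ‖a‖ ^ 2) - Real.log (‖y‖ ^ 2 + ‖a‖ ^ 2)) * ‖a‖ ≤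
      2 * ‖x - y‖ := by
    intro x y
    have hx : 0 < ‖x‖ ^ 2 + ‖a‖ ^ 2 := by positivity
    have hy : 0 < ‖y‖ ^ 2 + ‖a‖ ^ 2 := by positivity
    set r := √(‖x‖ ^ 2 + ‖a‖ ^ 2) with hr
    set s := √(‖y‖ ^ 2 + ‖a‖ ^ 2) with hs
    have hr0 : 0 < r := Real.sqrt_pos.2 hx
    have hs0 : 0 < s := Real.sqrt_pos.2 hy
    have hr2 : r ^ 2 = ‖x‖ ^ 2 + ‖a‖ ^ 2 := Real.sq_sqrt hx.le
    have hs2 : s ^ 2 = ‖y‖ ^ 2 + ‖a‖ ^ 2 := Real.sq_sqrt hy.le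
    have has : ‖a‖ ≤ s := by nlinarith [sq_nonneg ‖y‖]
    have hys : ‖y‖ ≤ s := by nlinarith [norm_nonneg y, sq_nonneg ‖a‖]
    have htri : ‖x‖ ≤ ‖y‖ + ‖x - y‖ := by simpa using norm_add_le y (x - y)
    have hrs : r ≤ s + ‖x - y‖ := by
      have : r ^ 2 ≤ (s + ‖x - y‖) ^ 2 := by
        nlinarith [norm_nonneg x, norm_nonneg y, norm_nonneg (x - y)]
      exact le_of_sq_le_sq this (by positivity)
    rw [← hr2, ← hs2, Real.log_pow, Real.log_pow]
    have hlog : Real.log r - Real.log s ≤ r / s - 1 := by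
      rw [← Real.log_div hr0.ne' hs0.ne']
      exact Real.log_le_sub_one_of_pos (by positivity)
    have h2 : (r / s - 1) * ‖a‖ ≤ ‖x - y‖ := by
      rw [div_sub_one hs0.ne', div_mul_eq_mul_div, div_le_iff₀ hs0]
      nlinarith [norm_nonneg (x - y)]
    push_cast
    nlinarith
  rcases abs_cases (Real.log (‖x‖ ^ 2 + ‖a‖ ^ 2) - Real.log (‖y‖ ^ 2 + ‖a‖ ^ 2)) with h | h
  · rw [h.1]; exact key x y
  · rw [h.1, neg_sub, norm_sub_rev]; exact key y x

/-- A perturbation of the identity by a contraction is bijective, and its inverse is Lipschitz. -/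
theorem bijective_add_contraction {G : Type*} [NormedAddCommGroup G] [CompleteSpace G] {p : G → G}
    (hp : ∀ x y, ‖p x - p y‖ ≤ 1 / 2 * ‖x - y‖) :
    (∀ x y, ‖x - y‖ ≤ 2 * ‖(x + p x) - (y + p y)‖) ∧ Function.Bijective fun x => x + p x := by
  have h1 : ∀ x y, ‖x - y‖ ≤ 2 * ‖(x + p x) - (y + p y)‖ := by
    intro x y
    have h : x - y = ((x + p x) - (y + p y)) - (p x - p y) := by abel
    have := norm_sub_le ((x + p x) - (y + p y)) (p x - p y)
    rw [← h] at this
    linarith [hp x y]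
  refine ⟨h1, fun x y hxy => ?_, fun y => ?_⟩
  · have := h1 x y
    simp only at hxy
    rw [hxy, sub_self, norm_zero, mul_zero] at this
    exact sub_eq_zero.1 (norm_le_zero_iff.1 this)
  · have hc : ContractingWith (1 / 2) fun x => y - p x := by
      refine ⟨by rw [← NNReal.coe_lt_coe]; norm_num, LipschitzWith.of_dist_le_mul fun a b => ?_⟩
      rw [dist_eq_norm, dist_eq_norm, sub_sub_sub_cancel_left, norm_sub_rev]
      simpa using hp a b
    have h : y - p (hc.fixedPoint _) = hc.fixedPoint _ := hc.fixedPoint_isFixedPt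
    exact ⟨hc.fixedPoint _, (sub_eq_iff_eq_add.1 h).symm⟩

/-- The shear of `ℂ²` that conjugates the homotheties to Jordan blocks. -/
def shearFun (t : ℝ) (z : C2) : C2 := ![z 0 + (Real.sin t / 4 * logNormSq z : ℝ) • z 1, z 1]

/-- The coefficient `sin t / 4` is at most `1 / 4` in absolute value, and the logarithmic term is
`2`-Lipschitz by `abs_log_sub_log_mul_le`. The perturbation is thus a `1 / 2`-contraction, for all
real `t` at once, which is why `sin t` replaces `t`. -/
theorem shearFun_fiber (t : ℝ) (a : ℂ) :
    (∀ x y : ℂ, ‖x - y‖ ≤ 2 * ‖shearFun t ![x, a] 0 - shearFun t ![y, a] 0‖) ∧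
      Function.Bijective fun x => shearFun t ![x, a] 0 := by
  refine bijective_add_contraction (p := fun x => (Real.sin t / 4 * logNormSq ![x, a] : ℝ) • a) ?_
  intro x y
  rw [← sub_smul, norm_smul, Real.norm_eq_abs, ← mul_sub, abs_mul, mul_assoc]
  have h := abs_log_sub_log_mul_le a x y
  have hs : |Real.sin t / 4| ≤ 1 / 4 := by
    rw [abs_div, abs_of_pos (by norm_num : (0 : ℝ) < 4)]
    have := Real.abs_sin_le_one t
    linarith
  have e : |logNormSq ![x, a] - logNormSq ![y, a]| * ‖a‖ ≤ 2 * ‖x - y‖ := by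
    simpa [logNormSq] using h
  calc _ ≤ 1 / 4 * (2 * ‖x - y‖) := mul_le_mul hs e (by positivity) (by norm_num)
    _ = _ := by ring

theorem eq_vec (z : C2) : z = ![z 0, z 1] := by
  ext i
  fin_cases i <;> rfl

theorem shearFun_bijective (t : ℝ) : Function.Bijective (shearFun t) := by
  constructor
  · intro z w h
    have h1 : z 1 = w 1 := congrFun h 1
    have h0 := congrFun h 0
    rw [eq_vec z, eq_vec w, h1] at h0
    have := (shearFun_fiber t (w 1)).2.1 h0
    rw [eq_vec z, eq_vec w, h1, this]
  · intro w
    obtain ⟨x, hx⟩ := (shearFun_fiber t (w 1)).2.2 (w 0)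
    refine ⟨![x, w 1], ?_⟩
    ext i
    fin_cases i
    · exact hx
    · rfl

/-- The shear, as a bijection. -/
def shear (t : ℝ) : C2 ≃ C2 := Equiv.ofBijective (shearFun t) (shearFun_bijective t)

theorem shear_apply (t : ℝ) (z : C2) :
    shear t z = ![z 0 + (Real.sin t / 4 * logNormSq z : ℝ) • z 1, z 1] := rfl

theorem shear_map_zero (t : ℝ) : shear t 0 = 0 := by
  rw [shear_apply]
  ext i
  fin_cases i <;> simp

theorem shear_ne_zero {t : ℝ} {z : C2} : shear t z ≠ 0 ↔ z ≠ 0 := by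
  conv_lhs => rw [← shear_map_zero t, (shear t).injective.ne_iff]

theorem shear_symm_ne_zero {t : ℝ} {z : C2} : (shear t).symm z ≠ 0 ↔ z ≠ 0 := by
  rw [← shear_ne_zero (t := t), Equiv.apply_symm_apply]

theorem shear_zero : shear 0 = Equiv.refl C2 := by
  ext z i
  rw [shear_apply]
  fin_cases i <;> simp

/-- The linear map `(x, y) ↦ (a x + b y, d y)`. -/
def triangular (a b d : ℂ) : C2 →L[ℂ] C2 :=
  (Matrix.toLin' (!![a, b; 0, d] : Matrix _ _ ℂ)).toContinuousLinearMap

theorem triangular_apply (a b d : ℂ) (z : C2) :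
    triangular a b d z = ![a * z 0 + b * z 1, d * z 1] := by
  have : triangular a b d z = (!![a, b; 0, d] : Matrix _ _ ℂ).mulVec z := rfl
  rw [this]
  ext i
  fin_cases i <;> simp [Matrix.mulVec, dotProduct, Fin.sum_univ_two]

/-- The logarithm increases by `2 k log ‖l‖` under `l ^ k`, which turns a homothety into a
triangular matrix. The off-diagonal entry carries the factor `sin t / 4 * 2`, so it vanishes at `t =
0`. -/
theorem shear_zpow_smul {l : ℂ} (hl : l ≠ 0) (t : ℝ) (k : ℤ) (z : C2) :
    shear t (l ^ k • z) =
      triangular (l ^ k) (l ^ k * (Real.sin t / 2 * k * Real.log ‖l‖ : ℝ)) (l ^ k) (shear t z) := by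
  rcases eq_or_ne z 0 with rfl | hz
  · rw [smul_zero, shear_map_zero, map_zero]
  rw [triangular_apply, shear_apply, shear_apply, logNormSq_zpow_smul hl k hz]
  ext i
  fin_cases i
  · simp only [Pi.smul_apply, smul_eq_mul, Complex.real_smul, Fin.zero_eta, Matrix.cons_val_zero,
      Matrix.cons_val_one]
    push_cast
    ring
  · simp

theorem contDiffAt_shear {t : ℝ} {z : C2} (hz : z ≠ 0) :
    ContDiffAt ℝ ∞ (fun p : ℝ × C2 => shear p.1 p.2) (t, z) := by
  have hi : ∀ i, ContDiffAt ℝ ∞ (fun p : ℝ × C2 => p.2 i) (t, z) := fun i =>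
    ((contDiff_apply ℝ ℂ i).comp contDiff_snd).contDiffAt
  have hN : ContDiffAt ℝ ∞ (fun p : ℝ × C2 => logNormSq p.2) (t, z) :=
    ContDiffAt.comp (g := logNormSq) (t, z) (contDiffAt_logNormSq hz) contDiffAt_snd
  have hs : ContDiffAt ℝ ∞ (fun p : ℝ × C2 => Real.sin p.1 / 4) (t, z) :=
    (Real.contDiff_sin.comp contDiff_fst).contDiffAt.div_const 4
  rw [contDiffAt_pi]
  intro i
  fin_cases i
  · exact (hi 0).add ((hs.mul hN).smul (hi 1))
  · exact hi 1

/-- The difference quotients along `v` have norm at least `c`, so their limit is not `0`. -/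
theorem fderiv_apply_ne_zero_of_antilipschitz {F G : Type*} [NormedAddCommGroup F]
    [NormedSpace ℝ F] [NormedAddCommGroup G] [NormedSpace ℝ G] {f : F → G} {x v : F}
    (hf : DifferentiableAt ℝ f x) {c : ℝ} (hc : 0 < c)
    (h : ∀ τ : ℝ, c * |τ| ≤ ‖f (x + τ • v) - f x‖) : fderiv ℝ f x v ≠ 0 := by
  intro h0
  have hd : HasDerivAt (fun τ : ℝ => f (x + τ • v)) 0 0 := by
    have h1 : HasDerivAt (fun τ : ℝ => x + τ • v) v 0 := by
      simpa using ((hasDerivAt_id (0 : ℝ)).smul_const v).const_add x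
    have h2 : HasFDerivAt f (fderiv ℝ f x) (x + (0 : ℝ) • v) := by simpa using hf.hasFDerivAt
    have := h2.comp_hasDerivAt 0 h1
    rwa [h0] at this
  have ht := hd.tendsto_slope_zero.norm
  rw [norm_zero] at ht
  have : c ≤ 0 := by
    refine ge_of_tendsto ht ?_
    filter_upwards [self_mem_nhdsWithin] with τ hτ
    have hτ' : 0 < |τ| := abs_pos.2 hτ
    have := h τ
    simp only [zero_add, zero_smul, add_zero]
    rw [norm_smul, norm_inv, Real.norm_eq_abs, ← div_eq_inv_mul, le_div_iff₀ hτ']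
    exact this
  exact absurd this (not_le.2 hc)

/-- The inverse function theorem for `(t, z) ↦ (t, S_t z)` gives smoothness of the inverse jointly
with the parameter. Its differential preserves `t` and the second coordinate, so a kernel vector
points along the first coordinate, where the inverse Lipschitz bound excludes it. -/
theorem contDiffAt_shear_symm {t : ℝ} {w : C2} (hw : w ≠ 0) :
    ContDiffAt ℝ ∞ (fun p : ℝ × C2 => (shear p.1).symm p.2) (t, w) := by
  obtain ⟨z, rfl⟩ := (shear t).surjective w
  have hz : z ≠ 0 := shear_ne_zero.1 hw
  let Θ : ℝ × C2 → ℝ × C2 := fun p => (p.1, shear p.1 p.2)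
  have hΘ : ContDiffAt ℝ ∞ Θ (t, z) := contDiffAt_fst.prodMk (contDiffAt_shear hz)
  have hΘi : Function.Injective Θ := by
    rintro ⟨a, x⟩ ⟨b, y⟩ h
    obtain rfl : a = b := congrArg Prod.fst h
    exact congrArg _ ((shear a).injective (congrArg Prod.snd h))
  have hd : DifferentiableAt ℝ Θ (t, z) := hΘ.differentiableAt (by simp)
  have h1 : ∀ v, (fderiv ℝ Θ (t, z) v).1 = v.1 := by
    intro v
    have := (hd.hasFDerivAt.fst).unique (hasFDerivAt_fst (p := (t, z)))
    exact congrArg (fun L => L v) this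
  have h2 : ∀ v, (fderiv ℝ Θ (t, z) v).2 1 = v.2 1 := by
    intro v
    have e1 := (hasFDerivAt_apply (𝕜 := ℝ) (1 : Fin 2) (Θ (t, z)).2).comp (t, z)
      hd.hasFDerivAt.snd
    have e2 := (hasFDerivAt_apply (𝕜 := ℝ) (1 : Fin 2) z).comp (t, z)
      (hasFDerivAt_snd (𝕜 := ℝ) (p := (t, z)))
    exact congrArg (fun L => L v) (e1.unique e2)
  have hinj : Function.Injective (fderiv ℝ Θ (t, z)) := by
    rw [injective_iff_map_eq_zero]
    rintro ⟨τ, v⟩ hv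
    obtain rfl : τ = 0 := (h1 (τ, v)).symm.trans (congrArg Prod.fst hv)
    have hv1 : v 1 = 0 := (h2 (0, v)).symm.trans (by rw [hv]; rfl)
    by_contra hne
    have hv0 : v 0 ≠ 0 := by
      intro h
      apply hne
      rw [eq_vec v, h, hv1]
      ext i
      · rfl
      · fin_cases i <;> rfl
    -- `shearFun_fiber` gives `|τ| ‖v 0‖ ≤ 2 ‖…‖`, hence the constant `‖v 0‖ / 2`.
    refine fderiv_apply_ne_zero_of_antilipschitz hd (v := (0, v)) (c := ‖v 0‖ / 2)
      (by positivity) ?_ hv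
    intro τ
    have hb := (shearFun_fiber t (z 1)).1 (z 0 + τ • v 0) (z 0)
    have e1 : z + τ • v = ![z 0 + τ • v 0, z 1] := by
      rw [eq_vec (z + τ • v)]
      simp [hv1]
    have e2 : Θ ((t, z) + τ • (0, v)) - Θ (t, z) =
        (0, shearFun t ![z 0 + τ • v 0, z 1] - shearFun t ![z 0, z 1]) := by
      rw [← e1, ← eq_vec z]
      simp only [Θ, Prod.smul_mk, smul_zero, Prod.mk_add_mk, add_zero, Prod.mk_sub_mk, sub_self]
      rfl
    rw [e2]
    have e3 : ‖shearFun t ![z 0 + τ • v 0, z 1] 0 - shearFun t ![z 0, z 1] 0‖ ≤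
        ‖((0 : ℝ), shearFun t ![z 0 + τ • v 0, z 1] - shearFun t ![z 0, z 1])‖ :=
      (norm_le_pi_norm (shearFun t ![z 0 + τ • v 0, z 1] - shearFun t ![z 0, z 1]) 0).trans
        (le_max_right _ _)
    rw [add_sub_cancel_left, norm_smul, Real.norm_eq_abs] at hb
    linarith
  let e : (ℝ × C2) ≃L[ℝ] (ℝ × C2) :=
    (LinearEquiv.ofInjectiveEndo (fderiv ℝ Θ (t, z) : ℝ × C2 →ₗ[ℝ] ℝ × C2)
      hinj).toContinuousLinearEquiv
  have he : HasFDerivAt Θ (e : ℝ × C2 →L[ℝ] ℝ × C2) (t, z) := by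
    have : (e : ℝ × C2 →L[ℝ] ℝ × C2) = fderiv ℝ Θ (t, z) := by ext v <;> rfl
    rw [this]
    exact hd.hasFDerivAt
  have hloc := hΘ.to_localInverse he (by simp)
  have hst := hΘ.hasStrictFDerivAt' he (by simp)
  refine (contDiffAt_snd.comp _ hloc).congr_of_eventuallyEq ?_
  filter_upwards [hst.eventually_right_inverse] with y hy
  have : (y.1, (shear y.1).symm y.2) = hst.localInverse Θ e (t, z) y := by
    apply hΘi
    rw [hy]
    simp [Θ]
  exact congrArg Prod.snd this

theorem contDiffAt_shear_right {t : ℝ} {z : C2} (hz : z ≠ 0) : ContDiffAt ℝ ∞ (shear t) z :=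
  ContDiffAt.comp (g := fun p : ℝ × C2 => shear p.1 p.2) (f := fun z : C2 => (t, z)) z
    (contDiffAt_shear hz)
    (contDiffAt_const.prodMk contDiffAt_id)

theorem contDiffAt_shear_symm_right {t : ℝ} {z : C2} (hz : z ≠ 0) :
    ContDiffAt ℝ ∞ (shear t).symm z :=
  ContDiffAt.comp (g := fun p : ℝ × C2 => (shear p.1).symm p.2) (f := fun z : C2 => (t, z)) z
    (contDiffAt_shear_symm hz)
    (contDiffAt_const.prodMk contDiffAt_id)

theorem isLocalDiffeomorphAt_of_equiv {e : C2 ≃ C2} (h0 : e 0 = 0)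
    (he : ∀ z ≠ 0, ContDiffAt ℝ ∞ e z) (he' : ∀ z ≠ 0, ContDiffAt ℝ ∞ e.symm z) {z : C2}
    (hz : z ≠ 0) : IsLocalDiffeomorphAt 𝓘(ℝ, C2) 𝓘(ℝ, C2) ∞ e z := by
  have h0' : e.symm 0 = 0 := by rw [Equiv.symm_apply_eq, h0]
  refine ⟨{ toFun := e
            invFun := e.symm
            source := {0}ᶜ
            target := {0}ᶜ
            map_source' := fun w hw h => hw (e.injective (h.trans h0.symm))
            map_target' := fun w hw h => hw (e.symm.injective (h.trans h0'.symm))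
            left_inv' := fun w _ => e.symm_apply_apply w
            right_inv' := fun w _ => e.apply_symm_apply w
            open_source := isOpen_compl_singleton
            open_target := isOpen_compl_singleton
            contMDiffOn_toFun := fun w hw => (he w hw).contMDiffAt.contMDiffWithinAt
            contMDiffOn_invFun := fun w hw => (he' w hw).contMDiffAt.contMDiffWithinAt },
    hz, fun w _ => rfl⟩

theorem fderiv_shear_symm_comp {t : ℝ} {z : C2} (hz : z ≠ 0) (v : C2) :
    fderiv ℝ (shear t) z (fderiv ℝ (shear t).symm (shear t z) v) = v := by
  have h1 : HasFDerivAt (shear t) (fderiv ℝ (shear t) z) ((shear t).symm (shear t z)) := by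
    rw [Equiv.symm_apply_apply]
    exact ((contDiffAt_shear_right hz).differentiableAt (by simp)).hasFDerivAt
  have h2 := ((contDiffAt_shear_symm_right (t := t) (shear_ne_zero (t := t).2 hz)).differentiableAt
    (by simp)).hasFDerivAt
  have h3 := h1.comp _ h2
  have h4 : (shear t ∘ (shear t).symm) = id := by ext1 w; simp
  rw [h4] at h3
  exact congrArg (fun L => L v) (h3.unique (hasFDerivAt_id _))

/-- The determinant is continuous in `t`, never zero, and equal to `1` at `t = 0` where the shear is
the identity. This keeps the deformed structures in the same orientation. -/
theorem det_fderiv_shear_pos {t : ℝ} {z : C2} (hz : z ≠ 0) :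
    0 < (fderiv ℝ (shear t) z).det := by
  have hc : Continuous fun t => (fderiv ℝ (shear t) z).det := by
    refine ContinuousLinearMap.continuous_det.comp ?_
    rw [continuous_iff_continuousAt]
    intro t
    exact (ContDiffAt.fderiv (f := fun t => (shear t : C2 → C2)) (g := fun _ => z) (m := 0)
      (contDiffAt_shear hz) contDiffAt_const (by simp)).continuousAt
  have hne : ∀ t, (fderiv ℝ (shear t) z).det ≠ 0 := by
    intro t h
    have := (fderiv ℝ (shear t) z).toLinearMap.bot_lt_ker_of_det_eq_zero h
    have hs : Function.Surjective (fderiv ℝ (shear t) z : C2 →ₗ[ℝ] C2) :=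
      fun v => ⟨_, fderiv_shear_symm_comp hz v⟩
    rw [LinearMap.ker_eq_bot.2 (LinearMap.injective_iff_surjective.2 hs)] at this
    exact lt_irrefl _ this
  have h0 : (fderiv ℝ (shear 0) z).det = 1 := by
    rw [shear_zero]
    have : fderiv ℝ (Equiv.refl C2) z = ContinuousLinearMap.id ℝ C2 := fderiv_id
    rw [this]
    simp [ContinuousLinearMap.det]
  by_contra! h
  obtain ⟨s, -, hs⟩ := (isPreconnected_univ (α := ℝ)).intermediate_value (Set.mem_univ t)
    (Set.mem_univ 0) hc.continuousOn ⟨h, by rw [h0]; exact zero_le_one⟩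
  exact hne s hs

/-- The multiplication by `i`, transported by the shear. -/
def shearOp (t : ℝ) (z : C2) : C2 →L[ℝ] C2 :=
  (fderiv ℝ (shear t).symm (shear t z)).comp (mulI.comp (fderiv ℝ (shear t) z))

theorem shearOp_zero (z : C2) : shearOp 0 z = mulI := by
  unfold shearOp
  rw [shear_zero]
  have h : fderiv ℝ (Equiv.refl C2) z = ContinuousLinearMap.id ℝ C2 := fderiv_id
  have h' : fderiv ℝ (Equiv.refl C2).symm z = ContinuousLinearMap.id ℝ C2 := fderiv_id
  rw [Equiv.refl_apply, h, h']
  rfl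

theorem contDiffAt_shearOp {t : ℝ} {z : C2} (hz : z ≠ 0) :
    ContDiffAt ℝ ∞ (fun p : ℝ × C2 => shearOp p.1 p.2) (t, z) := by
  have h1 : ContDiffAt ℝ ∞ (fun p : ℝ × C2 => fderiv ℝ (shear p.1) p.2) (t, z) :=
    ContDiffAt.fderiv (f := fun p : ℝ × C2 => (shear p.1 : C2 → C2)) (n := ∞)
      (ContDiffAt.comp (g := fun p : ℝ × C2 => shear p.1 p.2)
        (f := fun q : (ℝ × C2) × C2 => (q.1.1, q.2)) ((t, z), z) (contDiffAt_shear hz)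
        (contDiff_fst.fst.prodMk contDiff_snd).contDiffAt) contDiffAt_snd (by simp)
  have h2 : ContDiffAt ℝ ∞ (fun p : ℝ × C2 => fderiv ℝ (shear p.1).symm (shear p.1 p.2)) (t, z) :=
    ContDiffAt.fderiv (f := fun p : ℝ × C2 => ((shear p.1).symm : C2 → C2))
      (g := fun p : ℝ × C2 => shear p.1 p.2) (n := ∞)
      (ContDiffAt.comp (g := fun p : ℝ × C2 => (shear p.1).symm p.2)
        (f := fun q : (ℝ × C2) × C2 => (q.1.1, q.2)) ((t, z), shear t z)
        (contDiffAt_shear_symm (shear_ne_zero.2 hz))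
        (contDiff_fst.fst.prodMk contDiff_snd).contDiffAt) (contDiffAt_shear hz) (by simp)
  exact h2.clm_comp (contDiffAt_const.clm_comp h1)

/-! ### The sheared family of complex structures -/

section Deformation

variable {E : Type*} [NormedAddCommGroup E] [NormedSpace ℝ E] {H : Type*} [TopologicalSpace H]
  {I : ModelWithCorners ℝ E H} {M : Type*} [TopologicalSpace M] [ChartedSpace H M]

theorem op_congr (op : ∀ x : M, TangentSpace I x →L[ℝ] TangentSpace I x) {x y : M} (h : x = y)
    {a : TangentSpace I x} {b : TangentSpace I y} (hab : (a : E) = (b : E)) :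
    (op x a : E) = (op y b : E) := by
  subst h
  exact congrArg (op x) hab

theorem IsParam.tder_eq_comp {P R : C2 → M} (hP : IsParam I P) {ψ : C2 → C2}
    (h0 : ∀ z ≠ 0, ψ z ≠ 0) (hψ : ∀ z ≠ 0, DifferentiableAt ℝ ψ z)
    (hR : ∀ z ≠ 0, R z = P (ψ z)) {z : C2} (hz : z ≠ 0) (v : C2) :
    (tder I R z v : E) = (tder I P (ψ z) (fderiv ℝ ψ z v) : E) := by
  have h : R =ᶠ[𝓝 z] fun z => P (ψ z) := by
    filter_upwards [isOpen_compl_singleton.mem_nhds hz] with w hw using hR w hw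
  refine (h.tder_eq v).trans ?_
  rw [tder_comp (hP.mdifferentiableAt (h0 z hz)) (hψ z hz)]
  rfl

theorem ReadsAs.comp {P R : C2 → M} {op : ∀ x : M, TangentSpace I x →L[ℝ] TangentSpace I x}
    {j j' : C2 → C2 →L[ℝ] C2} (h : ReadsAs P op j) (hP : IsParam I P) {ψ : C2 → C2}
    (h0 : ∀ z ≠ 0, ψ z ≠ 0) (hψ : ∀ z ≠ 0, DifferentiableAt ℝ ψ z)
    (hR : ∀ z ≠ 0, R z = P (ψ z))
    (hj : ∀ z ≠ 0, ∀ v, fderiv ℝ ψ z (j' z v) = j (ψ z) (fderiv ℝ ψ z v)) : ReadsAs R op j' := by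
  intro z hz v
  have key := hP.tder_eq_comp h0 hψ hR hz
  refine (op_congr op (hR z hz) (key v)).trans ?_
  refine (h _ (h0 z hz) _).trans ?_
  rw [← hj z hz]
  exact (key _).symm

theorem IsParam.comp_equiv {P : C2 → M} (hP : IsParam I P) {e : C2 ≃ C2} (h0 : e 0 = 0)
    (he : ∀ z ≠ 0, ContDiffAt ℝ ∞ e z) (he' : ∀ z ≠ 0, ContDiffAt ℝ ∞ e.symm z) :
    IsParam I fun z => P (e z) := by
  have hne : ∀ z ≠ 0, e z ≠ 0 := fun z hz h => hz (e.injective (h.trans h0.symm))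
  refine ⟨fun z hz => ?_, fun x => ?_⟩
  · exact IsLocalDiffeomorphAt.comp I M (isLocalDiffeomorphAt_of_equiv h0 he he' hz)
      (hP.isLocalDiffeomorphAt _ (hne z hz))
  · obtain ⟨z, hz, rfl⟩ := hP.exists_eq x
    refine ⟨e.symm z, fun h => hz ?_, by simp⟩
    rw [← e.apply_symm_apply z, h, h0]

theorem IsParam.shear {P : C2 → M} (hP : IsParam I P) (t : ℝ) :
    IsParam I fun z => P ((shear t).symm z) :=
  hP.comp_equiv (e := (_root_.shear t).symm) (by rw [Equiv.symm_apply_eq, shear_map_zero])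
    (fun _ hz => contDiffAt_shear_symm_right hz) (fun _ hz => contDiffAt_shear_right hz)

/-- The fibres of the parametrization are the orbits of the homothety of ratio `l`. -/
structure IsScalarCover (l : ℂ) (P : C2 → M) : Prop where
  invariant : ∀ k : ℤ, ∀ z ≠ 0, P (l ^ k • z) = P z
  exists_zpow : ∀ z ≠ 0, ∀ w ≠ 0, P z = P w → ∃ k : ℤ, w = l ^ k • z

variable [IsManifold I ∞ M] {n : ℕ} {o : ManifoldOrientation (Fin n × Fin 2) I M}
  {J₀ : ComplexStructure o} {l : ℂ} {P : C2 → M}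

theorem contDiffAt_shearOp_right {t : ℝ} {z : C2} (hz : z ≠ 0) : ContDiffAt ℝ ∞ (shearOp t) z :=
  ContDiffAt.comp (g := fun p : ℝ × C2 => shearOp p.1 p.2) (f := fun z : C2 => (t, z)) z
    (contDiffAt_shearOp hz) (contDiffAt_const.prodMk contDiffAt_id)

theorem ComplexStructure.ext_op {J J' : ComplexStructure o} (h : J.op = J'.op) : J = J' := by
  cases J
  cases J'
  cases h
  rfl

/-- The fibres of `P ∘ S_t⁻¹` are related by powers of a complex linear map, so `i` descends. The
result is integrable since it is `i` in this parametrization; read in the fixed parametrization `P`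
it is `shearOp t`, smooth in `(t, z)`, whence continuity in `t`. -/
theorem exists_shear_deformation [CompleteSpace E] [I.Boundaryless] (hl : l ≠ 0)
    (hP : IsParam I P) (hc : IsScalarCover l P) (hJ : ReadsAs P J₀.op fun _ => mulI) :
    ∃ J : ℝ → ComplexStructure o, Continuous J ∧ J 0 = J₀ ∧
      ∀ t, ReadsAs (fun z => P ((shear t).symm z)) (J t).op fun _ => mulI := by
  have hop : ∀ t : ℝ, ∃ op : ∀ x : M, TangentSpace I x →L[ℝ] TangentSpace I x,
      ReadsAs (fun z => P ((shear t).symm z)) op fun _ => mulI := by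
    intro t
    refine (hP.shear t).exists_readsAs_mulI fun z hz w hw h => ?_
    obtain ⟨k, hk⟩ := hc.exists_zpow _ (shear_symm_ne_zero.2 hz) _ (shear_symm_ne_zero.2 hw) h
    have key : ∀ y : C2, shear t (l ^ k • (shear t).symm y) = triangular (l ^ k)
        (l ^ k * (Real.sin t / 2 * k * Real.log ‖l‖ : ℝ)) (l ^ k) y := by
      intro y
      rw [shear_zpow_smul hl, Equiv.apply_symm_apply]
    refine ⟨triangular (l ^ k) (l ^ k * (Real.sin t / 2 * k * Real.log ‖l‖ : ℝ)) (l ^ k), ?_,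
      fun y hy => ?_⟩
    · rw [← key, ← hk, Equiv.apply_symm_apply]
    · rw [← key, Equiv.symm_apply_apply]
      exact hc.invariant k _ (shear_symm_ne_zero.2 hy)
  choose op hop using hop
  have hops : ∀ t, ReadsAs P (op t) (shearOp t) := fun t =>
    (hop t).comp (hP.shear t) (ψ := shear t) (fun z hz => shear_ne_zero.2 hz)
      (fun z hz => (contDiffAt_shear_right hz).differentiableAt (by simp))
      (fun z _ => by simp) fun z hz v => fderiv_shear_symm_comp hz _
  have hex : ∀ t, ∃ J : ComplexStructure o, J.op = op t := by
    intro t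
    refine exists_complexStructure hP (hP.shear t) (j := shearOp t)
      (fun z hz => contDiffAt_shearOp_right hz) (hops t) (hop t) fun x b hb => ?_
    · obtain ⟨z, hz, rfl⟩ := hP.exists_eq x
      obtain ⟨e, he⟩ := (hP.isLocalDiffeomorphAt z hz).exists_tder_equiv
      let D : C2 ≃ₗ[ℝ] C2 := LinearEquiv.ofBijective (fderiv ℝ (shear t) z : C2 →ₗ[ℝ] C2) (by
        have hs : Function.Surjective (fderiv ℝ (shear t) z : C2 →ₗ[ℝ] C2) :=
          fun v => ⟨_, fderiv_shear_symm_comp hz v⟩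
        exact ⟨LinearMap.injective_iff_surjective.2 hs, hs⟩)
      have hDv : ∀ v, D v = fderiv ℝ (shear t) z v := fun v => rfl
      -- The differential of the shear, transported to the tangent space. It conjugates the new
      -- operator to that of `J₀` and has positive determinant, so a basis adapted to the new
      -- operator has the orientation of one adapted to `J₀`.
      let B : TangentSpace I (P z) ≃ₗ[ℝ] TangentSpace I (P z) :=
        (e.toLinearEquiv.symm.trans D).trans e.toLinearEquiv
      have hB : ∀ v, B (e v) = e (D v) := fun v => by simp [B]
      have hJe : ∀ v, J₀.op (P z) (e v) = e (mulI v) := by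
        have := hJ z hz
        rw [← he] at this
        exact this
      have hte : ∀ v, op t (P z) (e v) = e (shearOp t z v) := by
        have := hops t z hz
        rw [← he] at this
        exact this
      have hcomm : ∀ u, J₀.op (P z) (B u) = B (op t (P z) u) := by
        intro u
        obtain ⟨v, rfl⟩ := e.surjective u
        rw [hB, hJe, hte, hB, hDv, hDv]
        congr 1
        exact (fderiv_shear_symm_comp hz _).symm
      have h1 := J₀.oriented (P z) (b.map B) fun i => by
        rw [Module.Basis.map_apply, Module.Basis.map_apply, hcomm, hb]
      rw [Module.Basis.orientation_map] at h1
      have hdet : 0 < LinearMap.det (B : TangentSpace I (P z) →ₗ[ℝ] TangentSpace I (P z)) := by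
        have : (B : TangentSpace I (P z) →ₗ[ℝ] TangentSpace I (P z)) =
            e.toLinearEquiv.conj (D : C2 →ₗ[ℝ] C2) := by
          ext u
          rfl
        rw [this, LinearEquiv.conj_apply, LinearMap.comp_assoc, LinearMap.det_conj]
        exact det_fderiv_shear_pos (t := t) hz
      have := Module.Finite.of_basis b
      rw [← h1, eq_comm]
      exact (Orientation.map_eq_iff_det_pos _ B (Module.finrank_eq_card_basis b).symm).2 hdet
  choose J hJop using hex
  refine ⟨J, ?_, ?_, fun t => by rw [hJop]; exact hop t⟩
  · exact ComplexStructure.continuous_of_readsAs hP (fun t z hz => contDiffAt_shearOp hz)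
      fun t => by rw [hJop]; exact hops t
  · refine ComplexStructure.ext_op ?_
    rw [hJop]
    refine hP.op_ext (hops 0) ?_
    have : shearOp 0 = fun _ => mulI := funext shearOp_zero
    rw [this]
    exact hJ

end Deformation

/-! ### Invariance of the biholomorphism type under diffeomorphisms -/

section Invariance

variable {E : Type*} [NormedAddCommGroup E] [NormedSpace ℝ E] {H : Type*} [TopologicalSpace H]
  {I : ModelWithCorners ℝ E H} {M : Type*} [TopologicalSpace M] [ChartedSpace H M]
  [IsManifold I ∞ M] {n : ℕ} {o : ManifoldOrientation (Fin n × Fin 2) I M}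
  {J J' : ComplexStructure o} {g : C2 → C2}

theorem TeichmullerRel.isBiholomorphicToHopf_iff (h : TeichmullerRel J J') :
    IsBiholomorphicToHopf J g ↔ IsBiholomorphicToHopf J' g := by
  obtain ⟨f, -, hf⟩ := h
  constructor
  · intro hJ
    obtain ⟨φ, P, hP, hφ, hPJ⟩ := hJ.exists_param
    have hloc : ∀ z ≠ 0, IsLocalDiffeomorphAt 𝓘(ℝ, C2) I ∞ (fun z => f.symm (P z)) z :=
      fun z hz => IsLocalDiffeomorphAt.comp I M (hP.isLocalDiffeomorphAt z hz)
        (f.symm.isLocalDiffeomorph (P z))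
    refine isBiholomorphicToHopf_of_param (φ.trans f.symm.toEquiv) (P := fun z => f.symm (P z))
      hloc (fun z => congrArg f.symm (hφ z)) fun z hz v => ?_
    apply (f.mfderivToContinuousLinearEquiv (by simp) (f.symm (P z))).injective
    have key : ∀ v, (mfderiv I I f (f.symm (P z)) (tder I (fun z => f.symm (P z)) z v) : E) =
        (tder I P z v : E) := by
      intro v
      refine (tder_mcomp ((hloc z hz).contMDiffAt.mdifferentiableAt (by simp))
        (f.contMDiff.mdifferentiable (by simp) _) v).symm.trans ?_
      refine Filter.EventuallyEq.tder_eq (Filter.Eventually.of_forall fun w => ?_) v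
      simp
    refine (hf _ _).trans ?_
    refine (op_congr J.op (f.apply_symm_apply (P z)) (key v)).trans ?_
    exact (hPJ z hz v).trans (key _).symm
  · intro hJ
    obtain ⟨φ, P, hP, hφ, hPJ⟩ := hJ.exists_param
    have hloc : ∀ z ≠ 0, IsLocalDiffeomorphAt 𝓘(ℝ, C2) I ∞ (fun z => f (P z)) z :=
      fun z hz => IsLocalDiffeomorphAt.comp I M (hP.isLocalDiffeomorphAt z hz)
        (f.isLocalDiffeomorph (P z))
    refine isBiholomorphicToHopf_of_param (φ.trans f.toEquiv) (P := fun z => f (P z))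
      hloc (fun z => congrArg f (hφ z)) fun z hz v => ?_
    have key : ∀ v, tder I (fun z => f (P z)) z v = mfderiv I I f (P z) (tder I P z v) :=
      fun v => tder_mcomp (hP.mdifferentiableAt hz) (f.contMDiff.mdifferentiable (by simp) _) v
    rw [key, key, ← hf, hPJ z hz]

theorem isBiholomorphicToHopf_iff_of_mk_eq (h : TeichmullerSpace.mk J = TeichmullerSpace.mk J') :
    IsBiholomorphicToHopf J g ↔ IsBiholomorphicToHopf J' g :=
  iff_of_eq (congrArg (Quot.lift (fun J : ComplexStructure o => IsBiholomorphicToHopf J g)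
    fun _ _ h => propext h.isBiholomorphicToHopf_iff) h)

theorem IsBiholomorphicToHopf.exists_scalarCover {l : ℂ} (hl : l ≠ 0)
    (h : IsBiholomorphicToHopf J (!![l, 0; 0, l] : Matrix _ _ ℂ).mulVec) :
    ∃ (φ : HopfSurface (!![l, 0; 0, l] : Matrix _ _ ℂ).mulVec ≃ M) (P : C2 → M), IsParam I P ∧
      (∀ z : PuncturedPlane, φ (Quot.mk _ z) = P z) ∧ (ReadsAs P J.op fun _ => mulI) ∧
      IsScalarCover l P := by
  obtain ⟨φ, P, hP, hφ, hPJ⟩ := h.exists_param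
  refine ⟨φ, P, hP, hφ, hPJ, fun k => invariant_zpow_smul hl (fun z hz => ?_) k,
    fun z hz w hw h => ?_⟩
  · rw [← hφ ⟨l • z, smul_ne_zero hl hz⟩, ← hφ ⟨z, hz⟩]
    exact congrArg φ (HopfSurface.mk_eq (mulVec_scalar l z).symm).symm
  · rw [← hφ ⟨z, hz⟩, ← hφ ⟨w, hw⟩] at h
    exact exists_zpow_smul_of_mk_eq hl (φ.injective h)

end Invariance

/-! ### Descent of equivariant isotopies to the quotient -/

section Descent

variable {E : Type*} [NormedAddCommGroup E] [NormedSpace ℝ E] {H : Type*} [TopologicalSpace H]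
  {I : ModelWithCorners ℝ E H} {M : Type*} [TopologicalSpace M] [ChartedSpace H M]
  {l : ℂ} {P : C2 → M}

/-- A smooth family of maps of `ℂ² ∖ {0}` that commute with the homothety descends to `M`. -/
theorem IsParam.exists_descent (hP : IsParam I P) (hc : IsScalarCover l P) {G : ℝ → C2 → C2}
    (hG : ∀ s, ∀ z ≠ 0, ContDiffAt ℝ ∞ (fun p : ℝ × C2 => G p.1 p.2) (s, z))
    (hG0 : ∀ s, ∀ z ≠ 0, G s z ≠ 0) (hGl : ∀ s (k : ℤ) z, G s (l ^ k • z) = l ^ k • G s z) :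
    ∃ f : ℝ → M → M, ContMDiff (𝓘(ℝ, ℝ).prod I) I ∞ (fun p : ℝ × M => f p.1 p.2) ∧
      ∀ s, ∀ z ≠ 0, f s (P z) = P (G s z) := by
  -- An arbitrary section, not continuous. Equivariance makes `P ∘ G s ∘ sec` independent of it, so
  -- near any point a smooth local inverse of `P` can replace `sec`.
  choose sec hsec0 hsec using hP.exists_eq
  have hf : ∀ s, ∀ z ≠ 0, P (G s (sec (P z))) = P (G s z) := by
    intro s z hz
    obtain ⟨k, hk⟩ := hc.exists_zpow z hz _ (hsec0 (P z)) (hsec (P z)).symm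
    rw [hk, hGl, hc.invariant k _ (hG0 s z hz)]
  refine ⟨fun s x => P (G s (sec x)), ?_, hf⟩
  rintro ⟨s, x⟩
  obtain ⟨z, hz, rfl⟩ := hP.exists_eq x
  have hl := hP.isLocalDiffeomorphAt z hz
  have hq : ContMDiffAt I 𝓘(ℝ, C2) ∞ hl.localInverse (P z) := hl.localInverse_contMDiffAt
  have hqz : hl.localInverse (P z) = z := hl.localInverse_left_inv hl.localInverse_mem_target
  have hpair : ContMDiffAt (𝓘(ℝ, ℝ).prod I) 𝓘(ℝ, ℝ × C2) ∞
      (fun p : ℝ × M => (p.1, hl.localInverse p.2)) (s, P z) :=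
    contMDiffAt_fst.prodMk_space (hq.comp (s, P z) contMDiffAt_snd)
  have hGm : ContMDiffAt 𝓘(ℝ, ℝ × C2) 𝓘(ℝ, C2) ∞ (fun p : ℝ × C2 => G p.1 p.2)
      (s, hl.localInverse (P z)) := by
    rw [hqz]
    exact (hG s z hz).contMDiffAt
  have hPG : ContMDiffAt 𝓘(ℝ, C2) I ∞ P (G s (hl.localInverse (P z))) := by
    rw [hqz]
    exact (hP.isLocalDiffeomorphAt _ (hG0 s z hz)).contMDiffAt
  have hcomp := ContMDiffAt.comp (s, P z) (g := P)
    (f := fun p : ℝ × M => G p.1 (hl.localInverse p.2)) hPG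
    (ContMDiffAt.comp (s, P z) (g := fun p : ℝ × C2 => G p.1 p.2) hGm hpair)
  refine hcomp.congr_of_eventuallyEq ?_
  have h1 : ∀ᶠ y in 𝓝 (P z), P (hl.localInverse y) = y := hl.localInverse_eventuallyEq_right
  have h2 : ∀ᶠ y in 𝓝 (P z), hl.localInverse y ≠ 0 :=
    hq.continuousAt.eventually (isOpen_compl_singleton.mem_nhds (by rw [hqz]; exact hz))
  have ht : Filter.Tendsto (Prod.snd : ℝ × M → M) (𝓝 (s, P z)) (𝓝 (P z)) :=
    continuous_snd.continuousAt
  filter_upwards [ht.eventually (h1.and h2)] with p hp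
  have := hf p.1 _ hp.2
  rw [hp.1] at this
  exact this

/-- A smooth family of bijections of `ℂ² ∖ {0}` that commute with the homothety descends to an
isotopy of `M`. -/
theorem IsParam.exists_isotopy (hP : IsParam I P) (hc : IsScalarCover l P)
    {G : ℝ → C2 ≃ C2}
    (hG : ∀ s, ∀ z ≠ 0, ContDiffAt ℝ ∞ (fun p : ℝ × C2 => G p.1 p.2) (s, z))
    (hG' : ∀ s, ∀ z ≠ 0, ContDiffAt ℝ ∞ (G s).symm z)
    (hG0 : ∀ s, G s 0 = 0) (hGl : ∀ s (k : ℤ) z, G s (l ^ k • z) = l ^ k • G s z)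
    (hGid : ∀ z, G 0 z = z) :
    ∃ f : M ≃ₘ^∞⟮I, I⟯ M, IsIsotopicToId f ∧ ∀ z ≠ 0, f (P z) = P (G 1 z) := by
  have hne : ∀ s, ∀ z ≠ 0, G s z ≠ 0 := fun s z hz h =>
    hz ((G s).injective (h.trans (hG0 s).symm))
  have hne' : ∀ s, ∀ z ≠ 0, (G s).symm z ≠ 0 := fun s z hz h =>
    hz (by rw [← (G s).apply_symm_apply z, h, hG0])
  obtain ⟨f, hf, hfP⟩ := hP.exists_descent hc (G := fun s => G s) hG hne hGl
  have hinv : ∀ s, ∃ f' : M → M, ContMDiff I I ∞ f' ∧ ∀ z ≠ 0, f' (P z) = P ((G s).symm z) := by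
    intro s
    obtain ⟨f', hf', hfP'⟩ := hP.exists_descent hc (G := fun _ => (G s).symm)
      (fun _ z hz => ContDiffAt.comp (g := (G s).symm) _ (hG' s z hz) contDiffAt_snd)
      (fun _ => hne' s) (fun _ k z => by
        rw [Equiv.symm_apply_eq, hGl, Equiv.apply_symm_apply])
    exact ⟨f' 0, hf'.comp (contMDiff_const.prodMk contMDiff_id), hfP' 0⟩
  choose f' hf' hfP' using hinv
  let F : ℝ → (M ≃ₘ^∞⟮I, I⟯ M) := fun s =>
    { toFun := f s
      invFun := f' s
      left_inv := fun x => by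
        obtain ⟨z, hz, rfl⟩ := hP.exists_eq x
        rw [hfP s z hz, hfP' s _ (hne s z hz), Equiv.symm_apply_apply]
      right_inv := fun x => by
        obtain ⟨z, hz, rfl⟩ := hP.exists_eq x
        rw [hfP' s z hz, hfP s _ (hne' s z hz), Equiv.apply_symm_apply]
      contMDiff_toFun := hf.comp (contMDiff_const.prodMk contMDiff_id)
      contMDiff_invFun := hf' s }
  refine ⟨F 1, ⟨F, hf, ?_, rfl⟩, hfP 1⟩
  ext x
  obtain ⟨z, hz, rfl⟩ := hP.exists_eq x
  exact (hfP 0 z hz).trans (by rw [hGid]; rfl)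

end Descent

/-! ### The deformed structures are equivalent for positive parameters -/

/-- The bijection `(x, y) ↦ (a x, y)`. -/
def scaleFirst (a : ℂ) (ha : a ≠ 0) : C2 ≃ C2 where
  toFun := triangular a 0 1
  invFun := triangular a⁻¹ 0 1
  left_inv z := by
    rw [triangular_apply, triangular_apply]
    ext i
    fin_cases i <;> simp [ha]
  right_inv z := by
    rw [triangular_apply, triangular_apply]
    ext i
    fin_cases i <;> simp [ha]

theorem scaleFirst_apply (a : ℂ) (ha : a ≠ 0) (z : C2) :
    scaleFirst a ha z = triangular a 0 1 z := rfl

theorem scaleFirst_ne_zero {a : ℂ} {ha : a ≠ 0} {z : C2} (hz : z ≠ 0) : scaleFirst a ha z ≠ 0 :=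
  fun h => hz ((scaleFirst a ha).injective (h.trans (map_zero (triangular a 0 1)).symm))

theorem scaleFirst_triangular {a b b' d : ℂ} (ha : a ≠ 0) (hb : a * b = b') (z : C2) :
    scaleFirst a ha (triangular d b d z) = triangular d b' d (scaleFirst a ha z) := by
  simp only [scaleFirst_apply, triangular_apply]
  ext i
  fin_cases i
  · simp [← hb]; ring
  · simp

theorem shear_symm_triangular {l : ℂ} (hl : l ≠ 0) (t : ℝ) (k : ℤ) (w : C2) :
    (shear t).symm (triangular (l ^ k) (l ^ k * (Real.sin t / 2 * k * Real.log ‖l‖ : ℝ)) (l ^ k) w)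
      = l ^ k • (shear t).symm w := by
  rw [Equiv.symm_apply_eq, shear_zpow_smul hl, Equiv.apply_symm_apply]

/-- A smooth path in `(0, 1]` from `t` to `1`. -/
def pathToOne (t s : ℝ) : ℝ := t + (1 - t) * Real.smoothTransition s

/-- Isotopies are parametrized by all of `ℝ`; the smooth cutoff keeps the path where `sin` does not
vanish, so the diagonal conjugation stays invertible. -/
theorem pathToOne_mem {t : ℝ} (ht : t ∈ Set.Ioc (0 : ℝ) 1) (s : ℝ) :
    pathToOne t s ∈ Set.Ioc (0 : ℝ) 1 := by
  have h1 := Real.smoothTransition.nonneg s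
  have h2 := Real.smoothTransition.le_one s
  unfold pathToOne
  constructor <;> nlinarith [ht.1, ht.2]

theorem sin_ne_zero_of_mem {t : ℝ} (ht : t ∈ Set.Ioc (0 : ℝ) 1) : Real.sin t ≠ 0 :=
  (Real.sin_pos_of_pos_of_lt_pi ht.1 (by linarith [ht.2, Real.pi_gt_three])).ne'

section Equivalence

variable {E : Type*} [NormedAddCommGroup E] [NormedSpace ℝ E] {H : Type*} [TopologicalSpace H]
  {I : ModelWithCorners ℝ E H} {M : Type*} [TopologicalSpace M] [ChartedSpace H M]
  [IsManifold I ∞ M] {n : ℕ} {o : ManifoldOrientation (Fin n × Fin 2) I M}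
  {l : ℂ} {P : C2 → M}

/-- The isotopy that conjugates two of the sheared homotheties. -/
def shearIsotopy {t : ℝ} (ht : t ∈ Set.Ioc (0 : ℝ) 1) (s : ℝ) : C2 ≃ C2 :=
  ((shear t).trans (scaleFirst (Real.sin (pathToOne t s) / Real.sin t : ℝ)
    (Complex.ofReal_ne_zero.2 (div_ne_zero (sin_ne_zero_of_mem (pathToOne_mem ht s))
      (sin_ne_zero_of_mem ht))))).trans (shear (pathToOne t s)).symm

theorem shearIsotopy_apply {t : ℝ} (ht : t ∈ Set.Ioc (0 : ℝ) 1) (s : ℝ) (z : C2) :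
    shearIsotopy ht s z = (shear (pathToOne t s)).symm
      (triangular (Real.sin (pathToOne t s) / Real.sin t : ℝ) 0 1 (shear t z)) := rfl

theorem triangular_ne_zero {a : ℂ} (ha : a ≠ 0) {z : C2} (hz : z ≠ 0) :
    triangular a 0 1 z ≠ 0 :=
  scaleFirst_ne_zero (ha := ha) hz

theorem contDiffAt_shearIsotopy {t : ℝ} (ht : t ∈ Set.Ioc (0 : ℝ) 1) {s : ℝ} {z : C2}
    (hz : z ≠ 0) : ContDiffAt ℝ ∞ (fun p : ℝ × C2 => shearIsotopy ht p.1 p.2) (s, z) := by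
  have hτ : ContDiffAt ℝ ∞ (fun p : ℝ × C2 => pathToOne t p.1) (s, z) :=
    ((contDiff_const.add (contDiff_const.mul Real.smoothTransition.contDiff)).comp
      contDiff_fst).contDiffAt
  have hw : ContDiffAt ℝ ∞ (fun p : ℝ × C2 => shear t p.2) (s, z) :=
    ContDiffAt.comp (g := shear t) (s, z) (contDiffAt_shear_right hz) contDiffAt_snd
  have hwi : ∀ i, ContDiffAt ℝ ∞ (fun p : ℝ × C2 => shear t p.2 i) (s, z) := fun i =>
    contDiffAt_pi.1 hw i
  have hsin : ContDiffAt ℝ ∞ (fun p : ℝ × C2 => Real.sin (pathToOne t p.1) / Real.sin t) (s, z) :=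
    (Real.contDiff_sin.contDiffAt.comp _ hτ).div_const _
  have hD : ContDiffAt ℝ ∞ (fun p : ℝ × C2 =>
      triangular (Real.sin (pathToOne t p.1) / Real.sin t : ℝ) 0 1 (shear t p.2)) (s, z) := by
    simp only [triangular_apply]
    rw [contDiffAt_pi]
    intro i
    fin_cases i
    · have : ContDiffAt ℝ ∞ (fun p : ℝ × C2 =>
          (Real.sin (pathToOne t p.1) / Real.sin t) • shear t p.2 0) (s, z) := hsin.smul (hwi 0)
      simpa only [Fin.zero_eta, Matrix.cons_val_zero, zero_mul, add_zero, Complex.real_smul]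
        using this
    · simpa only [Fin.mk_one, Matrix.cons_val_one, Matrix.cons_val_fin_one, one_mul] using hwi 1
  have hne : triangular (Real.sin (pathToOne t s) / Real.sin t : ℝ) 0 1 (shear t z) ≠ 0 :=
    triangular_ne_zero (Complex.ofReal_ne_zero.2 (div_ne_zero
      (sin_ne_zero_of_mem (pathToOne_mem ht s)) (sin_ne_zero_of_mem ht))) (shear_ne_zero.2 hz)
  exact ContDiffAt.comp (g := fun p : ℝ × C2 => (shear p.1).symm p.2)
    (f := fun p : ℝ × C2 => (pathToOne t p.1,
      triangular (Real.sin (pathToOne t p.1) / Real.sin t : ℝ) 0 1 (shear t p.2))) (s, z)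
    (contDiffAt_shear_symm hne) (hτ.prodMk hD)

theorem contDiffAt_shearIsotopy_symm {t : ℝ} (ht : t ∈ Set.Ioc (0 : ℝ) 1) (s : ℝ) {z : C2}
    (hz : z ≠ 0) : ContDiffAt ℝ ∞ (shearIsotopy ht s).symm z := by
  have hne : triangular (Real.sin (pathToOne t s) / Real.sin t : ℝ)⁻¹ 0 1
      (shear (pathToOne t s) z) ≠ 0 :=
    triangular_ne_zero (inv_ne_zero (Complex.ofReal_ne_zero.2 (div_ne_zero
      (sin_ne_zero_of_mem (pathToOne_mem ht s)) (sin_ne_zero_of_mem ht)))) (shear_ne_zero.2 hz)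
  exact ContDiffAt.comp (g := (shear t).symm) z (contDiffAt_shear_symm_right hne)
    (((triangular (Real.sin (pathToOne t s) / Real.sin t : ℝ)⁻¹ 0 1).restrictScalars
      ℝ).contDiff.contDiffAt.comp z (contDiffAt_shear_right hz))

/-- `S_t` turns `l ^ k` into a triangular matrix whose off-diagonal entry is proportional to `sin
t`. The diagonal scaling changes that factor to `sin (pathToOne t s)`, and the last inverse shear
turns the result back into `l ^ k`. -/
theorem shearIsotopy_zpow_smul (hl : l ≠ 0) {t : ℝ} (ht : t ∈ Set.Ioc (0 : ℝ) 1) (s : ℝ) (k : ℤ)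
    (z : C2) : shearIsotopy ht s (l ^ k • z) = l ^ k • shearIsotopy ht s z := by
  have hs : (Real.sin t : ℂ) ≠ 0 := Complex.ofReal_ne_zero.2 (sin_ne_zero_of_mem ht)
  have ha : ((Real.sin (pathToOne t s) / Real.sin t : ℝ) : ℂ) ≠ 0 :=
    Complex.ofReal_ne_zero.2 (div_ne_zero (sin_ne_zero_of_mem (pathToOne_mem ht s))
      (sin_ne_zero_of_mem ht))
  rw [shearIsotopy_apply, shearIsotopy_apply, shear_zpow_smul hl, ← scaleFirst_apply _ ha,
    scaleFirst_triangular ha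
      (b' := l ^ k * (Real.sin (pathToOne t s) / 2 * k * Real.log ‖l‖ : ℝ)),
    shear_symm_triangular hl, scaleFirst_apply]
  push_cast
  rw [Complex.ofReal_sin] at hs
  field_simp

/-- Between `P ∘ S_t⁻¹` and `P ∘ S_1⁻¹` the end of the isotopy is `diag(sin 1 / sin t, 1)`. It is
complex linear, hence holomorphic from `J t` to `J 1`. -/
theorem teichmullerRel_of_shear (hl : l ≠ 0) (hP : IsParam I P) (hc : IsScalarCover l P)
    {J : ℝ → ComplexStructure o}
    (hJ : ∀ t, ReadsAs (fun z => P ((shear t).symm z)) (J t).op fun _ => mulI) {t : ℝ}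
    (ht : t ∈ Set.Ioc (0 : ℝ) 1) : TeichmullerRel (J 1) (J t) := by
  obtain ⟨f, hf, hfP⟩ := hP.exists_isotopy hc (G := shearIsotopy ht)
    (fun s z hz => contDiffAt_shearIsotopy ht hz)
    (fun s z hz => contDiffAt_shearIsotopy_symm ht s hz)
    (fun s => by
      rw [shearIsotopy_apply, shear_map_zero, map_zero, Equiv.symm_apply_eq, shear_map_zero])
    (fun s k z => shearIsotopy_zpow_smul hl ht s k z)
    (fun z => by
      have h0 : pathToOne t 0 = t := by simp [pathToOne]
      rw [shearIsotopy_apply, h0, div_self (sin_ne_zero_of_mem ht), triangular_apply]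
      simp [← eq_vec])
  refine ⟨f, hf, fun x v => ?_⟩
  obtain ⟨w, hw, rfl⟩ := (hP.shear t).exists_eq x
  obtain ⟨e, he⟩ := ((hP.shear t).isLocalDiffeomorphAt w hw).exists_tder_equiv
  obtain ⟨u, rfl⟩ := e.surjective v
  have heu : ∀ u, e u = tder I (fun z => P ((shear t).symm z)) w u := fun u => by rw [← he]; rfl
  have h1 : pathToOne t 1 = 1 := by simp [pathToOne]
  set a : ℂ := ((Real.sin 1 / Real.sin t : ℝ) : ℂ) with ha
  have ha0 : a ≠ 0 := Complex.ofReal_ne_zero.2 (div_ne_zero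
    (sin_ne_zero_of_mem ⟨one_pos, le_rfl⟩) (sin_ne_zero_of_mem ht))
  have hfw : ∀ w ≠ 0, f (P ((shear t).symm w)) = P ((shear 1).symm (triangular a 0 1 w)) := by
    intro w hw
    rw [hfP _ (shear_symm_ne_zero.2 hw), shearIsotopy_apply, h1, Equiv.apply_symm_apply]
  have hfd : ∀ u, (mfderiv I I f (P ((shear t).symm w)) (e u) : E) =
      (tder I (fun z => P ((shear 1).symm z)) (triangular a 0 1 w) (triangular a 0 1 u) : E) := by
    intro u
    rw [heu]
    refine (tder_mcomp ((hP.shear t).mdifferentiableAt hw)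
      (f.contMDiff.mdifferentiable (by simp) _) u).symm.trans ?_
    refine ((hP.shear 1).tder_eq_comp (ψ := (triangular a 0 1).restrictScalars ℝ)
      (fun z hz => triangular_ne_zero ha0 hz)
      (fun z _ => ContinuousLinearMap.differentiableAt _) hfw hw u).trans ?_
    rw [ContinuousLinearMap.fderiv]
    rfl
  have hJt := hJ t w hw u
  rw [← heu, ← heu] at hJt
  refine (congrArg (mfderiv I I f _) hJt).trans ((hfd _).trans ?_)
  refine Eq.trans ?_ (op_congr (J 1).op (hfw w hw) (hfd u)).symm
  have hJ1 := hJ 1 _ (triangular_ne_zero ha0 hw) (triangular a 0 1 u)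
  refine Eq.trans ?_ hJ1.symm
  have : triangular a 0 1 (mulI u) = mulI (triangular a 0 1 u) :=
    map_smul (triangular a 0 1) Complex.I u
  rw [this]

/-- `S_1` turns `l` into a Jordan block with entry `c = l (sin 1 / 2) log ‖l‖`, nonzero because `‖l‖
< 1`. Multiplying the first coordinate by `c` normalises this entry to `1`. -/
theorem isBiholomorphicToHopf_jordan_of_shear (h0 : 0 < ‖l‖) (h1 : ‖l‖ < 1) (hP : IsParam I P)
    (φ : HopfSurface (!![l, 0; 0, l] : Matrix _ _ ℂ).mulVec ≃ M)
    (hφ : ∀ z : PuncturedPlane, φ (Quot.mk _ z) = P z) {J : ComplexStructure o}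
    (hJ : ReadsAs (fun z => P ((shear 1).symm z)) J.op fun _ => mulI) :
    IsBiholomorphicToHopf J (!![l, 1; 0, l] : Matrix _ _ ℂ).mulVec := by
  have hl : l ≠ 0 := norm_pos_iff.1 h0
  set c : ℂ := l ^ (1 : ℤ) * (Real.sin 1 / 2 * (1 : ℤ) * Real.log ‖l‖ : ℝ) with hc
  have hc0 : c ≠ 0 := by
    refine mul_ne_zero (zpow_ne_zero _ hl) (Complex.ofReal_ne_zero.2 (mul_ne_zero ?_ ?_))
    · have := sin_ne_zero_of_mem (t := 1) ⟨one_pos, le_rfl⟩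
      simpa using this
    · exact (Real.log_neg h0 h1).ne
  let T : C2 ≃ C2 := (scaleFirst c hc0).trans (shear 1).symm
  have hT : ∀ z, T z = (shear 1).symm (scaleFirst c hc0 z) := fun z => rfl
  have hT0 : ∀ z, z ≠ 0 ↔ T z ≠ 0 := by
    have : T 0 = 0 := by
      rw [hT, Equiv.symm_apply_eq, shear_map_zero]
      exact map_zero (triangular c 0 1)
    intro z
    conv_rhs => rw [← this, T.injective.ne_iff]
  have hTl : ∀ z, T ((!![l, 1; 0, l] : Matrix _ _ ℂ).mulVec z) = l • T z := by
    intro z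
    have e1 : (!![l, 1; 0, l] : Matrix _ _ ℂ).mulVec z = triangular (l ^ (1 : ℤ)) 1 (l ^ (1 : ℤ)) z
      := by rw [zpow_one]; rfl
    rw [e1, hT, scaleFirst_triangular hc0 (mul_one c)]
    refine (shear_symm_triangular hl 1 1 _).trans ?_
    rw [zpow_one, hT]
  let T' : PuncturedPlane ≃ PuncturedPlane := T.subtypeEquiv hT0
  have hquot : ∀ z w : PuncturedPlane, (w : C2) = (!![l, 1; 0, l] : Matrix _ _ ℂ).mulVec z ↔
      (T' w : C2) = (!![l, 0; 0, l] : Matrix _ _ ℂ).mulVec (T' z) := by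
    intro z w
    rw [mulVec_scalar]
    have e1 : (T' w : C2) = T w := rfl
    have e2 : (T' z : C2) = T z := rfl
    rw [e1, e2, ← hTl, T.injective.eq_iff]
  refine isBiholomorphicToHopf_of_param ((Quot.congr T' hquot).trans φ)
    (P := fun z => P ((shear 1).symm (scaleFirst c hc0 z))) ?_ ?_ ?_
  · intro z hz
    refine IsLocalDiffeomorphAt.comp I M (isLocalDiffeomorphAt_of_equiv
      (e := scaleFirst c hc0) (map_zero (triangular c 0 1)) ?_ ?_ hz)
      ((hP.shear 1).isLocalDiffeomorphAt _ (scaleFirst_ne_zero hz))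
    · exact fun z _ => ((triangular c 0 1).restrictScalars ℝ).contDiff.contDiffAt
    · exact fun z _ => ((triangular c⁻¹ 0 1).restrictScalars ℝ).contDiff.contDiffAt
  · intro z
    exact hφ (T' z)
  · refine hJ.comp (hP.shear 1) (ψ := (triangular c 0 1).restrictScalars ℝ)
      (fun z hz => triangular_ne_zero hc0 hz)
      (fun z _ => ContinuousLinearMap.differentiableAt _) (fun z _ => rfl) fun z hz v => ?_
    rw [ContinuousLinearMap.fderiv]
    exact map_smul (triangular c 0 1) _ _

theorem exists_degeneration [CompleteSpace E] [I.Boundaryless] (h0 : 0 < ‖l‖) (h1 : ‖l‖ < 1)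
    {J₀ : ComplexStructure o}
    (hJ : IsBiholomorphicToHopf J₀ (!![l, 0; 0, l] : Matrix _ _ ℂ).mulVec) :
    ∃ J : ℝ → ComplexStructure o, IsDegeneration J ∧ J 0 = J₀ ∧
      IsBiholomorphicToHopf (J 1) (!![l, 1; 0, l] : Matrix _ _ ℂ).mulVec := by
  have hl : l ≠ 0 := norm_pos_iff.1 h0
  obtain ⟨φ, P, hP, hφ, hPJ, hc⟩ := hJ.exists_scalarCover hl
  obtain ⟨J, hJc, rfl, hJt⟩ := exists_shear_deformation hl hP hc hPJ
  have hJ1 := isBiholomorphicToHopf_jordan_of_shear h0 h1 hP φ hφ (hJt 1)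
  refine ⟨J, ⟨hJc, fun t ht => teichmullerRel_of_shear hl hP hc hJt ht, fun h => ?_⟩, rfl, hJ1⟩
  exact not_isBiholomorphicToHopf_jordan h0 h1 hJ ((isBiholomorphicToHopf_iff_of_mk_eq h).2 hJ1)

end Equivalence

/-! ### Orientations and parametrizations -/

/-- The basis `(e₁, i e₁, e₂, i e₂)` of `ℂ²`. -/
def complexBasis : Module.Basis (Fin 2 × Fin 2) ℝ C2 :=
  Complex.basisOneI.smulTower' (Pi.basisFun ℂ (Fin 2))

theorem complexBasis_zero (i : Fin 2) : complexBasis (i, 0) = Pi.basisFun ℂ (Fin 2) i := by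
  simp [complexBasis, Module.Basis.smulTower'_apply]

theorem complexBasis_one (i : Fin 2) :
    complexBasis (i, 1) = Complex.I • Pi.basisFun ℂ (Fin 2) i := by
  simp [complexBasis, Module.Basis.smulTower'_apply]

/-- The change of basis is complex linear, and its real determinant is the squared modulus of its
complex determinant. -/
theorem orientation_eq_complexBasis (b : Module.Basis (Fin 2 × Fin 2) ℝ C2)
    (hb : ∀ i, b (i, 1) = Complex.I • b (i, 0)) : b.orientation = complexBasis.orientation := by
  symm
  rw [Module.Basis.orientation_eq_iff_det_pos]
  let L : C2 →ₗ[ℂ] C2 := (Pi.basisFun ℂ (Fin 2)).constr ℂ fun i => b (i, 0)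
  have hL : ∀ i, L (Pi.basisFun ℂ (Fin 2) i) = b (i, 0) := fun i =>
    (Pi.basisFun ℂ (Fin 2)).constr_basis ℂ _ i
  have hLb : (b : Fin 2 × Fin 2 → C2) = L.restrictScalars ℝ ∘ complexBasis := by
    funext ⟨i, k⟩
    fin_cases k
    · change b (i, 0) = L (complexBasis (i, 0))
      rw [complexBasis_zero, hL]
    · change b (i, 1) = L (complexBasis (i, 1))
      rw [complexBasis_one, map_smul, hL, hb]
  have h1 : complexBasis.det b = LinearMap.det (L.restrictScalars ℝ) := by
    rw [hLb, Module.Basis.det_comp, Module.Basis.det_self, mul_one]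
  have h2 : IsUnit (complexBasis.det b) := complexBasis.isUnit_det b
  have h3 : 0 ≤ complexBasis.det b := by
    rw [h1, LinearMap.det_restrictScalars, Algebra.norm_complex_eq]
    exact Complex.normSq_nonneg _
  exact lt_of_le_of_ne h3 h2.ne_zero.symm

theorem one_lt_rank_C2 : 1 < Module.rank ℝ C2 := by
  rw [← Module.finrank_eq_rank, Module.finrank_eq_card_basis complexBasis]
  norm_num

theorem preconnectedSpace_compl_zero : PreconnectedSpace ({0}ᶜ : Set C2) :=
  Subtype.preconnectedSpace
    (isConnected_compl_singleton_of_one_lt_rank one_lt_rank_C2 (0 : C2)).isPreconnected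

theorem orientation_eq_of_det_neg {W : Type*} [AddCommGroup W] [Module ℝ W] {e e' : C2 ≃ₗ[ℝ] W}
    {A : C2 ≃ₗ[ℝ] C2} (hA : LinearMap.det (A : C2 →ₗ[ℝ] C2) < 0) (he : ∀ v, e' v = e (A v))
    {u : Orientation ℝ W (Fin 2 × Fin 2)} (h : (complexBasis.map e).orientation ≠ u) :
    (complexBasis.map e').orientation = u := by
  have hcard := (Module.finrank_eq_card_basis complexBasis).symm
  have h2 := (complexBasis.orientation.map_eq_neg_iff_det_neg A hcard).2 hA
  have h3 : complexBasis.map e' = (complexBasis.map A).map e :=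
    Module.Basis.eq_of_apply_eq fun i => by
      rw [Module.Basis.map_apply, Module.Basis.map_apply, Module.Basis.map_apply, he]
  have : FiniteDimensional ℝ W := e.finiteDimensional
  rw [h3, Module.Basis.orientation_map, Module.Basis.orientation_map, h2, Orientation.map_neg,
    ← Module.Basis.orientation_map]
  exact ((Orientation.ne_iff_eq_neg _ _ (hcard.trans e.finrank_eq)).1 h.symm).symm

section Orientation

variable {E : Type*} [NormedAddCommGroup E] [NormedSpace ℝ E] {H : Type*} [TopologicalSpace H]
  {I : ModelWithCorners ℝ E H} {M : Type*} [TopologicalSpace M] [ChartedSpace H M]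
  [IsManifold I ∞ M] {o : ManifoldOrientation (Fin 2 × Fin 2) I M} {P : C2 → M}

/-- The parametrization preserves the orientation at `z`. -/
def IsPositiveAt (o : ManifoldOrientation (Fin 2 × Fin 2) I M) (P : C2 → M) (z : C2) : Prop :=
  ∀ e : C2 ≃L[ℝ] TangentSpace I (P z), (e : C2 →L[ℝ] TangentSpace I (P z)) = tder I P z →
    (complexBasis.map e.toLinearEquiv).orientation = o.at_point (P z)

theorem isPositiveAt_iff {z : C2} (e : C2 ≃L[ℝ] TangentSpace I (P z))
    (he : (e : C2 →L[ℝ] TangentSpace I (P z)) = tder I P z) :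
    IsPositiveAt o P z ↔
      (complexBasis.map e.toLinearEquiv).orientation = o.at_point (P z) := by
  refine ⟨fun h => h e he, fun h e' he' => ?_⟩
  have : e' = e := ContinuousLinearEquiv.coe_injective (he'.trans he.symm)
  rw [this, h]

theorem IsPositiveAt.orientation_eq {z : C2} (h : IsPositiveAt o P z)
    (hP : IsLocalDiffeomorphAt 𝓘(ℝ, C2) I ∞ P z)
    {op : ∀ x : M, TangentSpace I x →L[ℝ] TangentSpace I x}
    (hop : ∀ v, op (P z) (tder I P z v) = tder I P z (mulI v))
    (b : Module.Basis (Fin 2 × Fin 2) ℝ (TangentSpace I (P z)))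
    (hb : ∀ i, b (i, 1) = op (P z) (b (i, 0))) : b.orientation = o.at_point (P z) := by
  obtain ⟨e, he⟩ := hP.exists_tder_equiv
  rw [← h e he]
  have hop' : ∀ v, op (P z) (e v) = e (Complex.I • v) := fun v => by
    have := hop v
    rw [← he] at this
    exact this
  have h1 : (b.map e.symm.toLinearEquiv).orientation = complexBasis.orientation := by
    refine orientation_eq_complexBasis _ fun i => ?_
    have : b (i, 1) = e (Complex.I • e.symm (b (i, 0))) := by
      rw [← hop', ContinuousLinearEquiv.apply_symm_apply, hb]
    have h2 := congrArg e.symm this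
    rw [ContinuousLinearEquiv.symm_apply_apply] at h2
    exact h2
  rw [Module.Basis.orientation_map, ← h1, ← Module.Basis.orientation_map]
  congr 1
  ext i
  exact (e.apply_symm_apply (b i)).symm

/-- In a trivialization of the tangent bundle the orientation of `M` is constant near the point. The
differential of `P`, compared with its value at `z₀`, has determinant close to `1`. -/
theorem eventually_isPositiveAt_iff {z₀ : C2} (hP : IsLocalDiffeomorphAt 𝓘(ℝ, C2) I ∞ P z₀) :
    ∀ᶠ z in 𝓝 z₀, IsPositiveAt o P z ↔ IsPositiveAt o P z₀ := by
  obtain ⟨e₀, he₀⟩ := hP.exists_tder_equiv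
  let T := trivializationAt E (TangentSpace I : M → Type _) (P z₀)
  have hT₀ : P z₀ ∈ T.baseSet := FiberBundle.mem_baseSet_trivializationAt' (P z₀)
  let L₀ : C2 ≃L[ℝ] E := e₀.trans (T.continuousLinearEquivAt ℝ _ hT₀)
  have hcont : ContinuousAt P z₀ := hP.contMDiffAt.continuousAt
  let A : C2 → C2 →L[ℝ] E := inTangentCoordinates 𝓘(ℝ, C2) I id P (fun z => tder I P z) z₀
  have hA : ContinuousAt A z₀ :=
    (ContMDiffAt.mfderiv_const (m := 0) hP.contMDiffAt (by simp)).continuousAt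
  have hAe : ∀ z (hz : P z ∈ T.baseSet) (e : C2 ≃L[ℝ] TangentSpace I (P z)),
      (e : C2 →L[ℝ] TangentSpace I (P z)) = tder I P z →
      A z = (e.trans (T.continuousLinearEquivAt ℝ _ hz) : C2 ≃L[ℝ] E) := by
    intro z hz e he
    refine ContinuousLinearMap.ext fun v => ?_
    have h1 : A z v = T.continuousLinearMapAt ℝ (P z) (tder I P z
        ((trivializationAt C2 (TangentSpace 𝓘(ℝ, C2)) z₀).symmL ℝ z v)) := rfl
    rw [h1, TangentBundle.symmL_model_space, ← he]
    exact (congrFun (T.coe_continuousLinearEquivAt_eq (R := ℝ) hz) (e v)).symm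
  have hdet : ContinuousAt (fun z => ((L₀.symm : E →L[ℝ] C2).comp (A z)).det) z₀ :=
    ContinuousLinearMap.continuous_det.continuousAt.comp
      (((ContinuousLinearMap.compL ℝ C2 E C2 L₀.symm).continuous).continuousAt.comp hA)
  have hpos : 0 < ((L₀.symm : E →L[ℝ] C2).comp (A z₀)).det := by
    have : (L₀.symm : E →L[ℝ] C2).comp (A z₀) = ContinuousLinearMap.id ℝ C2 := by
      rw [hAe z₀ hT₀ e₀ he₀]
      exact L₀.coe_symm_comp_coe
    rw [this]
    simp [ContinuousLinearMap.det]
  filter_upwards [hP.eventually, hcont.eventually (T.open_baseSet.mem_nhds hT₀),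
    hcont.eventually (o.locally_constant (P z₀)), hdet.eventually (lt_mem_nhds hpos)]
    with z hz hzT hzo hzd
  obtain ⟨e, he⟩ := hz.exists_tder_equiv
  rw [isPositiveAt_iff e he, isPositiveAt_iff e₀ he₀]
  let L : C2 ≃L[ℝ] E := e.trans (T.continuousLinearEquivAt ℝ _ hzT)
  have hL : (complexBasis.map L.toLinearEquiv).orientation =
      (complexBasis.map L₀.toLinearEquiv).orientation := by
    have h1 := (complexBasis.orientation.map_eq_iff_det_pos
      (L.trans L₀.symm).toLinearEquiv (Module.finrank_eq_card_basis complexBasis).symm).2 (by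
        rw [hAe z hzT e he] at hzd
        exact hzd)
    rw [← Module.Basis.orientation_map] at h1
    rw [Module.Basis.orientation_map complexBasis L₀.toLinearEquiv, ← h1,
      ← Module.Basis.orientation_map]
    congr 1
    ext i
    exact (L₀.apply_symm_apply (L (complexBasis i))).symm
  have h1 : (complexBasis.map L.toLinearEquiv).orientation = Orientation.map _
      (T.continuousLinearEquivAt ℝ _ hzT).toLinearEquiv
        (complexBasis.map e.toLinearEquiv).orientation :=
    (Module.Basis.orientation_map _ _)
  have h2 : (complexBasis.map L₀.toLinearEquiv).orientation = Orientation.map _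
      (T.continuousLinearEquivAt ℝ _ hT₀).toLinearEquiv
        (complexBasis.map e₀.toLinearEquiv).orientation :=
    (Module.Basis.orientation_map _ _)
  rw [← (Orientation.map _ (T.continuousLinearEquivAt ℝ _ hzT).toLinearEquiv).injective.eq_iff,
    ← (Orientation.map _ (T.continuousLinearEquivAt ℝ _ hT₀).toLinearEquiv).injective.eq_iff,
    hzo hzT, ← h1, ← h2, hL]

/-- Positivity is locally constant and `ℂ² ∖ {0}` is connected, so a single point decides the
orientation. -/
theorem IsParam.isPositiveAt_iff (hP : IsParam I P) {z w : C2} (hz : z ≠ 0) (hw : w ≠ 0) :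
    IsPositiveAt o P z ↔ IsPositiveAt o P w := by
  have := preconnectedSpace_compl_zero
  have h : IsLocallyConstant fun z : ({0}ᶜ : Set C2) => IsPositiveAt o P z := by
    rw [IsLocallyConstant.iff_eventually_eq]
    intro z
    filter_upwards [continuous_subtype_val.continuousAt.eventually
      (eventually_isPositiveAt_iff (o := o) (hP.isLocalDiffeomorphAt z z.2))] with w hw
    exact propext hw
  exact iff_of_eq (h.apply_eq_of_preconnectedSpace (⟨z, hz⟩ : ({0}ᶜ : Set C2)) ⟨w, hw⟩)

/-- A change of parametrization with negative Jacobian determinant reverses the orientation. -/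
theorem IsPositiveAt.of_det_neg {Q : C2 → M} {z w : C2} {A : C2 ≃L[ℝ] C2}
    (hQ : IsLocalDiffeomorphAt 𝓘(ℝ, C2) I ∞ Q w) (h : ¬ IsPositiveAt o Q w) (hz : P z = Q w)
    (hA : LinearMap.det (A.toLinearEquiv : C2 →ₗ[ℝ] C2) < 0)
    (hd : ∀ v, (tder I P z v : E) = (tder I Q w (A v) : E)) : IsPositiveAt o P z := by
  obtain ⟨e, he⟩ := hQ.exists_tder_equiv
  rw [_root_.isPositiveAt_iff e he] at h
  have key : ∀ (x : M) (_ : x = Q w) (e' : C2 ≃L[ℝ] TangentSpace I x),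
      (∀ v, (e' v : E) = (e (A v) : E)) →
      (complexBasis.map e'.toLinearEquiv).orientation = o.at_point x := by
    rintro x rfl e' he'
    exact orientation_eq_of_det_neg hA he' h
  intro e' he'
  refine key (P z) hz e' fun v => ?_
  have h1 : e' v = tder I P z v := by rw [← he']; rfl
  have h2 : e (A v) = tder I Q w (A v) := by rw [← he]; rfl
  rw [h1, h2]
  exact hd v

end Orientation

/-! ### The flow through the homothety and an orientation-reversing involution -/

section Flow

/-- The function on `ℂ² ∖ {0}` that increases by `1` under the homothety of ratio `l`. -/
def hopfTime (l : ℂ) (z : C2) : ℝ := logNormSq z / (2 * Real.log ‖l‖)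

/-- The one-parameter group of homotheties through the homothety of ratio `l`. -/
def hopfFlow (l : ℂ) (s : ℝ) (z : C2) : C2 := Complex.exp (s * Complex.log l) • z

variable {l : ℂ}

theorem hopfFlow_ne_zero {s : ℝ} {z : C2} (hz : z ≠ 0) : hopfFlow l s z ≠ 0 :=
  smul_ne_zero (Complex.exp_ne_zero _) hz

theorem hopfFlow_hopfFlow (s t : ℝ) (z : C2) :
    hopfFlow l s (hopfFlow l t z) = hopfFlow l (s + t) z := by
  rw [hopfFlow, hopfFlow, hopfFlow, smul_smul, ← Complex.exp_add]
  push_cast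
  rw [add_mul]

theorem hopfFlow_zero (z : C2) : hopfFlow l 0 z = z := by simp [hopfFlow]

theorem hopfFlow_intCast (hl : l ≠ 0) (k : ℤ) (z : C2) : hopfFlow l k z = l ^ k • z := by
  rw [hopfFlow, Complex.ofReal_intCast, Complex.exp_int_mul, Complex.exp_log hl]

theorem hopfTime_hopfFlow (h0 : 0 < ‖l‖) (h1 : ‖l‖ < 1) (s : ℝ) {z : C2} (hz : z ≠ 0) :
    hopfTime l (hopfFlow l s z) = hopfTime l z + s := by
  have h := logNormSq_zpow_smul (Complex.exp_ne_zero (s * Complex.log l)) 1 hz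
  rw [zpow_one] at h
  have hlog : Real.log ‖l‖ ≠ 0 := (Real.log_neg h0 h1).ne
  rw [hopfTime, hopfFlow, h, Complex.norm_exp, Real.log_exp, Complex.re_ofReal_mul,
    Complex.log_re, hopfTime]
  field_simp
  simp

theorem contDiffAt_hopfTime {z : C2} (hz : z ≠ 0) : ContDiffAt ℝ ∞ (hopfTime l) z :=
  (contDiffAt_logNormSq hz).div_const _

theorem contDiff_hopfFlow : ContDiff ℝ ∞ fun p : ℝ × C2 => hopfFlow l p.1 p.2 :=
  ((Complex.ofRealCLM.contDiff.comp contDiff_fst).mul contDiff_const).cexp.smul contDiff_snd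

/-- The involution of `ℂ² ∖ {0}` that changes the sign of `hopfTime` on each orbit of the flow. -/
def hopfReversalFun (l : ℂ) (z : C2) : C2 := hopfFlow l (-2 * hopfTime l z) z

theorem hopfReversalFun_zero : hopfReversalFun l 0 = 0 := by
  simp [hopfReversalFun, hopfFlow]

theorem hopfReversalFun_involutive (h0 : 0 < ‖l‖) (h1 : ‖l‖ < 1) :
    Function.Involutive (hopfReversalFun l) := by
  intro z
  by_cases hz : z = 0
  · simp [hopfReversalFun, hopfFlow, hz]
  · rw [hopfReversalFun, hopfReversalFun, hopfFlow_hopfFlow, hopfTime_hopfFlow h0 h1 _ hz]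
    convert hopfFlow_zero z using 2
    ring

theorem contDiffAt_hopfReversalFun {z : C2} (hz : z ≠ 0) :
    ContDiffAt ℝ ∞ (hopfReversalFun l) z :=
  ContDiffAt.comp (g := fun p : ℝ × C2 => hopfFlow l p.1 p.2)
    (f := fun z : C2 => (-2 * hopfTime l z, z)) z contDiff_hopfFlow.contDiffAt
    ((contDiffAt_const.mul (contDiffAt_hopfTime hz)).prodMk contDiffAt_id)

theorem hopfTime_zpow_smul (h0 : 0 < ‖l‖) (h1 : ‖l‖ < 1) (k : ℤ) {z : C2} (hz : z ≠ 0) :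
    hopfTime l (l ^ k • z) = hopfTime l z + k := by
  rw [← hopfFlow_intCast (norm_pos_iff.1 h0), hopfTime_hopfFlow h0 h1 _ hz]

theorem hopfReversalFun_zpow_smul (h0 : 0 < ‖l‖) (h1 : ‖l‖ < 1) (k : ℤ) {z : C2} (hz : z ≠ 0) :
    hopfReversalFun l (l ^ k • z) = l ^ (-k) • hopfReversalFun l z := by
  have hl : l ≠ 0 := norm_pos_iff.1 h0
  rw [← hopfFlow_intCast hl, ← hopfFlow_intCast hl, hopfReversalFun, hopfReversalFun,
    hopfTime_hopfFlow h0 h1 _ hz, hopfFlow_hopfFlow, hopfFlow_hopfFlow]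
  congr 1
  push_cast
  ring

/-- The involution `hopfReversalFun` as a permutation of `ℂ²`. -/
def hopfReversal (h0 : 0 < ‖l‖) (h1 : ‖l‖ < 1) : C2 ≃ C2 :=
  (hopfReversalFun_involutive h0 h1).toPerm

theorem hopfTime_unit : hopfTime l ![1, 0] = 0 := by
  simp [hopfTime, logNormSq]

theorem unit_ne_zero : (![1, 0] : C2) ≠ 0 := fun h => one_ne_zero (congrFun h 0)

/-- With `a = log l`, the involution fixes `z₀ = (1, 0)`, and its differential there is `v ↦ v - 2
f(v) a z₀`, where `f` is the differential of `hopfTime`. Time has unit speed along the flow, so `f(a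
z₀) = 1`: this is a reflection, of determinant `-1`. -/
theorem exists_det_neg_hasFDerivAt_hopfReversalFun (h0 : 0 < ‖l‖) (h1 : ‖l‖ < 1) :
    ∃ A : C2 →L[ℝ] C2, A.det < 0 ∧ HasFDerivAt (hopfReversalFun l) A ![1, 0] := by
  set z₀ : C2 := ![1, 0] with hz₀
  have hz : z₀ ≠ 0 := unit_ne_zero
  set a : ℂ := Complex.log l
  obtain ⟨f, hf⟩ : ∃ f, HasFDerivAt (hopfTime l) f z₀ :=
    (contDiffAt_hopfTime hz).differentiableAt (by simp)
  have hfa : f (a • z₀) = 1 := by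
    have hflow : HasDerivAt (fun s : ℝ => hopfFlow l s z₀) (a • z₀) 0 := by
      have h2 : HasDerivAt (fun s : ℝ => (s : ℂ) * a) a 0 := by
        simpa using (Complex.ofRealCLM.hasDerivAt (x := (0 : ℝ))).mul_const a
      have h3 := h2.cexp.smul_const z₀
      rw [Complex.ofReal_zero, zero_mul, Complex.exp_zero, one_mul] at h3
      exact h3
    have hf' : HasFDerivAt (hopfTime l) f (hopfFlow l 0 z₀) := by rwa [hopfFlow_zero]
    have h2 := hf'.comp_hasDerivAt (0 : ℝ) hflow
    have h3 : hopfTime l ∘ (fun s : ℝ => hopfFlow l s z₀) = fun s => s := by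
      funext s
      rw [Function.comp_apply, hopfTime_hopfFlow h0 h1 s hz, hopfTime_unit, zero_add]
    rw [h3] at h2
    exact h2.unique (hasDerivAt_id _)
  let g : Module.Dual ℝ C2 := -2 • (f : C2 →ₗ[ℝ] ℝ)
  let A : C2 →L[ℝ] C2 := ContinuousLinearMap.id ℝ C2 + (-2 • f).smulRight (a • z₀)
  have hA : (A : C2 →ₗ[ℝ] C2) = LinearMap.transvection g (a • z₀) := by
    ext v
    rfl
  refine ⟨A, ?_, ?_⟩
  · rw [ContinuousLinearMap.det, hA, LinearMap.transvection.det]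
    have : g (a • z₀) = -2 := by
      change -2 • f (a • z₀) = -2
      rw [hfa]
      norm_num
    rw [this]
    norm_num
  · have h2 : HasFDerivAt (fun z => ((-2 * hopfTime l z : ℝ) : ℂ) * a)
        ((Complex.ofRealCLM.comp ((-2 : ℝ) • f)).smulRight a) z₀ :=
      (Complex.ofRealCLM.hasFDerivAt.comp z₀ (hf.const_mul (-2))).mul_const' a
    have h3 := h2.cexp.smul (hasFDerivAt_id z₀)
    have h4 : A = Complex.exp (((-2 * hopfTime l z₀ : ℝ) : ℂ) * a) • ContinuousLinearMap.id ℝ C2 +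
        (Complex.exp (((-2 * hopfTime l z₀ : ℝ) : ℂ) * a) •
          (Complex.ofRealCLM.comp ((-2 : ℝ) • f)).smulRight a).smulRight z₀ := by
      refine ContinuousLinearMap.ext fun v => ?_
      simp [A, hopfTime_unit, hz₀]
    rw [h4]
    exact h3

end Flow

/-! ### Existence of a Hopf structure for either orientation -/

section Existence

variable {E : Type*} [NormedAddCommGroup E] [NormedSpace ℝ E] {H : Type*} [TopologicalSpace H]
  {I : ModelWithCorners ℝ E H} {M : Type*} [TopologicalSpace M] [ChartedSpace H M]
  [IsManifold I ∞ M] {l : ℂ} {P : C2 → M}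

/-- A covering with the wrong orientation is composed with the time reversal. The latter conjugates
`l` to `l⁻¹`, so the fibres are still the orbits of `l`. -/
theorem IsParam.exists_isPositiveAt (o : ManifoldOrientation (Fin 2 × Fin 2) I M)
    (h0 : 0 < ‖l‖) (h1 : ‖l‖ < 1) (hP : IsParam I P) (hc : IsScalarCover l P) :
    ∃ Q : C2 → M, IsParam I Q ∧ IsScalarCover l Q ∧ ∀ z ≠ 0, IsPositiveAt o Q z := by
  by_cases h : IsPositiveAt o P ![1, 0]
  · exact ⟨P, hP, hc, fun z hz => (hP.isPositiveAt_iff unit_ne_zero hz).1 h⟩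
  have hl : l ≠ 0 := norm_pos_iff.1 h0
  have hR0 : hopfReversal h0 h1 0 = 0 := hopfReversalFun_zero
  have hR : ∀ z ≠ 0, hopfReversalFun l z ≠ 0 := fun z hz => hopfFlow_ne_zero hz
  have hQ : IsParam I fun z => P (hopfReversal h0 h1 z) :=
    hP.comp_equiv hR0 (fun z hz => contDiffAt_hopfReversalFun hz)
      (fun z hz => contDiffAt_hopfReversalFun hz)
  refine ⟨_, hQ, ⟨fun k z hz => ?_, fun z hz w hw hzw => ?_⟩,
    fun z hz => (hQ.isPositiveAt_iff unit_ne_zero hz).1 ?_⟩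
  · refine (congrArg P (hopfReversalFun_zpow_smul h0 h1 k hz)).trans ?_
    exact hc.invariant _ _ (hR z hz)
  · obtain ⟨k, hk⟩ := hc.exists_zpow _ (hR z hz) _ (hR w hw) hzw
    refine ⟨-k, hopfReversalFun_involutive h0 h1 |>.injective ?_⟩
    rw [hopfReversalFun_zpow_smul h0 h1 _ hz, neg_neg]
    exact hk
  · obtain ⟨A, hA, hd⟩ := exists_det_neg_hasFDerivAt_hopfReversalFun h0 h1
    have hunit : hopfReversalFun l ![1, 0] = ![1, 0] := by
      rw [hopfReversalFun, hopfTime_unit, mul_zero, hopfFlow_zero]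
    let A' : C2 ≃L[ℝ] C2 := (LinearEquiv.ofIsUnitDet (f := (A : C2 →ₗ[ℝ] C2))
      (v := complexBasis) (v' := complexBasis) (by
        rw [LinearMap.det_toMatrix]; exact hA.ne.isUnit)).toContinuousLinearEquiv
    refine IsPositiveAt.of_det_neg (Q := P) (w := ![1, 0]) (A := A')
      (hP.isLocalDiffeomorphAt _ unit_ne_zero) h (congrArg P hunit) hA fun v => ?_
    refine (hP.tder_eq_comp hR
      (fun z hz => (contDiffAt_hopfReversalFun hz).differentiableAt (by simp))
      (fun z _ => rfl) unit_ne_zero v).trans ?_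
    rw [hunit, hd.fderiv]
    rfl

/-- The deck transformations are complex linear, so `i` descends to `M`. The fibres being exactly
the orbits, the induced map from the Hopf surface is bijective. -/
theorem IsScalarCover.exists_isBiholomorphicToHopf [CompleteSpace E] [I.Boundaryless]
    (o : ManifoldOrientation (Fin 2 × Fin 2) I M) (h0 : 0 < ‖l‖) (h1 : ‖l‖ < 1)
    (hc : IsScalarCover l P) (hP : IsParam I P) :
    ∃ J : ComplexStructure o, IsBiholomorphicToHopf J (!![l, 0; 0, l] : Matrix _ _ ℂ).mulVec := by
  have hl : l ≠ 0 := norm_pos_iff.1 h0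
  obtain ⟨Q, hQ, hQc, hQo⟩ := hP.exists_isPositiveAt o h0 h1 hc
  obtain ⟨op, hop⟩ := hQ.exists_readsAs_mulI fun z hz w hw h => by
    obtain ⟨k, rfl⟩ := hQc.exists_zpow z hz w hw h
    exact ⟨l ^ k • ContinuousLinearMap.id ℂ C2, rfl, fun y hy => hQc.invariant k y hy⟩
  obtain ⟨J, rfl⟩ := exists_complexStructure (o := o) hQ hQ (fun z _ => contDiffAt_const) hop hop
    fun x b hb => by
      obtain ⟨z, hz, rfl⟩ := hQ.exists_eq x
      exact (hQo z hz).orientation_eq (hQ.isLocalDiffeomorphAt z hz) (hop z hz) b hb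
  let φ : HopfSurface (!![l, 0; 0, l] : Matrix _ _ ℂ).mulVec → M :=
    Quot.lift (fun z : PuncturedPlane => Q z) fun z w h => by
      rw [h, mulVec_scalar, ← zpow_one l, hQc.invariant 1 z z.2]
  have hmk : ∀ (k : ℤ) (z w : PuncturedPlane), (w : C2) = l ^ k • (z : C2) →
      (Quot.mk _ z : HopfSurface (!![l, 0; 0, l] : Matrix _ _ ℂ).mulVec) = Quot.mk _ w := by
    classical
    intro k z w h
    let R : C2 → HopfSurface (!![l, 0; 0, l] : Matrix _ _ ℂ).mulVec := fun y =>
      if hy : y ≠ 0 then Quot.mk _ ⟨y, hy⟩ else Quot.mk _ z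
    have hR : ∀ y : PuncturedPlane, R y = Quot.mk _ y := fun y => dif_pos y.2
    have hinv := invariant_zpow_smul hl (P := R) (fun y hy => by
      have e1 := hR ⟨y, hy⟩
      have e2 := hR ⟨l • y, smul_ne_zero hl hy⟩
      refine e2.trans (Eq.trans ?_ e1.symm)
      exact (HopfSurface.mk_eq (mulVec_scalar l y).symm).symm) k z z.2
    rw [← h, hR, hR] at hinv
    exact hinv.symm
  have hφ : Function.Bijective φ := by
    constructor
    · rintro ⟨z⟩ ⟨w⟩ h
      obtain ⟨k, hk⟩ := hQc.exists_zpow z z.2 w w.2 h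
      exact hmk k z w hk
    · intro x
      obtain ⟨z, hz, rfl⟩ := hQ.exists_eq x
      exact ⟨Quot.mk _ ⟨z, hz⟩, rfl⟩
  exact ⟨J, isBiholomorphicToHopf_of_param (Equiv.ofBijective φ hφ) hQ.isLocalDiffeomorphAt
    (fun z => rfl) hop⟩

end Existence

/-! ### The covering of the product of spheres -/

section Cover

/-- The real and imaginary parts of the coordinates. -/
def realCoords : C2 ≃L[ℝ] EuclideanSpace ℝ (Fin 4) :=
  LinearEquiv.toContinuousLinearEquiv
    { toFun := fun z => !₂[(z 0).re, (z 0).im, (z 1).re, (z 1).im]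
      invFun := fun x => ![⟨x 0, x 1⟩, ⟨x 2, x 3⟩]
      map_add' := fun z w => by ext i; fin_cases i <;> simp
      map_smul' := fun c z => by ext i; fin_cases i <;> simp
      left_inv := fun z => by ext i; fin_cases i <;> simp
      right_inv := fun x => by ext i; fin_cases i <;> simp }

theorem norm_realCoords_sq (z : C2) : ‖realCoords z‖ ^ 2 = ‖z 0‖ ^ 2 + ‖z 1‖ ^ 2 := by
  have h : realCoords z = !₂[(z 0).re, (z 0).im, (z 1).re, (z 1).im] := rfl
  rw [EuclideanSpace.norm_sq_eq, h]
  simp [Fin.sum_univ_four, ← Complex.normSq_eq_norm_sq, Complex.normSq_apply]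
  ring

variable {l : ℂ}

theorem norm_realCoords_eq_one_iff (h0 : 0 < ‖l‖) (h1 : ‖l‖ < 1) {z : C2} (hz : z ≠ 0) :
    ‖realCoords z‖ = 1 ↔ hopfTime l z = 0 := by
  have hlog : Real.log ‖l‖ ≠ 0 := (Real.log_neg h0 h1).ne
  have hp := normSq_pos hz
  rw [hopfTime, div_eq_zero_iff, or_iff_left (mul_ne_zero two_ne_zero hlog), logNormSq,
    ← norm_realCoords_sq]
  rw [← norm_realCoords_sq] at hp
  constructor
  · intro h
    simp [h]
  · intro h
    have h2 := Real.eq_one_of_pos_of_log_eq_zero hp h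
    exact (pow_eq_one_iff_of_nonneg (norm_nonneg _) two_ne_zero).1 h2

theorem realCoords_normalize_mem (h0 : 0 < ‖l‖) (h1 : ‖l‖ < 1) {z : C2} (hz : z ≠ 0) :
    realCoords (hopfFlow l (-hopfTime l z) z) ∈ Metric.sphere (0 : EuclideanSpace ℝ (Fin 4)) 1 := by
  rw [mem_sphere_zero_iff_norm, norm_realCoords_eq_one_iff h0 h1 (hopfFlow_ne_zero hz),
    hopfTime_hopfFlow h0 h1 _ hz, add_neg_cancel]

theorem realCoords_unit_mem : realCoords ![1, 0] ∈ Metric.sphere (0 : EuclideanSpace ℝ (Fin 4)) 1 := by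
  have h := norm_realCoords_sq ![1, 0]
  rw [mem_sphere_zero_iff_norm]
  refine (pow_eq_one_iff_of_nonneg (norm_nonneg _) two_ne_zero).1 ?_
  rw [h]
  simp

open Classical in
/-- The projection of `ℂ² ∖ {0}` onto the unit sphere along the flow. -/
def sphereProj (h0 : 0 < ‖l‖) (h1 : ‖l‖ < 1) (z : C2) :
    Metric.sphere (0 : EuclideanSpace ℝ (Fin 4)) 1 :=
  if hz : z ≠ 0 then ⟨_, realCoords_normalize_mem h0 h1 hz⟩ else ⟨_, realCoords_unit_mem⟩

theorem coe_sphereProj (h0 : 0 < ‖l‖) (h1 : ‖l‖ < 1) {z : C2} (hz : z ≠ 0) :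
    (sphereProj h0 h1 z : EuclideanSpace ℝ (Fin 4)) =
      realCoords (hopfFlow l (-hopfTime l z) z) := by
  rw [sphereProj, dif_pos hz]

theorem contMDiffAt_sphereProj (h0 : 0 < ‖l‖) (h1 : ‖l‖ < 1) {z : C2} (hz : z ≠ 0) :
    ContMDiffAt 𝓘(ℝ, C2) (𝓡 3) ∞ (sphereProj h0 h1) z := by
  have h : ContMDiff 𝓘(ℝ, C2) 𝓘(ℝ, EuclideanSpace ℝ (Fin 4)) ∞ fun z : PuncturedPlane =>
      realCoords (hopfFlow l (-hopfTime l z) z) := by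
    intro z
    refine (contMDiffAt_subtype_iff (f := fun z : C2 =>
      realCoords (hopfFlow l (-hopfTime l z) z))).2 (ContDiffAt.contMDiffAt ?_)
    refine realCoords.contDiff.contDiffAt.comp _ ?_
    exact ContDiffAt.comp (g := fun p : ℝ × C2 => hopfFlow l p.1 p.2)
      (f := fun z : C2 => (-hopfTime l z, z)) (z : C2) contDiff_hopfFlow.contDiffAt
      ((contDiffAt_hopfTime z.2).neg.prodMk contDiffAt_id)
  have : Fact (Module.finrank ℝ (EuclideanSpace ℝ (Fin 4)) = 3 + 1) := ⟨finrank_euclideanSpace_fin⟩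
  have h2 := h.codRestrict_sphere (n := 3) fun z => realCoords_normalize_mem h0 h1 z.2
  refine (contMDiffAt_subtype_iff (U := PuncturedPlane) (x := ⟨z, hz⟩)).1 ?_
  refine (h2 ⟨z, hz⟩).congr_of_eventuallyEq (Filter.Eventually.of_forall fun w => ?_)
  exact Subtype.ext (coe_sphereProj h0 h1 w.2)

/-- The covering of `S³ × S¹` by `ℂ² ∖ {0}`. -/
def hopfCover (h0 : 0 < ‖l‖) (h1 : ‖l‖ < 1) (z : C2) : SphereTimesCircle :=
  (sphereProj h0 h1 z, Circle.exp (2 * Real.pi * hopfTime l z))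

/-- The lift of a point of `S³ × S¹` to a given time. -/
def hopfLift (l : ℂ) (s : ℝ) (x : Metric.sphere (0 : EuclideanSpace ℝ (Fin 4)) 1) : C2 :=
  hopfFlow l s (realCoords.symm x)

theorem realCoords_symm_ne_zero (x : Metric.sphere (0 : EuclideanSpace ℝ (Fin 4)) 1) :
    realCoords.symm x ≠ 0 := by
  rw [Ne, realCoords.symm.map_eq_zero_iff]
  exact ne_zero_of_mem_unit_sphere x

theorem hopfLift_ne_zero (s : ℝ) (x : Metric.sphere (0 : EuclideanSpace ℝ (Fin 4)) 1) :
    hopfLift l s x ≠ 0 :=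
  hopfFlow_ne_zero (realCoords_symm_ne_zero x)

theorem hopfTime_hopfLift (h0 : 0 < ‖l‖) (h1 : ‖l‖ < 1) (s : ℝ)
    (x : Metric.sphere (0 : EuclideanSpace ℝ (Fin 4)) 1) : hopfTime l (hopfLift l s x) = s := by
  rw [hopfLift, hopfTime_hopfFlow h0 h1 s (realCoords_symm_ne_zero x),
    (norm_realCoords_eq_one_iff h0 h1 (realCoords_symm_ne_zero x)).1, zero_add]
  rw [realCoords.apply_symm_apply, norm_eq_of_mem_sphere]

theorem sphereProj_hopfLift (h0 : 0 < ‖l‖) (h1 : ‖l‖ < 1) (s : ℝ)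
    (x : Metric.sphere (0 : EuclideanSpace ℝ (Fin 4)) 1) :
    sphereProj h0 h1 (hopfLift l s x) = x := by
  apply Subtype.ext
  rw [coe_sphereProj h0 h1 (hopfLift_ne_zero s x), hopfTime_hopfLift h0 h1, hopfLift,
    hopfFlow_hopfFlow, neg_add_cancel, hopfFlow_zero, realCoords.apply_symm_apply]

theorem hopfLift_sphereProj (h0 : 0 < ‖l‖) (h1 : ‖l‖ < 1) (s : ℝ) {z : C2} (hz : z ≠ 0) :
    hopfLift l s (sphereProj h0 h1 z) = hopfFlow l (s - hopfTime l z) z := by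
  rw [hopfLift, coe_sphereProj h0 h1 hz, realCoords.symm_apply_apply, hopfFlow_hopfFlow,
    sub_eq_add_neg]

theorem hopfCover_hopfLift (h0 : 0 < ‖l‖) (h1 : ‖l‖ < 1) (s : ℝ)
    (x : Metric.sphere (0 : EuclideanSpace ℝ (Fin 4)) 1) :
    hopfCover h0 h1 (hopfLift l s x) = (x, Circle.exp (2 * Real.pi * s)) := by
  rw [hopfCover, sphereProj_hopfLift, hopfTime_hopfLift h0 h1]

/-- The sphere component determines the orbit of the flow and the circle component determines the
time modulo `1`. Two points of a fibre thus differ by an integral time of the flow, that is, by a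
power of `l`. -/
theorem isScalarCover_hopfCover (h0 : 0 < ‖l‖) (h1 : ‖l‖ < 1) :
    IsScalarCover l (hopfCover h0 h1) := by
  have hl : l ≠ 0 := norm_pos_iff.1 h0
  refine ⟨fun k z hz => ?_, fun z hz w hw h => ?_⟩
  · refine Prod.ext (Subtype.ext ?_) ?_
    · change (sphereProj h0 h1 _ : EuclideanSpace ℝ (Fin 4)) = sphereProj h0 h1 z
      rw [coe_sphereProj h0 h1 hz, coe_sphereProj h0 h1 (smul_ne_zero (zpow_ne_zero k hl) hz),
        hopfTime_zpow_smul h0 h1 k hz, ← hopfFlow_intCast hl, hopfFlow_hopfFlow]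
      congr 2
      ring
    · change Circle.exp _ = Circle.exp _
      rw [hopfTime_zpow_smul h0 h1 k hz, Circle.exp_eq_exp]
      exact ⟨k, by ring⟩
  · have hs : sphereProj h0 h1 z = sphereProj h0 h1 w := congrArg Prod.fst h
    have hc : Circle.exp _ = Circle.exp _ := congrArg Prod.snd h
    obtain ⟨m, hm⟩ := Circle.exp_eq_exp.1 hc
    have hm' : hopfTime l z = hopfTime l w + m := by
      have := Real.pi_pos
      field_simp at hm
      linarith
    refine ⟨-m, ?_⟩
    have h2 := hopfLift_sphereProj h0 h1 (hopfTime l w) hw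
    rw [← hs, hopfLift_sphereProj h0 h1 _ hz, sub_self, hopfFlow_zero, hm'] at h2
    rw [← h2, ← hopfFlow_intCast hl]
    congr 1
    push_cast
    ring

/-- The determination of the time on `S¹ ∖ {-c₀}` with value `s₀` at `c₀ = exp (2 π i s₀)`. -/
def circleTime (s₀ : ℝ) (c : Circle) : ℝ :=
  s₀ + Complex.arg (c * (Circle.exp (-(2 * Real.pi * s₀)) : Circle) : ℂ) / (2 * Real.pi)

theorem exp_circleTime (s₀ : ℝ) (c : Circle) :
    Circle.exp (2 * Real.pi * circleTime s₀ c) = c := by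
  have h : 2 * Real.pi * circleTime s₀ c =
      2 * Real.pi * s₀ + Complex.arg ((c * Circle.exp (-(2 * Real.pi * s₀)) : Circle) : ℂ) := by
    rw [circleTime, Circle.coe_mul]
    field_simp
  rw [h, Circle.exp_add, Circle.exp_arg, mul_comm c, ← mul_assoc, ← Circle.exp_add,
    add_neg_cancel, Circle.exp_zero, one_mul]

theorem circleTime_exp {s₀ s : ℝ} (h : |s - s₀| < 1 / 2) :
    circleTime s₀ (Circle.exp (2 * Real.pi * s)) = s := by
  have hp := Real.pi_pos
  rw [abs_lt] at h
  rw [circleTime, ← Circle.coe_mul, ← Circle.exp_add, Circle.arg_exp]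
  · field_simp
    ring
  · nlinarith
  · nlinarith

theorem isLocalDiffeomorphAt_hopfCover (h0 : 0 < ‖l‖) (h1 : ‖l‖ < 1) {z₀ : C2} (hz₀ : z₀ ≠ 0) :
    IsLocalDiffeomorphAt 𝓘(ℝ, C2) ((𝓡 3).prod (𝓡 1)) ∞ (hopfCover h0 h1) z₀ := by
  set s₀ := hopfTime l z₀
  have hp := Real.pi_pos
  have hcont : Continuous fun c : Circle =>
      (c * (Circle.exp (-(2 * Real.pi * s₀)) : Circle) : ℂ) := by fun_prop
  refine ⟨{ toFun := hopfCover h0 h1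
            invFun := fun x => hopfLift l (circleTime s₀ x.2) x.1
            -- Times within `1 / 2` of `s₀` correspond to arguments in `(-π, π)`, where the
            -- determination of the circle coordinate is smooth.
            source := {0}ᶜ ∩ {z | |hopfTime l z - s₀| < 1 / 2}
            target := {x | (x.2 * (Circle.exp (-(2 * Real.pi * s₀)) : Circle) : ℂ) ∈
              Complex.slitPlane}
            map_source' := ?_
            map_target' := ?_
            left_inv' := ?_
            right_inv' := ?_
            open_source := ?_
            open_target := Complex.isOpen_slitPlane.preimage (hcont.comp continuous_snd)
            contMDiffOn_toFun := ?_
            contMDiffOn_invFun := ?_ }, ⟨hz₀, ?_⟩, fun w _ => rfl⟩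
  · rintro z ⟨hz, hs⟩
    have hs' := abs_lt.1 (show |hopfTime l z - s₀| < 1 / 2 from hs)
    rw [Set.mem_ofPred_eq, hopfCover, ← Circle.coe_mul, ← Circle.exp_add,
      Complex.mem_slitPlane_iff_arg, Circle.arg_exp (by nlinarith) (by nlinarith)]
    exact ⟨by nlinarith, Circle.coe_ne_zero _⟩
  · rintro ⟨x, c⟩ hx
    refine ⟨hopfLift_ne_zero _ _, ?_⟩
    have hx' := (Complex.mem_slitPlane_iff_arg.1 hx).1
    have h2 := lt_of_le_of_ne (Complex.arg_le_pi _) hx'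
    have h3 := Complex.neg_pi_lt_arg (c * (Circle.exp (-(2 * Real.pi * s₀)) : Circle) : ℂ)
    rw [Set.mem_ofPred_eq, hopfTime_hopfLift h0 h1, circleTime, add_sub_cancel_left, abs_lt,
      lt_div_iff₀ (by positivity), div_lt_iff₀ (by positivity)]
    constructor <;> linarith
  · rintro z ⟨hz, hs⟩
    change hopfLift l (circleTime s₀ (Circle.exp _)) (sphereProj h0 h1 z) = z
    rw [circleTime_exp hs, hopfLift_sphereProj h0 h1 _ hz, sub_self, hopfFlow_zero]
  · rintro ⟨x, c⟩ -
    rw [hopfCover_hopfLift, exp_circleTime]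
  · rw [isOpen_iff_mem_nhds]
    rintro z ⟨hz, hs⟩
    refine Filter.inter_mem (isOpen_compl_singleton.mem_nhds hz) ?_
    have : ContinuousAt (fun z => |hopfTime l z - s₀|) z :=
      ((contDiffAt_hopfTime hz).continuousAt.sub continuousAt_const).abs
    exact this.eventually (gt_mem_nhds hs)
  · rintro z ⟨hz, -⟩
    refine ContMDiffAt.contMDiffWithinAt ((contMDiffAt_sphereProj h0 h1 hz).prodMk ?_)
    exact (contMDiff_circleExp _).comp z
      ((contDiffAt_const.mul (contDiffAt_hopfTime hz)).contMDiffAt)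
  · rintro ⟨x, c⟩ hx
    refine ContMDiffAt.contMDiffWithinAt ?_
    have : Fact (Module.finrank ℝ ℂ = 1 + 1) := Complex.finrank_real_complex_fact
    have : Fact (Module.finrank ℝ (EuclideanSpace ℝ (Fin 4)) = 3 + 1) :=
      ⟨finrank_euclideanSpace_fin⟩
    have hcirc : ContMDiff (𝓡 1) 𝓘(ℝ, ℂ) ∞ (fun c : Circle => (c : ℂ)) := contMDiff_coe_sphere
    have hlog : ContDiffAt ℝ ∞ (fun w : ℂ => s₀ +
        Complex.arg (w * (Circle.exp (-(2 * Real.pi * s₀)) : Circle)) / (2 * Real.pi)) (c : ℂ) := by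
      refine contDiffAt_const.add (ContDiffAt.div_const ?_ _)
      have h2 : ContDiffAt ℝ ∞ (fun w : ℂ => (Complex.log w).im)
          (c * (Circle.exp (-(2 * Real.pi * s₀)) : Circle) : ℂ) :=
        Complex.imCLM.contDiff.contDiffAt.comp _ ((Complex.contDiffAt_log hx).restrict_scalars ℝ)
      simp only [Complex.log_im] at h2
      exact ContDiffAt.comp (g := Complex.arg)
        (f := fun w : ℂ => w * (Circle.exp (-(2 * Real.pi * s₀)) : Circle)) _ h2
        (contDiffAt_id.mul contDiffAt_const)
    have htime : ContMDiffAt ((𝓡 3).prod (𝓡 1)) 𝓘(ℝ, ℝ) ∞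
        (fun x : SphereTimesCircle => circleTime s₀ x.2) (x, c) :=
      ContMDiffAt.comp (g := fun w : ℂ => s₀ +
        Complex.arg (w * (Circle.exp (-(2 * Real.pi * s₀)) : Circle)) / (2 * Real.pi)) (x, c)
        hlog.contMDiffAt ((hcirc c).comp (x, c) contMDiffAt_snd)
    have hsph : ContMDiffAt ((𝓡 3).prod (𝓡 1)) 𝓘(ℝ, C2) ∞
        (fun x : SphereTimesCircle => realCoords.symm x.1) (x, c) :=
      realCoords.symm.contDiff.contMDiff.contMDiffAt.comp (x, c)
        ((contMDiff_coe_sphere x).comp (x, c) contMDiffAt_fst)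
    exact (contDiff_hopfFlow (l := l)).contMDiff.contMDiffAt.comp (x, c)
      (htime.prodMk_space hsph)
  · simp [s₀]

theorem isParam_hopfCover (h0 : 0 < ‖l‖) (h1 : ‖l‖ < 1) :
    IsParam ((𝓡 3).prod (𝓡 1)) (hopfCover h0 h1) := by
  refine ⟨fun z hz => isLocalDiffeomorphAt_hopfCover h0 h1 hz, fun ⟨x, c⟩ => ?_⟩
  refine ⟨hopfLift l (circleTime 0 c) x, hopfLift_ne_zero _ _, ?_⟩
  rw [hopfCover_hopfLift, exp_circleTime]

end Cover

theorem proposition1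
    (o : ManifoldOrientation (Fin 2 × Fin 2) ((𝓡 3).prod (𝓡 1)) SphereTimesCircle) :
    IsEmpty (AnalyticSpaceStructure (TeichmullerSpace o)) ∧
    ¬ IsLocallyHausdorff (TeichmullerSpace o) ∧
    ∀ l : ℂ, 0 < ‖l‖ → ‖l‖ < 1 →
      (∃ J : ComplexStructure o, IsBiholomorphicToHopf J (!![l, 0; 0, l] : Matrix _ _ ℂ).mulVec) ∧
      ∀ J₀ : ComplexStructure o,
        IsBiholomorphicToHopf J₀ (!![l, 0; 0, l] : Matrix _ _ ℂ).mulVec →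
        IsEmpty (AnalyticSpaceStructure (TeichmullerComponent J₀)) ∧
        ¬ IsLocallyHausdorff (TeichmullerComponent J₀) ∧
        ∃ J₁ : connectedComponent J₀,
          IsBiholomorphicToHopf J₁.1 (!![l, 1; 0, l] : Matrix _ _ ℂ).mulVec ∧
          TeichmullerSpace.mk J₀ ≠ TeichmullerSpace.mk J₁.1 ∧
          ¬ Disjoint (𝓝 (TeichmullerSpace.mk J₀)) (𝓝 (TeichmullerSpace.mk J₁.1)) ∧
          ∀ U ∈ 𝓝 (TeichmullerComponent.mk (⟨J₀, mem_connectedComponent⟩ : connectedComponent J₀)),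
            TeichmullerComponent.mk J₁ ∈ U := by
  have hex : ∀ l : ℂ, 0 < ‖l‖ → ‖l‖ < 1 → ∃ J : ComplexStructure o,
      IsBiholomorphicToHopf J (!![l, 0; 0, l] : Matrix _ _ ℂ).mulVec := fun l h0 h1 =>
    (isScalarCover_hopfCover h0 h1).exists_isBiholomorphicToHopf o h0 h1 (isParam_hopfCover h0 h1)
  have hnot : ¬ IsLocallyHausdorff (TeichmullerSpace o) := by
    have h0 : 0 < ‖(1 / 2 : ℂ)‖ := by norm_num
    have h1 : ‖(1 / 2 : ℂ)‖ < 1 := by norm_num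
    obtain ⟨J₀, hJ₀⟩ := hex _ h0 h1
    obtain ⟨J, hJ, -, -⟩ := exists_degeneration h0 h1 hJ₀
    exact hJ.not_isLocallyHausdorff
  refine ⟨⟨fun S => hnot S.isLocallyHausdorff⟩, hnot, fun l h0 h1 => ⟨hex l h0 h1, ?_⟩⟩
  intro J₀ hJ₀
  obtain ⟨J, hJ, rfl, hJ1⟩ := exists_degeneration h0 h1 hJ₀
  exact ⟨⟨fun S => hJ.not_isLocallyHausdorff_component S.isLocallyHausdorff⟩,
    hJ.not_isLocallyHausdorff_component, ⟨J 1, hJ.mem_connectedComponent 1⟩, hJ1, hJ.mk_ne,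
    hJ.not_disjoint_nhds, fun U hU => hJ.mem_of_mem_nhds hU⟩

end
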